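/- **Conventions.** $ZFC^-$ is $ZFC$ without powerset, with collection in place of replacement and with the well-ordering principle as the axiom of choice. $\mathcal{B}$ is a complete Boolean algebra, $\mathcal{B}_+$ the set of its nonzero elements, and $\mathcal{U}$ an ultrafilter on $\mathcal{B}$. A *$\mathcal{B}$-valued $\mathcal{L}$-structure* is a set $\mathbf{M}$ with a map $\varphi\mapsto\|\varphi\|_{\mathbf M}\in\mathcal B$ on the $\mathcal{L}$-sentences with parameters from $\mathbf{M}$ such that logically valid sentences have value $1$, $\|\lnot\varphi\|=\lnot\|\varphi\|$, $\|\varphi\wedge\psi\|=\|\varphi\|\wedge\|\psi\|$, $\|\exists x\,\varphi(x)\|=\bigvee_{a\in\mathbf{M}}\|\varphi(a)\|$, and $\|a=b\|<1$ for $a\neq b$; it is *full* if these suprema are attained. Elementary embeddings preserve $\|\cdot\|$; ordinary structures are viewed as $\{0,1\}$-valued ones. $\mathbf{N}$ is *$\lambda^+$-saturated* if for all $\mathbf{M}_0\preceq\mathbf{N}$ and $\mathbf{M}_0\preceq\mathbf{M}_1$ with $|\mathbf{M}_0|,|\mathbf{M}_1|\le\lambda$ there is an elementary embedding of $\mathbf{M}_1$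 into $\mathbf{N}$ over $\mathbf{M}_0$. For full $\mathbf{M}$, the specialization $\mathbf{M}/\mathcal{U}$ is the ordinary structure on the classes $[a]_{\mathcal U}$ of the relation $\|a=b\|\in\mathcal{U}$, so that $\mathbf{M}/\mathcal{U}\models\varphi([\overline a]_{\mathcal U})$ iff $\|\varphi(\overline a)\|_{\mathbf M}\in\mathcal{U}$. A *pattern* on $I$ is a family $\Delta\subseteq[I]^{<\aleph_0}$ closed under subsets. A *$J$-distribution* in $\mathcal{B}$ is a map $\mathbf{A}:[J]^{<\aleph_0}\to\mathcal{B}_+$ with $\mathbf{A}(\emptyset)=1$ and $\mathbf{A}(t)\le\mathbf{A}(s)$ for $s\subseteq t$; it is *in $\mathcal{U}$* if all its values are in $\mathcal{U}$, and *multiplicative* if $\mathbf{A}(s)=\bigwedge_{j\in s}\mathbf{A}(\{j\})$ for all $s$; $\mathbf{B}$ *refines* $\mathbf{A}$ if $\mathbf{B}(s)\le\mathbf{A}(s)$ for all $s$. $\mathbf{A}$ is a *$(J,\Delta)$-distribution* if for all $s\in[J]^{<\aleph_0}$ and $\mathbf{c}\in\mathcal{B}_+$ such that $\mathbf{c}\le\mathbf{A}(t)$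 or $\mathbf{c}\le\lnot\mathbf{A}(t)$ for every $t\subseteq s$, there is $f:s\to I$ such that for all $t\subseteq s$: $\mathbf{c}\le\mathbf{A}(t)$ iff $f[t]\in\Delta$. Let $\lambda_{\mathcal{U}}(\Delta)$ be the least cardinal $\lambda$ such that some $(\lambda,\Delta)$-distribution in $\mathcal{U}$ has no multiplicative refinement in $\mathcal{U}$ ($\infty$ if there is none). If $V\models ZFC^-$ is a transitive set, $\mathbf{j}:V\preceq\hat V$, and $\Delta\in V$ is a pattern on $I\in V$, let $\lambda_{\hat V}(\Delta)$ be the least cardinal $\lambda$ such that there is a set $X$ of $\hat\in$-elements of $\mathbf{j}(I)$ with $|X|\le\lambda$ that is pseudofinite (all its members are $\hat\in$-elements of one $\hat Y\in\hat V$ that is finite in the sense of $\hat V$), such that every finite subset of $X$ is (coded by) an $\hat\in$-element of $\mathbf{j}(\Delta)$, but no $\hat X\,\hat\in\,\mathbf{j}(\Delta)$ contains all members of $X$ ($\infty$ if there is no such $\lambda$). For a complete theory $T$ in a countable language, $\mathcal{U}$ *$\lambda^+$-saturates* $T$ if there is a $\lambda^+$-saturated full $\mathcal{B}$-valued model $\mathbf{M}$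 of $T$ with $\mathbf{M}/\mathcal{U}$ $\lambda^+$-saturated; $\lambda_{\mathcal{U}}(T)$ is the least infinite cardinal $\lambda$ such that $\mathcal{U}$ does not $\lambda^+$-saturate $T$ ($\infty$ if there is none). For $M\models T$ and a formula $\varphi(\overline x,\overline y)$ let $\lambda_{\mathcal{U}}(T,\varphi)=\lambda_{\mathcal{U}}(\Delta_{M,\varphi})$, where $\Delta_{M,\varphi}=\{s\in[M^{|\overline y|}]^{<\aleph_0}: M\models\exists\overline x\bigwedge_{\overline a\in s}\varphi(\overline x,\overline a)\}$. **Theorem.** Let $\mathcal{U}$ be an ultrafilter on the complete Boolean algebra $\mathcal{B}$. 1. Let $\lambda$ be a cardinal, $V\models ZFC^-$ a transitive set, $\mathbf{V}$ a full $\lambda^+$-saturated $\mathcal{B}$-valued structure with an elementary embedding $\mathbf{i}:V\preceq\mathbf{V}$, and $\Delta\in V$ a pattern on $I\in V$. Then $\lambda<\lambda_{\mathcal{U}}(\Delta)$ if and only if $\lambda<\lambda_{\mathbf{V}/\mathcal{U}}(\Delta)$, where the latter is computed with $\mathbf{j}=[\cdot]_{\mathcal{U}}\circ\mathbf{i}:V\preceq\mathbf{V}/\mathcal{U}$.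 2. Let $T$ be a complete theory in a countable language, and compute the cardinals $\lambda_{\mathcal U}(T,\varphi)$ in an arbitrary model $M\models T$. Then $\lambda_{\mathcal{U}}(T)$ is the minimum of all $\lambda_{\mathcal{U}}(T,\varphi(\overline x,\overline y))$, for $\varphi(\overline x,\overline y)$ a formula of $T$; this is the same as the minimum of all $\lambda_{\mathcal{U}}(T,\varphi(x,\overline y))$ with $x$ a single variable. -/

import Mathlib

universe u v w

open FirstOrder FirstOrder.Language Cardinal

namespace BVPatterns

noncomputable section

/-! ## Boolean-valued structures -/

/-- An ultrafilter on a Boolean algebra: a filter containing exactly one of `b`, `bᶜ` for each `b`.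
(It is proper, as it contains `⊤` and hence not `⊥`.) -/
def IsUltrafilter {B : Type*} [BooleanAlgebra B] (U : Order.PFilter B) : Prop :=
  ∀ b : B, bᶜ ∈ U ↔ b ∉ U

/-- `φ(a)`, where the formula `φ(x)` has parameters from `M`, one free variable `x`, and `a : M`. -/
def inst {L : FirstOrder.Language} {M : Type*} (φ : L.BoundedFormula M 1) (a : M) : L.Formula M :=
  φ.toFormula.relabel (Sum.elim id fun _ => a)

/-- The formula `a = b`, with parameters `a` and `b`. -/
def eqF (L : FirstOrder.Language) {M : Type*} (a b : M) : L.Formula M :=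
  (Term.var a).equal (Term.var b)

/-- The formula `f(a) = b`, with parameters `a` and `b`. -/
def funF {L : FirstOrder.Language} {M : Type*} {n : ℕ} (f : L.Functions n) (a : Fin n → M) (b : M) :
    L.Formula M :=
  (Term.func f fun k => Term.var (a k)).equal (Term.var b)

/-- The formula `R(a)`, with parameters `a`. -/
def relF {L : FirstOrder.Language} {M : Type*} {n : ℕ} (R : L.Relations n) (a : Fin n → M) : L.Formula M :=
  R.formula fun k => Term.var (a k)

/-- A `B`-valued `L`-structure with domain `M`. A formula with parameters from `M` is an element of
`L.Formula M`, that is, a formula whose free variables are the elements of `M`. -/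
structure BVStructure (L : FirstOrder.Language) (B : Type*) [CompleteBooleanAlgebra B] (M : Type*) where
  /-- the value `‖φ‖` -/
  val : L.Formula M → B
  val_valid : ∀ φ : L.Formula M, ((∅ : L.Theory) ⊨ᵇ φ) → val φ = ⊤
  val_not : ∀ φ : L.Formula M, val (BoundedFormula.not φ) = (val φ)ᶜ
  val_and : ∀ φ ψ : L.Formula M, val (φ ⊓ ψ) = val φ ⊓ val ψ
  val_ex : ∀ φ : L.BoundedFormula M 1, IsLUB (Set.range fun a : M => val (inst φ a)) (val φ.ex)
  val_eq_lt : ∀ a b : M, a ≠ b → val (eqF L a b) < ⊤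

/-- A `B`-valued structure is full if the suprema in the clause for `∃` are attained. -/
structure FullBVStructure (L : FirstOrder.Language) (B : Type*) [CompleteBooleanAlgebra B] (M : Type*) extends
    BVStructure L B M where
  full : ∀ φ : L.BoundedFormula M 1, ∃ a : M, val (inst φ a) = val φ.ex

/-- Elementary embeddings between `B`-valued structures. -/
def BVStructure.IsElementary {L : FirstOrder.Language} {B : Type*} [CompleteBooleanAlgebra B] {M N : Type*}
    (S : BVStructure L B M) (S' : BVStructure L B N) (f : M → N) : Prop :=
  ∀ φ : L.Formula M, S'.val (φ.relabel f) = S.val φ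

/-- Elementary embeddings of an ordinary `L`-structure `M`, viewed as a `{0, 1}`-valued one, into a
`B`-valued structure: true formulas have value `1` (hence false ones value `0`). -/
def IsElementaryInto {L : FirstOrder.Language} {B : Type*} [CompleteBooleanAlgebra B] {M N : Type*}
    [L.Structure M] (S' : BVStructure L B N) (f : M → N) : Prop :=
  ∀ φ : L.Formula M, φ.Realize id → S'.val (φ.relabel f) = ⊤

/-- `κ⁺`-saturation of a `B`-valued structure `S'`: for all `P ≼ S'` and `Q ≽ P` of cardinality
at most `κ`, the inclusion of `P` in `S'` extends to an elementary embedding of `Q` in `S'`.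
The inclusions `P ≼ S'` and `P ≼ Q` are written as elementary embeddings
(which are automatically injective if `B` is nontrivial). -/
def BVStructure.IsSuccSaturated {L : FirstOrder.Language.{v, w}} {B : Type*} [CompleteBooleanAlgebra B]
    {N : Type u} (S' : BVStructure L B N) (κ : Cardinal.{u}) : Prop :=
  ∀ (M₀ M₁ : Type u) (P : BVStructure L B M₀) (Q : BVStructure L B M₁)
    (e₀ : M₀ → N) (e₁ : M₀ → M₁), #M₀ ≤ κ → #M₁ ≤ κ →
    P.IsElementary S' e₀ → P.IsElementary Q e₁ →
    ∃ f : M₁ → N, Q.IsElementary S' f ∧ ∀ a, f (e₁ a) = e₀ a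

/-- `S` is a `B`-valued model of `T`. -/
def BVStructure.IsModel {L : FirstOrder.Language} {B : Type*} [CompleteBooleanAlgebra B] {M : Type*}
    (S : BVStructure L B M) (T : L.Theory) : Prop :=
  ∀ σ ∈ T, S.val (Formula.relabel (Empty.elim : Empty → M) σ) = ⊤

/-! ## The specialization of a full Boolean-valued structure at an ultrafilter -/

section Specialization

variable {L : FirstOrder.Language} {B : Type*} [CompleteBooleanAlgebra B] {M : Type*}

theorem BVStructure.val_le_of_imp (S : BVStructure L B M) {φ ψ : L.Formula M}
    (h : (∅ : L.Theory) ⊨ᵇ (BoundedFormula.imp φ ψ : L.Formula M)) : S.val φ ≤ S.val ψ := by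
  have h1 : S.val (BoundedFormula.not (φ ⊓ BoundedFormula.not ψ)) = ⊤ := by
    apply S.val_valid
    intro N v xs
    have := h N v xs
    simp only [BoundedFormula.realize_imp, BoundedFormula.realize_not,
      BoundedFormula.realize_inf] at this ⊢
    tauto
  rw [S.val_not, S.val_and, S.val_not, compl_eq_top] at h1
  rwa [← sdiff_eq, sdiff_eq_bot_iff] at h1

theorem BVStructure.eqF_equivalence (S : BVStructure L B M) (U : Order.PFilter B) :
    Equivalence fun a b : M => S.val (eqF L a b) ∈ U where
  refl a := by
    have h : S.val (eqF L a a) = ⊤ := S.val_valid _ fun N v xs => by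
      simp [eqF, Language.Term.equal]
    rw [h]
    exact U.top_mem
  symm {a b} h := U.mem_of_le (S.val_le_of_imp fun N v xs => by
    simp only [eqF, Term.equal, BoundedFormula.realize_imp, BoundedFormula.realize_bdEqual,
      Term.realize_relabel, Term.realize_var]
    exact fun h => h.symm) h
  trans {a b c} h h' := U.mem_of_le
    ((S.val_and _ _).ge.trans (S.val_le_of_imp fun N v xs => by
      simp only [eqF, Term.equal, BoundedFormula.realize_imp, BoundedFormula.realize_inf,
        BoundedFormula.realize_bdEqual, Term.realize_relabel, Term.realize_var]
      exact fun h => h.1.trans h.2)) (U.inf_mem h h')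

/-- `a ~ b` if `‖a = b‖ ∈ U`. -/
def BVStructure.setoid (S : BVStructure L B M) (U : Order.PFilter B) : Setoid M where
  r a b := S.val (eqF L a b) ∈ U
  iseqv := S.eqF_equivalence U

/-- The domain of the specialization `S / U`. -/
def FullBVStructure.Spec (S : FullBVStructure L B M) (U : Order.PFilter B) :=
  Quotient (S.setoid U)

/-- The canonical surjection onto the specialization. -/
def FullBVStructure.toSpec (S : FullBVStructure L B M) (U : Order.PFilter B) (a : M) : S.Spec U :=
  Quotient.mk (S.setoid U) a

theorem FullBVStructure.exists_funF (S : FullBVStructure L B M) {n : ℕ} (f : L.Functions n)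
    (a : Fin n → M) : ∃ b, S.val (funF f a b) = ⊤ := by
  let φ : L.BoundedFormula M 1 :=
    (Term.func f fun k => Term.var (Sum.inl (a k))).bdEqual (Term.var (Sum.inr 0))
  obtain ⟨b, hb⟩ := S.full φ
  have h : S.val φ.ex = ⊤ := S.val_valid _ fun N v xs => by
    simp only [φ, Language.BoundedFormula.realize_ex]
    exact ⟨Language.Structure.funMap f fun k => v (a k), by simp [Fin.snoc]⟩
  refine ⟨b, top_unique (le_trans (h.ge.trans hb.ge) (S.val_le_of_imp fun N v xs => ?_))⟩
  have e1 := BoundedFormula.realize_toFormula φ (M := N) (v ∘ Sum.elim id fun _ => b)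
  have e2 := Formula.realize_relabel (φ := φ.toFormula)
    (g := (Sum.elim id fun _ => b : M ⊕ Fin 1 → M)) (v := v)
  rw [Subsingleton.elim xs default, BoundedFormula.realize_imp]
  intro h
  have h := e1.1 (e2.1 h)
  simpa [φ, funF, Term.equal] using h

/-- The specialization `S / U`: `f([a]) = [b]` if `‖f(a) = b‖ ∈ U`, and `R([a])` holds if
`‖R(a)‖ ∈ U`. (The choice of representatives and of `b` with `‖f(a) = b‖ = 1` is immaterial.) -/
instance FullBVStructure.specStructure (S : FullBVStructure L B M) (U : Order.PFilter B) :
    L.Structure (S.Spec U) where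
  funMap f x := S.toSpec U (S.exists_funF f fun k => (x k).out).choose
  RelMap R x := S.val (relF R fun k => (x k).out) ∈ U

end Specialization

/-- The ordinary `L`-structure `N` is `κ⁺`-saturated: for every `A ⊆ N` with `|A| ≤ κ`, every
finitely satisfiable set of formulas `φ(x)` over `A` is realized in `N`. -/
def IsSuccSaturated (L : FirstOrder.Language.{v, w}) (N : Type u) [L.Structure N] (κ : Cardinal.{u}) : Prop :=
  ∀ A : Set N, #A ≤ κ → ∀ p : Set (L.Formula (A ⊕ Unit)),
    (∀ s : Finset (L.Formula (A ⊕ Unit)), ↑s ⊆ p →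
      ∃ x : N, ∀ φ ∈ s, φ.Realize (Sum.elim (fun a : A => (a : N)) fun _ => x)) →
    ∃ x : N, ∀ φ ∈ p, φ.Realize (Sum.elim (fun a : A => (a : N)) fun _ => x)

/-- `U` `κ⁺`-saturates `T`: some `κ⁺`-saturated full `B`-valued model of `T` has a `κ⁺`-saturated
specialization at `U`. -/
def SuccSaturates {B : Type u} [CompleteBooleanAlgebra B] (U : Order.PFilter B) {L : FirstOrder.Language.{v, w}}
    (T : L.Theory) (κ : Cardinal.{u}) : Prop :=
  ∃ (M : Type u) (S : FullBVStructure L B M),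
    S.IsModel T ∧ S.IsSuccSaturated κ ∧ IsSuccSaturated L (S.Spec U) κ

/-! ## Models of `ZFC⁻` -/

/-- The only symbol of the language of set theory is a binary relation symbol. -/
inductive SetRel : ℕ → Type
  | mem : SetRel 2

/-- The language of set theory. -/
def setLang : FirstOrder.Language.{0, 0} := ⟨fun _ => Empty, SetRel⟩

section Internal

variable {M : Type*} [setLang.Structure M]

/-- The membership relation of a structure in the language of set theory. -/
def E (x y : M) : Prop :=
  Structure.RelMap (L := setLang) SetRel.mem ![x, y]

/-- `z = {x, y}` -/
def IsUPair (z x y : M) : Prop := ∀ t, E t z ↔ t = x ∨ t = y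

/-- `p` is the ordered pair `(x, y) = {{x}, {x, y}}`. -/
def IsOPair (p x y : M) : Prop := ∃ a b, IsUPair a x x ∧ IsUPair b x y ∧ IsUPair p a b

/-- `(x, y) ∈ r` -/
def Rel (r x y : M) : Prop := ∃ p, IsOPair p x y ∧ E p r

/-- `n` is a natural number: a transitive set linearly ordered by membership (so, by foundation, an
ordinal), such that each nonempty `m ∈ n ∪ {n}` is a successor `k ∪ {k}`. -/
def IsNat (n : M) : Prop :=
  (∀ x y, E x n → E y x → E y n) ∧
  (∀ x y, E x n → E y n → E x y ∨ x = y ∨ E y x) ∧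
  ∀ m, (E m n ∨ m = n) → (∃ y, E y m) → ∃ k, ∀ z, E z m ↔ E z k ∨ z = k

/-- The relation `f` restricts to a bijection from `x` to `y`. -/
def IsBij (f x y : M) : Prop :=
  (∀ s, E s x → ∃! t, E t y ∧ Rel f s t) ∧ ∀ t, E t y → ∃! s, E s x ∧ Rel f s t

/-- `x` is finite in the sense of the structure. -/
def IsFin (x : M) : Prop := ∃ n f, IsNat n ∧ IsBij f x n

/-- `r` is a well-ordering of `x`. -/
def IsWellOrdering (r x : M) : Prop :=
  (∀ a, E a x → ¬ Rel r a a) ∧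
  (∀ a b c, E a x → E b x → E c x → Rel r a b → Rel r b c → Rel r a c) ∧
  (∀ a b, E a x → E b x → Rel r a b ∨ a = b ∨ Rel r b a) ∧
  ∀ y, (∀ a, E a y → E a x) → (∃ a, E a y) → ∃ m, E m y ∧ ∀ a, E a y → m = a ∨ Rel r m a

/-- A subset `X` of a model of set theory is pseudofinite if it is covered by an element of the
model that is finite in the sense of the model. -/
def IsPseudofinite (X : Set M) : Prop := ∃ y : M, IsFin y ∧ ∀ x ∈ X, E x y

end Internal

/-- `M` is a model of `ZFC⁻`: `ZFC` without powerset, with collection instead of replacement, and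
with the well-ordering principle as the axiom of choice. Instances of the schemes correspond to
subsets and relations that are definable with parameters. -/
structure IsModelZFCMinus (M : Type*) [setLang.Structure M] : Prop where
  extensionality : ∀ x y : M, (∀ z, E z x ↔ E z y) → x = y
  foundation : ∀ x : M, (∃ y, E y x) → ∃ y, E y x ∧ ∀ z, E z x → ¬ E z y
  pairing : ∀ x y : M, ∃ z, E x z ∧ E y z
  union : ∀ x : M, ∃ t, ∀ y z, E y x → E z y → E z t
  infinity : ∃ t : M, (∃ e, E e t ∧ ∀ z, ¬ E z e) ∧
    ∀ x, E x t → ∃ y, E y t ∧ ∀ z, E z y ↔ E z x ∨ z = x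
  separation : ∀ D : Set M, Set.univ.Definable₁ setLang D →
    ∀ a : M, ∃ b, ∀ x, E x b ↔ E x a ∧ x ∈ D
  collection : ∀ R : Set (M × M), Set.univ.Definable₂ setLang R →
    ∀ a : M, (∀ x, E x a → ∃ y, (x, y) ∈ R) → ∃ b, ∀ x, E x a → ∃ y, E y b ∧ (x, y) ∈ R
  well_ordering : ∀ x : M, ∃ r, IsWellOrdering r x

/-- A set `V`, viewed as a structure with the true membership relation. -/
instance setStructure (V : ZFSet.{u}) : setLang.Structure V where
  funMap f := f.elim
  RelMap {_} R := match R with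
    | SetRel.mem => fun x => (x 0 : ZFSet.{u}) ∈ (x 1 : ZFSet.{u})

/-! ## Patterns and distributions -/

/-- A pattern on `I` is a set of finite subsets of `I` that is closed under subsets. -/
structure Pattern (I : Type*) where
  carrier : Set (Finset I)
  down_closed : ∀ s ∈ carrier, ∀ t, t ⊆ s → t ∈ carrier

/-- The pattern `Δ_{M, φ}` on the tuples `y` from `M`, for `φ = φ(x, y)`: finite sets `s` with
`M ⊨ ∃ x ⋀_{a ∈ s} φ(x, a)`. -/
def formulaPattern {L : FirstOrder.Language} (M : Type*) [L.Structure M] {n m : ℕ}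
    (φ : L.Formula (Fin n ⊕ Fin m)) : Pattern (Fin m → M) where
  carrier := {s | ∃ x : Fin n → M, ∀ a ∈ s, φ.Realize (Sum.elim x a)}
  down_closed := fun _ ⟨x, hx⟩ _ hts => ⟨x, fun a ha => hx a (hts ha)⟩

/-- The set `Δ` is a pattern on the set `I`. -/
def IsPatternOn (Δ I : ZFSet.{u}) : Prop :=
  (∀ s ∈ Δ, s ⊆ I ∧ {x : ZFSet.{u} | x ∈ s}.Finite) ∧ ∀ s ∈ Δ, ∀ t, t ⊆ s → t ∈ Δ

/-- A set that is a pattern on the set `I`, as a pattern on the type of elements of `I`. -/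
def setPattern {Δ I : ZFSet.{u}} (h : IsPatternOn Δ I) : Pattern I where
  carrier := {s | ∃ d ∈ Δ, ∀ x : ZFSet.{u}, x ∈ d ↔ ∃ y ∈ s, (y : ZFSet.{u}) = x}
  down_closed := by
    rintro s ⟨d, hd, hs⟩ t hts
    refine ⟨ZFSet.sep (fun x => ∃ y ∈ t, (y : ZFSet.{u}) = x) d,
      h.2 d hd _ (ZFSet.sep_subset), fun x => ?_⟩
    rw [ZFSet.mem_sep, hs]
    exact ⟨fun hx => hx.2, fun ⟨y, hy, e⟩ => ⟨⟨y, hts hy, e⟩, y, hy, e⟩⟩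

section Distributions

variable {B : Type*} [CompleteBooleanAlgebra B] {I J : Type*}

/-- `A` is a `J`-distribution in `B`. -/
structure IsDistribution (A : Finset J → B) : Prop where
  pos : ∀ s, A s ≠ ⊥
  empty : A ∅ = ⊤
  anti : ∀ s t, s ⊆ t → A t ≤ A s

/-- `A` is multiplicative. -/
def IsMultiplicative (A : Finset J → B) : Prop := ∀ s, A s = s.inf fun j => A {j}

open Classical in
/-- `A` is a `(J, Δ)`-distribution in `B`. (The map `f` only matters on `s`.) -/
def IsPatternDistribution (Δ : Pattern I) (A : Finset J → B) : Prop :=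
  IsDistribution A ∧ ∀ (s : Finset J) (c : B), c ≠ ⊥ → (∀ t ⊆ s, c ≤ A t ∨ c ≤ (A t)ᶜ) →
    ∃ f : s → I, ∀ t : Finset s,
      c ≤ A (t.map (Function.Embedding.subtype _)) ↔ t.image f ∈ Δ.carrier

/-- `A` has a multiplicative refinement in `U`. -/
def HasMultiplicativeRefinement (U : Order.PFilter B) (A : Finset J → B) : Prop :=
  ∃ A' : Finset J → B, IsDistribution A' ∧ IsMultiplicative A' ∧ (∀ s, A' s ∈ U) ∧
    ∀ s, A' s ≤ A s

end Distributions

/-! ## The cardinal invariants (with `⊤` in the role of `∞`) -/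

/-- `λ_U(Δ)` -/
def lambdaPattern {B : Type u} [CompleteBooleanAlgebra B] (U : Order.PFilter B) {I : Type*}
    (Δ : Pattern I) : WithTop Cardinal.{u} :=
  sInf ((↑) '' {κ : Cardinal.{u} | ∃ (J : Type u) (A : Finset J → B), #J = κ ∧
    IsPatternDistribution Δ A ∧ (∀ s, A s ∈ U) ∧ ¬ HasMultiplicativeRefinement U A})

/-- `λ_U(T)` -/
def lambdaTheory {B : Type u} [CompleteBooleanAlgebra B] (U : Order.PFilter B) {L : FirstOrder.Language.{v, w}}
    (T : L.Theory) : WithTop Cardinal.{u} :=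
  sInf ((↑) '' {κ : Cardinal.{u} | ℵ₀ ≤ κ ∧ ¬ SuccSaturates U T κ})

/-- `λ_U(T, φ) = λ_U(Δ_{M, φ})`, where `M` is a model of `T`. -/
def lambdaFormula {B : Type u} [CompleteBooleanAlgebra B] (U : Order.PFilter B) {L : FirstOrder.Language}
    (M : Type*) [L.Structure M] {n m : ℕ} (φ : L.Formula (Fin n ⊕ Fin m)) :
    WithTop Cardinal.{u} :=
  lambdaPattern U (formulaPattern M φ)

/-- `λ_W(Δ)` for `j : V ≼ W` and a pattern `Δ ∈ V` on `I ∈ V`. -/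
def lambdaModel {V : ZFSet.{u}} {W : Type u} [setLang.Structure W] (j : V → W) (Δ I : V) :
    WithTop Cardinal.{u} :=
  sInf ((↑) '' {κ : Cardinal.{u} | ∃ X : Set W, IsPseudofinite X ∧ (∀ x ∈ X, E x (j I)) ∧
    #X ≤ κ ∧ (∀ s : Finset W, ↑s ⊆ X → ∃ d : W, E d (j Δ) ∧ ∀ y, E y d ↔ y ∈ s) ∧
    ¬ ∃ d : W, E d (j Δ) ∧ ∀ x ∈ X, E x d})

end

end BVPatterns

open BVPatterns

namespace BVPatterns

noncomputable section

/-! ## Auxiliary formulas -/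

section Formulas

variable {L : FirstOrder.Language.{0, 0}} {α β : Type*}

/-! Boolean values are handled through ordinary truth. An inequality in `B` holds if it holds at
every ultrafilter (`le_of_forall_ultrafilter`), and at an ultrafilter the values of a full structure
are decided by truth in the specialization (Łoś, `FullBVStructure.realize_spec`). Conversely, a
homomorphism from a power set to `B` turns a family of ordinary structures into a full
Boolean-valued one (`exists_full_structure`, from Sikorski's extension theorem). With saturation
this gives the workhorse `FullBVStructure.exists_realization`: elements with prescribed lower bounds
on values exist as soon as finitely many bounds at a time can be met in specializations.

Part 1. A pattern distribution `A` corresponds to elements `x j` of `i I` such that `{x j : j ∈ s} ∈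
i Δ` has value `A s`. A multiplicative refinement in `U` corresponds to a `d` that is an element of
`i Δ` and contains all the `x j` at `U`: from `d` one reads off the values of `x j ∈ d`, and from a
refinement `a` one realizes the bounds `a j ≤ ‖x j ∈ d‖`.

Part 2. Saturation yields refinements in the same way, with consistency of instances of `φ` in place
of membership in `Δ`. For the converse, take a saturated model `S` (`exists_saturated`) and a type
of at most `κ` formulas `Φ (k j) (x, b j)` in one variable over the specialization. A multiplicative
refinement of its consistency values produces a realization. The hypothesis refines distributions
for one formula, hence for finitely many coded into one (`exists_refinement`); the difficulty is
that `k` may be unbounded.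

If some `ψ` has the order property, the refinements for bounded `k` are glued by an auxiliary
distribution built from `ψ` and its negation only (`exists_refinement_of_hasOrder`). Otherwise an
ultrafilter of points extending the type is decided, on finitely many formulas, by majority vote
among finitely many points (`exists_majority`). Either the consistency of all majority instances,
for each bound on `k`, has value in `U`, which gives a refinement outright, or there are arbitrarily
large minimally inconsistent systems of instances of boundedly many formulas. In the latter case,
distributions made from these simplices select an approximating point that avoids the few bad points
of each `j` (`exists_refinement_of_simplices`). -/

open Classical in
theorem realize_congr_freeVar {n : ℕ} (φ : L.BoundedFormula α n) {N : Type*} [L.Structure N]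
    {a a' : α → N} {xs : Fin n → N} (h : ∀ i ∈ φ.freeVarFinset, a i = a' i) :
    φ.Realize a xs ↔ φ.Realize a' xs := by
  rw [← BoundedFormula.realize_restrictFreeVar' (s := ↑φ.freeVarFinset) (φ := φ) subset_rfl
    (v := a), ← BoundedFormula.realize_restrictFreeVar' (s := ↑φ.freeVarFinset) (φ := φ) subset_rfl
    (v := a')]
  have : (a ∘ (↑) : ((φ.freeVarFinset : Set α)) → N) = a' ∘ (↑) := funext fun i => h i i.2
  rw [this]

open Classical in
theorem finite_inr_freeVar (φ : L.Formula (α ⊕ β)) :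
    Finite {b : β // Sum.inr b ∈ BoundedFormula.freeVarFinset φ} :=
  Finite.of_injective (fun b => (⟨Sum.inr b.1, b.2⟩ : BoundedFormula.freeVarFinset φ))
    fun _ _ h => Subtype.ext (Sum.inr_injective (congrArg Subtype.val h))

open Classical in
/-- `∃ y, φ(x, y)`, where `y` is an arbitrary family of variables. -/
def exF (φ : L.Formula (α ⊕ β)) : L.Formula α :=
  haveI := finite_inr_freeVar φ
  Formula.iExs {b : β // Sum.inr b ∈ BoundedFormula.freeVarFinset φ}
    (BoundedFormula.restrictFreeVar φ fun x => match x with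
      | ⟨.inl a, _⟩ => .inl a
      | ⟨.inr b, h⟩ => .inr ⟨b, h⟩)

-- Variables of the family that do not occur in the formula may take any value; this is where
-- nonemptiness of the structure enters.
@[simp]
theorem realize_exF (φ : L.Formula (α ⊕ β)) {N : Type*} [L.Structure N] [Nonempty N] (a : α → N) :
    (exF φ).Realize a ↔ ∃ b : β → N, φ.Realize (Sum.elim a b) := by
  classical
  have key : ∀ (c : {b : β // Sum.inr b ∈ BoundedFormula.freeVarFinset φ} → N) (b : β → N),
      (∀ i, c i = b i) → ((Formula.Realize (BoundedFormula.restrictFreeVar φ fun x => match x with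
      | ⟨.inl a, _⟩ => .inl a
      | ⟨.inr b, h⟩ => .inr ⟨b, h⟩ :
        L.Formula (α ⊕ {b : β // Sum.inr b ∈ BoundedFormula.freeVarFinset φ})) (Sum.elim a c)) ↔
        φ.Realize (Sum.elim a b)) := by
    intro c b h
    apply BoundedFormula.realize_restrictFreeVar
    rintro ⟨i | i, hi⟩
    · rfl
    · exact h ⟨i, hi⟩
  have := finite_inr_freeVar φ
  unfold exF
  rw [Formula.realize_iExs]
  constructor
  · rintro ⟨c, hc⟩
    let b : β → N := fun i =>
      if h : Sum.inr i ∈ BoundedFormula.freeVarFinset φ then c ⟨i, h⟩ else Classical.arbitrary N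
    exact ⟨b, (key c b fun i => by simp [b, i.2]).1 hc⟩
  · rintro ⟨b, hb⟩
    exact ⟨fun i => b i, (key _ b fun i => rfl).2 hb⟩

/-- `∀ y, φ(x, y)`, where `y` is an arbitrary family of variables. -/
def allF (φ : L.Formula (α ⊕ β)) : L.Formula α := (exF φ.not).not

@[simp]
theorem realize_allF (φ : L.Formula (α ⊕ β)) {N : Type*} [L.Structure N] [Nonempty N] (a : α → N) :
    (allF φ).Realize a ↔ ∀ b : β → N, φ.Realize (Sum.elim a b) := by
  simp [allF]

/-- The conjunction of a finite family of formulas. -/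
def infF {ι : Type*} (s : Finset ι) (f : ι → L.Formula α) : L.Formula α :=
  Formula.iInf fun i : s => f i

@[simp]
theorem realize_infF {ι : Type*} (s : Finset ι) (f : ι → L.Formula α) {N : Type*} [L.Structure N]
    (a : α → N) : (infF s f).Realize a ↔ ∀ i ∈ s, (f i).Realize a := by
  simp [infF]

/-- The Boolean combination of a finite family of formulas that holds if the set of those of them
that hold is in `P`. -/
def combF {ι : Type*} [Finite ι] (P : Set (Set ι)) (f : ι → L.Formula α) : L.Formula α :=
  open Classical in
  Formula.iSup fun S : P => Formula.iInf fun i => if i ∈ S.1 then f i else (f i).not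

@[simp]
theorem realize_combF {ι : Type*} [Finite ι] (P : Set (Set ι)) (f : ι → L.Formula α) {N : Type*}
    [L.Structure N] (a : α → N) : (combF P f).Realize a ↔ {i | (f i).Realize a} ∈ P := by
  classical
  simp only [combF, Formula.realize_iSup, Formula.realize_iInf]
  constructor
  · rintro ⟨S, hS⟩
    have : {i | (f i).Realize a} = S.1 := by
      ext i
      have := hS i
      by_cases hi : i ∈ S.1
      · simpa [hi] using this
      · simpa [hi] using this
    rw [this]
    exact S.2
  · intro h
    refine ⟨⟨_, h⟩, fun i => ?_⟩
    by_cases hi : (f i).Realize a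
    · simp [hi]
    · simp [hi]

/-- The formula `a = b`. -/
def eqv (a b : α) : L.Formula α := (Term.var a).equal (Term.var b)

@[simp]
theorem realize_eqv (a b : α) {N : Type*} [L.Structure N] (x : α → N) :
    (eqv a b : L.Formula α).Realize x ↔ x a = x b := by
  simp [eqv, Formula.realize_equal]

@[simp]
theorem realize_eqF (a b : α) {N : Type*} [L.Structure N] (x : α → N) :
    (eqF L a b).Realize x ↔ x a = x b := by
  simp [eqF, Formula.realize_equal]

/-- A formula with one extra variable as a formula with one bound variable. -/
def toBound (φ : L.Formula (α ⊕ Unit)) : L.BoundedFormula α 1 :=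
  BoundedFormula.relabel (Sum.map id fun _ => (0 : Fin 1)) φ

theorem realize_toBound (φ : L.Formula (α ⊕ Unit)) {N : Type*} [L.Structure N] (a : α → N)
    (xs : Fin 1 → N) : (toBound φ).Realize a xs ↔ φ.Realize (Sum.elim a fun _ => xs 0) := by
  unfold toBound
  refine (BoundedFormula.realize_relabel (m := 1) (n := 0)).trans ?_
  change BoundedFormula.Realize φ _ (fun i => xs (Fin.natAdd 1 i)) ↔ _
  rw [Formula.Realize, Subsingleton.elim (α := Fin 0 → N) (fun i => xs (Fin.natAdd 1 i)) default]
  have : Sum.elim a (xs ∘ Fin.castAdd 0) ∘ Sum.map id (fun _ => (0 : Fin 1)) =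
      (Sum.elim a fun _ => xs 0 : α ⊕ Unit → N) := by
    ext (i | i) <;> simp
  rw [this]

@[simp]
theorem realize_toBound_ex (φ : L.Formula (α ⊕ Unit)) {N : Type*} [L.Structure N] (a : α → N) :
    Formula.Realize (toBound φ).ex a ↔ ∃ x, φ.Realize (Sum.elim a fun _ => x) := by
  simp [Formula.Realize, realize_toBound, Fin.snoc]

@[simp]
theorem realize_inst (φ : L.BoundedFormula α 1) (b : α) {N : Type*} [L.Structure N] (a : α → N) :
    (inst φ b).Realize a ↔ φ.Realize a fun _ => a b := by
  unfold inst
  rw [Formula.realize_relabel, BoundedFormula.realize_toFormula]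
  exact iff_of_eq rfl

theorem realize_ex_one (φ : L.BoundedFormula α 1) {N : Type*} [L.Structure N] (a : α → N) :
    Formula.Realize φ.ex a ↔ ∃ x, φ.Realize a fun _ => x := by
  simp only [Formula.Realize, BoundedFormula.realize_ex]
  refine exists_congr fun x => ?_
  have : (Fin.snoc default x : Fin 1 → N) = fun _ => x := by
    ext i; rw [@Subsingleton.elim (Fin 1) _ i 0]; rfl
  rw [this]

/-- A formula with one bound variable as a formula with one extra variable. -/
def ofBound (φ : L.BoundedFormula α 1) : L.Formula (α ⊕ Unit) :=
  φ.toFormula.relabel (Sum.map id fun _ => ())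

@[simp]
theorem realize_ofBound (φ : L.BoundedFormula α 1) {N : Type*} [L.Structure N] (a : α ⊕ Unit → N) :
    (ofBound φ).Realize a ↔ φ.Realize (a ∘ Sum.inl) fun _ => a (Sum.inr ()) := by
  simp [ofBound, BoundedFormula.realize_toFormula, Function.comp_def]

open Classical in
/-- Rename the parameters of a formula by natural numbers. -/
def codeF (φ : L.Formula (α ⊕ β)) : L.Formula (ℕ ⊕ β) :=
  BoundedFormula.restrictFreeVar φ fun x => match x with
      | ⟨.inl a, h⟩ => .inl ((BoundedFormula.freeVarFinset φ).equivFin ⟨.inl a, h⟩)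
      | ⟨.inr b, _⟩ => .inr b

open Classical in
/-- The parameters of a formula, as a sequence. -/
def codeV [Nonempty α] (φ : L.Formula (α ⊕ β)) (n : ℕ) : α :=
  if h : n < (BoundedFormula.freeVarFinset φ).card then
    Sum.elim id (fun _ => Classical.arbitrary α)
      ((BoundedFormula.freeVarFinset φ).equivFin.symm ⟨n, h⟩).1
  else Classical.arbitrary α

theorem realize_codeF [Nonempty α] (φ : L.Formula (α ⊕ β)) {N : Type*} [L.Structure N] (a : α → N)
    (b : β → N) : (codeF φ).Realize (Sum.elim (a ∘ codeV φ) b) ↔ φ.Realize (Sum.elim a b) := by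
  classical
  unfold codeF
  apply BoundedFormula.realize_restrictFreeVar
  rintro ⟨i | i, hi⟩
  · simp [codeV]
  · simp

/-- A formula mentions finitely many variables, so an initial segment of the sequence suffices. This
leads back from sequences of parameters to the finite arities of Skolem functions and of formula
patterns. -/
theorem exists_fin_code (φ : L.Formula (β ⊕ ℕ)) : ∃ (m : ℕ) (φ' : L.Formula (β ⊕ Fin m)),
    ∀ (N : Type u) [L.Structure N] (b : β → N) (a : ℕ → N),
      φ'.Realize (Sum.elim b fun i : Fin m => a i) ↔ φ.Realize (Sum.elim b a) := by
  classical
  let m := ((BoundedFormula.freeVarFinset φ).image (Sum.elim (fun _ => 0) id)).sup id + 1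
  have hm : ∀ i, Sum.inr i ∈ BoundedFormula.freeVarFinset φ → i < m := fun i hi =>
    Nat.lt_succ_of_le (Finset.le_sup (f := id) (Finset.mem_image.2 ⟨_, hi, rfl⟩))
  refine ⟨m, BoundedFormula.restrictFreeVar φ fun x => match x with
      | ⟨.inl a, _⟩ => .inl a
      | ⟨.inr i, h⟩ => .inr ⟨i, hm i h⟩, fun N _ b a => ?_⟩
  apply BoundedFormula.realize_restrictFreeVar
  rintro ⟨i | i, hi⟩
  · rfl
  · rfl

end Formulas

/-! ## Valuations -/

section Valuations

variable {L : FirstOrder.Language.{0, 0}} {B : Type u} [CompleteBooleanAlgebra B]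
  {α β : Type u}

/-- A Boolean-valued theory in the variables `α`. -/
structure IsValuation (t : L.Formula α → B) : Prop where
  valid : ∀ φ : L.Formula α, ((∅ : L.Theory) ⊨ᵇ φ) → t φ = ⊤
  not : ∀ φ : L.Formula α, t (BoundedFormula.not φ) = (t φ)ᶜ
  and : ∀ φ ψ : L.Formula α, t (φ ⊓ ψ) = t φ ⊓ t ψ

theorem BVStructure.isValuation {M : Type u} (S : BVStructure L B M) : IsValuation S.val :=
  ⟨S.val_valid, S.val_not, S.val_and⟩

namespace IsValuation

variable {t : L.Formula α → B} (ht : IsValuation t)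
include ht

theorem mono {φ ψ : L.Formula α} (h : ∀ (N : Type u) [L.Structure N] [Nonempty N] (a : α → N),
    φ.Realize a → ψ.Realize a) : t φ ≤ t ψ := by
  have h1 : t (BoundedFormula.not (φ ⊓ BoundedFormula.not ψ)) = ⊤ := by
    apply ht.valid
    intro N v xs
    have := h N v
    rw [Subsingleton.elim xs default]
    simp only [BoundedFormula.realize_not, BoundedFormula.realize_inf]
    simp only [Formula.Realize] at this
    tauto
  rw [ht.not, ht.and, ht.not, compl_eq_top] at h1
  rwa [← sdiff_eq, sdiff_eq_bot_iff] at h1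

theorem congr {φ ψ : L.Formula α} (h : ∀ (N : Type u) [L.Structure N] [Nonempty N] (a : α → N),
    φ.Realize a ↔ ψ.Realize a) : t φ = t ψ :=
  le_antisymm (ht.mono fun N _ _ a => (h N a).1) (ht.mono fun N _ _ a => (h N a).2)

theorem eq_top {φ : L.Formula α} (h : ∀ (N : Type u) [L.Structure N] [Nonempty N] (a : α → N),
    φ.Realize a) : t φ = ⊤ :=
  ht.valid _ fun N v xs => by rw [Subsingleton.elim xs default]; exact h N v

theorem exists_realize {φ : L.Formula α} (h : t φ ≠ ⊥) : ∃ (N : Type u) (_ : L.Structure N)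
    (_ : Nonempty N) (a : α → N), φ.Realize a := by
  by_contra! hc
  apply h
  have := ht.eq_top (φ := BoundedFormula.not φ) fun N _ h a => hc N _ h a
  rwa [ht.not, compl_eq_top] at this

theorem inf_le_infF {ι : Type*} (s : Finset ι) (f : ι → L.Formula α) :
    (s.inf fun i => t (f i)) ≤ t (infF s f) := by
  classical
  induction s using Finset.induction_on with
  | empty => exact le_of_le_of_eq le_top (ht.eq_top fun N _ _ a => by simp).symm
  | insert i s hi ih =>
    rw [Finset.inf_insert]
    refine (inf_le_inf_left _ ih).trans ?_
    rw [← ht.and]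
    exact ht.mono fun N _ _ a => by
      rw [Formula.realize_inf]
      simp only [realize_infF, Finset.mem_insert, forall_eq_or_imp]
      exact id

theorem comap (g : β → α) : IsValuation fun φ : L.Formula β => t (φ.relabel g) where
  valid φ h := ht.eq_top fun N _ _ a => by
    rw [Formula.realize_relabel]; exact h.realize_formula N
  not φ := by
    rw [← ht.not]
    refine ht.congr fun N _ _ a => ?_
    refine Formula.realize_relabel.trans (Formula.realize_not.trans ?_)
    exact (not_congr Formula.realize_relabel.symm).trans Formula.realize_not.symm
  and φ ψ := by
    rw [← ht.and]
    exact ht.congr fun N _ _ a => by simp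

end IsValuation

end Valuations

/-! ## The extension theorem for homomorphisms to complete Boolean algebras -/

section Extension

variable {A : Type*} [BooleanAlgebra A] {B : Type*} [CompleteBooleanAlgebra B]

/-- A `B`-valued filter on a Boolean algebra. -/
structure IsValuedFilter (G : A → B) : Prop where
  top : G ⊤ = ⊤
  bot : G ⊥ = ⊥
  inf : ∀ x y, G (x ⊓ y) = G x ⊓ G y

theorem IsValuedFilter.mono {G : A → B} (hG : IsValuedFilter G) : Monotone G := fun x y h => by
  rw [← inf_eq_left, ← hG.inf, inf_eq_left.2 h]

/-- A maximal valued filter is a homomorphism. One can adjoin `x` to `G` with any value that leaves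
the value of `⊥` unchanged; the largest such value is `(G xᶜ)ᶜ`, and maximality gives `(G xᶜ)ᶜ ≤ G
x`. -/
theorem IsValuedFilter.exists_compl {G₀ : A → B} (h₀ : IsValuedFilter G₀) :
    ∃ G : A → B, IsValuedFilter G ∧ G₀ ≤ G ∧ ∀ x, G xᶜ = (G x)ᶜ := by
  obtain ⟨G, hG₀, hG⟩ := zorn_le_nonempty₀ {G : A → B | IsValuedFilter G} (fun c hc hch y hy => by
    refine ⟨sSup c, ⟨?_, ?_, fun x z => ?_⟩, fun z hz => le_sSup hz⟩
    · rw [sSup_apply]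
      exact top_unique ((hc hy).top.ge.trans (le_iSup (fun g : c => g.1 ⊤) ⟨y, hy⟩))
    · rw [sSup_apply]
      exact bot_unique (iSup_le fun g => (hc g.2).bot.le)
    · simp only [sSup_apply]
      apply le_antisymm
      · exact iSup_le fun g => by
          rw [(hc g.2).inf]
          exact inf_le_inf (le_iSup (fun g : c => g.1 x) g) (le_iSup (fun g : c => g.1 z) g)
      · rw [iSup_inf_iSup]
        refine iSup_le fun ⟨g, g'⟩ => ?_
        rcases hch.total g.2 g'.2 with h | h
        · refine le_trans ?_ (le_iSup (fun g : c => g.1 (x ⊓ z)) g')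
          change _ ≤ g'.1 (x ⊓ z)
          rw [(hc g'.2).inf]
          exact inf_le_inf_right _ (h x)
        · refine le_trans ?_ (le_iSup (fun g : c => g.1 (x ⊓ z)) g)
          change _ ≤ g.1 (x ⊓ z)
          rw [(hc g.2).inf]
          exact inf_le_inf_left _ (h z)) G₀ h₀
  have hGf : IsValuedFilter G := hG.1
  refine ⟨G, hGf, hG₀, fun x => ?_⟩
  have hd : G x ⊓ G xᶜ = ⊥ := by rw [← hGf.inf, inf_compl_eq_bot, hGf.bot]
  let e := (G xᶜ)ᶜ
  let G' : A → B := fun y => G y ⊔ e ⊓ G (x ⇨ y)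
  have hle : G ≤ G' := fun y => le_sup_left
  have hG' : IsValuedFilter G' := by
    refine ⟨?_, ?_, fun y z => ?_⟩
    · simp [G', hGf.top]
    · simp [G', e, hGf.bot]
    · simp only [G', himp_inf_distrib, hGf.inf]
      have hy : G y ≤ G (x ⇨ y) := hGf.mono le_himp
      have hz : G z ≤ G (x ⇨ z) := hGf.mono le_himp
      apply le_antisymm
      · refine sup_le (inf_le_inf le_sup_left le_sup_left) (le_inf ?_ ?_)
        · exact (inf_le_inf_left _ inf_le_left).trans le_sup_right
        · exact (inf_le_inf_left _ inf_le_right).trans le_sup_right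
      · rw [inf_sup_left, inf_sup_right, inf_sup_right]
        refine sup_le (sup_le le_sup_left ?_) (sup_le ?_ ?_)
        · refine le_trans ?_ le_sup_right
          exact le_inf (inf_le_left.trans inf_le_left) (inf_le_inf inf_le_right hz)
        · refine le_trans ?_ le_sup_right
          exact le_inf (inf_le_right.trans inf_le_left) (inf_le_inf hy inf_le_right)
        · refine le_trans ?_ le_sup_right
          exact le_inf (inf_le_left.trans inf_le_left) (inf_le_inf inf_le_right inf_le_right)
  have hm : G' x ≤ G x := hG.2 hG' hle x
  have h1 : e ≤ G x := by
    refine le_trans ?_ hm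
    simp [G', hGf.top]
  refine le_antisymm ?_ (compl_le_iff_compl_le.1 h1)
  exact le_compl_iff_disjoint_left.2 (disjoint_iff.2 hd)

/-- The map `G₀` is the valued filter generated by the constraints `b k ≤ G (a k)`. The hypothesis
says that it sends `⊥` to `⊥`, and every homomorphism above it satisfies the constraints. -/
theorem exists_hom_of_le {K : Type*} (a : K → A) (b : K → B)
    (h : ∀ s : Finset K, s.inf a = ⊥ → s.inf b = ⊥) :
    ∃ G : A → B, IsValuedFilter G ∧ (∀ x, G xᶜ = (G x)ᶜ) ∧ ∀ k, b k ≤ G (a k) := by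
  classical
  let G₀ : A → B := fun x => ⨆ (s : Finset K) (_ : s.inf a ≤ x), s.inf b
  have le : ∀ (s : Finset K) (x : A), s.inf a ≤ x → s.inf b ≤ G₀ x := fun s x hs =>
    le_iSup₂ (f := fun (s : Finset K) (_ : s.inf a ≤ x) => s.inf b) s hs
  have hmono : Monotone G₀ := fun x y hxy => iSup₂_le fun s hs => le s y (hs.trans hxy)
  have h₀ : IsValuedFilter G₀ := by
    refine ⟨top_unique (le ∅ ⊤ le_top), bot_unique (iSup₂_le fun s hs => ?_), fun x y => ?_⟩
    · exact (h s (bot_unique hs)).le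
    · apply le_antisymm (le_inf (hmono inf_le_left) (hmono inf_le_right))
      simp only [G₀, iSup_inf_eq, inf_iSup_eq]
      refine iSup₂_le fun s hs => iSup₂_le fun s' hs' => ?_
      rw [← Finset.inf_union]
      refine le _ _ ?_
      rw [Finset.inf_union]
      exact le_inf (inf_le_left.trans hs') (inf_le_right.trans hs)
  obtain ⟨G, hG, hle, hc⟩ := h₀.exists_compl
  exact ⟨G, hG, hc, fun k => (by simpa using le {k} (a k) (by simp) : b k ≤ G₀ (a k)).trans (hle _)⟩

/-- Every nonzero element belongs to an ultrafilter. -/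
theorem exists_ultrafilter {B : Type*} [BooleanAlgebra B] {c : B} (hc : c ≠ ⊥) :
    ∃ U : Order.PFilter B, IsUltrafilter U ∧ c ∈ U := by
  -- Ultrafilters are homomorphisms to the two-element algebra `Prop`; the single constraint is that
  -- `c` is sent to `True`.
  obtain ⟨G, hG, hcompl, h1⟩ := exists_hom_of_le (B := Prop) (fun _ : Unit => c) (fun _ => True)
    (fun s hs => by
      rcases s.eq_empty_or_nonempty with rfl | ⟨⟨⟩, hs'⟩
      · simp only [Finset.inf_empty] at hs
        exact absurd (bot_unique (le_top.trans hs.le)) hc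
      · exact absurd (bot_unique (le_of_le_of_eq (Finset.le_inf fun _ _ => le_rfl) hs)) hc)
  have hF : Order.IsPFilter {x | G x} := Order.IsPFilter.of_def
    ⟨c, h1 () trivial⟩
    (fun x hx y hy => ⟨x ⊓ y, by
      change G (x ⊓ y); rw [hG.inf]; exact ⟨hx, hy⟩, inf_le_left, inf_le_right⟩)
    (fun {x y} hxy hx => hG.mono hxy hx)
  refine ⟨hF.toPFilter, fun b => ?_, h1 () trivial⟩
  change G bᶜ ↔ ¬ G b
  rw [hcompl]
  rfl

end Extension

section Ultrafilters

variable {B : Type*} [BooleanAlgebra B] {U : Order.PFilter B} (hU : IsUltrafilter U)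
include hU

theorem IsUltrafilter.compl_mem {b : B} : bᶜ ∈ U ↔ b ∉ U := hU b

theorem IsUltrafilter.bot_notMem : (⊥ : B) ∉ U := by
  rw [← hU, compl_bot]; exact U.top_mem

omit hU in
theorem pfilter_inf_mem_iff {a b : B} : a ⊓ b ∈ U ↔ a ∈ U ∧ b ∈ U :=
  ⟨fun h => ⟨U.mem_of_le inf_le_left h, U.mem_of_le inf_le_right h⟩, fun h => U.inf_mem h.1 h.2⟩

theorem IsUltrafilter.sup_mem {a b : B} : a ⊔ b ∈ U ↔ a ∈ U ∨ b ∈ U := by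
  rw [← compl_compl (a ⊔ b), hU.compl_mem, compl_sup, pfilter_inf_mem_iff, hU.compl_mem,
    hU.compl_mem]
  tauto

omit hU in
theorem pfilter_finset_inf_mem_iff {ι : Type*} {s : Finset ι} {f : ι → B} :
    s.inf f ∈ U ↔ ∀ i ∈ s, f i ∈ U := by
  classical
  induction s using Finset.induction_on with
  | empty => simp [U.top_mem]
  | insert i s hi ih => simp [ih]

theorem IsUltrafilter.finset_sup_mem {ι : Type*} {s : Finset ι} {f : ι → B} :
    s.sup f ∈ U ↔ ∃ i ∈ s, f i ∈ U := by
  classical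
  induction s using Finset.induction_on with
  | empty => simp [hU.bot_notMem]
  | insert i s hi ih => simp [hU.sup_mem, ih]

theorem IsUltrafilter.ne_bot {b : B} (hb : b ∈ U) : b ≠ ⊥ := by
  rintro rfl; exact hU.bot_notMem hb

end Ultrafilters

/-- Otherwise `a ⊓ bᶜ` belongs to some ultrafilter. Together with Łoś, this turns inequalities
between values into implications in ordinary structures. -/
theorem le_of_forall_ultrafilter {B : Type*} [BooleanAlgebra B] {a b : B}
    (h : ∀ U : Order.PFilter B, IsUltrafilter U → a ∈ U → b ∈ U) : a ≤ b := by
  by_contra hab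
  have : a ⊓ bᶜ ≠ ⊥ := fun h' => hab (by rwa [← sdiff_eq, sdiff_eq_bot_iff] at h')
  obtain ⟨U, hU, hm⟩ := exists_ultrafilter this
  rw [pfilter_inf_mem_iff, hU.compl_mem] at hm
  exact hm.2 (h U hU hm.1)

/-! ## Compactness for Boolean-valued theories -/

section Compactness

variable {L : FirstOrder.Language.{0, 0}} {B : Type u} [CompleteBooleanAlgebra B]
  {α K : Type u}

/-- The Boolean-valued theory of the Boolean-valued ultraproduct of structures. -/
theorem isValuation_of_hom {W : Type*} {N : W → Type u} [∀ i, L.Structure (N i)]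
    [∀ i, Nonempty (N i)] {G : Set W → B} (hG : IsValuedFilter G) (hc : ∀ x, G xᶜ = (G x)ᶜ)
    (a : ∀ i, α → N i) : IsValuation fun φ : L.Formula α => G {i | φ.Realize (a i)} where
  valid φ h := by
    rw [show {i | φ.Realize (a i)} = ⊤ from
      Set.eq_univ_of_forall fun i => h.realize_formula (N i), hG.top]
  not φ := by
    rw [← hc]; rfl
  and φ ψ := by
    rw [← hG.inf]
    congr 1
    ext i
    simp

/-- Compactness for full Boolean-valued structures, without control on the domain. -/
theorem exists_hom_worlds (φ : K → L.Formula α) (b : K → B)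
    (h : ∀ s : Finset K, s.inf b ≠ ⊥ → ∃ (N : Type u) (_ : L.Structure N)
      (_ : Nonempty N) (a : α → N), ∀ k ∈ s, (φ k).Realize a) :
    ∃ (W : Type u) (N : W → Type u) (_ : ∀ i, L.Structure (N i)) (_ : ∀ i, Nonempty (N i))
      (a : ∀ i, α → N i) (G : Set W → B), IsValuedFilter G ∧ (∀ x, G xᶜ = (G x)ᶜ) ∧
      ∀ k, b k ≤ G {i | (φ k).Realize (a i)} := by
  -- The worlds are the finite sets of constraints with nonzero meet. The world `s` satisfies all
  -- formulas in `s`, so their truth sets have a common point.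
  choose N hN hne a ha using fun s : {s : Finset K // s.inf b ≠ ⊥} => h s.1 s.2
  obtain ⟨G, hG, hc, hle⟩ := exists_hom_of_le
    (fun k => {i : {s : Finset K // s.inf b ≠ ⊥} | (φ k).Realize (a i)}) b (fun s hs => by
      by_contra hb
      have : (⟨s, hb⟩ : {s : Finset K // s.inf b ≠ ⊥}) ∈
          s.inf fun k => {i : {s : Finset K // s.inf b ≠ ⊥} | (φ k).Realize (a i)} := by
        rw [Finset.inf_set_eq_iInter]
        simp only [Set.mem_iInter]
        exact fun k hk => ha ⟨s, hb⟩ k hk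
      rw [hs] at this
      exact this)
  exact ⟨_, N, hN, hne, a, G, hG, hc, hle⟩

theorem exists_valuation (φ : K → L.Formula α) (b : K → B)
    (h : ∀ s : Finset K, s.inf b ≠ ⊥ → ∃ (N : Type u) (_ : L.Structure N)
      (_ : Nonempty N) (a : α → N), ∀ k ∈ s, (φ k).Realize a) :
    ∃ t : L.Formula α → B, IsValuation t ∧ ∀ k, b k ≤ t (φ k) := by
  obtain ⟨W, N, _, _, a, G, hG, hc, hle⟩ := exists_hom_worlds φ b h
  exact ⟨_, isValuation_of_hom hG hc a, hle⟩

theorem IsValuation.congr_relabel {t : L.Formula α → B} (ht : IsValuation t) (φ : L.Formula β)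
    {g g' : β → α} (h : ∀ i, t (eqF L (g i) (g' i)) = ⊤) : t (φ.relabel g) = t (φ.relabel g') := by
  classical
  have h1 : t (infF (BoundedFormula.freeVarFinset φ) fun i => eqF L (g i) (g' i)) = ⊤ :=
    top_unique (le_trans (Finset.le_inf fun a _ => (h a).ge) (ht.inf_le_infF _ _))
  rw [← top_inf_eq (t (φ.relabel g)), ← top_inf_eq (t (φ.relabel g')), ← h1, ← ht.and, ← ht.and]
  refine ht.congr fun N _ _ x => ?_
  rw [Formula.realize_inf, Formula.realize_inf]
  refine and_congr_right fun h => ?_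
  rw [Formula.realize_relabel, Formula.realize_relabel]
  refine realize_congr_freeVar φ fun a ha => ?_
  simp only [realize_infF, realize_eqF] at h
  exact h a ha

/-- A Boolean-valued theory with witnesses is the theory of a full structure. -/
theorem IsValuation.exists_full {t : L.Formula α → B} (ht : IsValuation t)
    (hfull : ∀ φ : L.Formula (α ⊕ Unit), ∃ a, t (exF φ) ≤ t (φ.relabel (Sum.elim id fun _ => a))) :
    ∃ (M : Type u) (S : FullBVStructure L B M) (g : α → M), Function.Surjective g ∧
      ∀ φ, S.val (φ.relabel g) = t φ := by
  classical
  have hrefl : ∀ a, t (eqF L a a) = ⊤ := fun a => ht.eq_top fun N _ _ x => by simp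
  -- Variables whose equality has value `⊤` must be identified, by the clause `val_eq_lt`; formulas
  -- keep their value when variables are replaced by representatives.
  let r : Setoid α := ⟨fun a b => t (eqF L a b) = ⊤, hrefl,
    fun {a b} h => top_unique (h.ge.trans (ht.mono fun N _ _ x => by simpa using Eq.symm)),
    fun {a b c} h h' => by
      refine top_unique (le_trans (le_inf h.ge h'.ge) ?_)
      rw [← ht.and]
      exact ht.mono fun N _ _ x => by
        rw [Formula.realize_inf]
        simpa using Eq.trans⟩
  let out : Quotient r → α := Quotient.out
  have hout : ∀ a, t (eqF L (out (Quotient.mk r a)) a) = ⊤ := fun a =>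
    Quotient.exact (Quotient.out_eq (Quotient.mk r a))
  have hrel : ∀ φ : L.Formula α, t ((φ.relabel (Quotient.mk r)).relabel out) = t φ := fun φ => by
    have h1 := ht.congr_relabel φ (g := out ∘ Quotient.mk r) (g' := id) hout
    refine Eq.trans ?_ (h1.trans ?_) <;>
    exact ht.congr fun N _ _ x => by simp [Function.comp_def]
  have hv := ht.comap out
  have hfull' : ∀ φ : L.BoundedFormula (Quotient r) 1, ∃ a : Quotient r,
      t (Formula.relabel out φ.ex) ≤ t ((inst φ a).relabel out) := by
    intro φ
    obtain ⟨a, ha⟩ := hfull ((ofBound φ).relabel (Sum.map out id))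
    refine ⟨Quotient.mk r a, le_trans (le_of_eq ?_) (ha.trans (le_of_eq ?_))⟩
    · refine ht.congr fun N _ _ x => ?_
      rw [Formula.realize_relabel, realize_ex_one, realize_exF]
      simp only [Formula.realize_relabel, realize_ofBound]
      exact ⟨fun ⟨y, hy⟩ => ⟨fun _ => y, hy⟩, fun ⟨y, hy⟩ => ⟨y (), hy⟩⟩
    · refine (ht.congr_relabel _ (g' := Sum.elim id fun _ => out (Quotient.mk r a)) ?_).trans ?_
      · rintro (i | i)
        · exact hrefl i
        · exact r.symm (hout a)
      · refine ht.congr fun N _ _ x => ?_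
        simp only [Formula.realize_relabel, realize_ofBound, realize_inst]
        exact iff_of_eq rfl
  have hle : ∀ (φ : L.BoundedFormula (Quotient r) 1) (a : Quotient r),
      t ((inst φ a).relabel out) ≤ t (Formula.relabel out φ.ex) := fun φ a => by
    refine ht.mono fun N _ _ x => ?_
    rw [Formula.realize_relabel, Formula.realize_relabel, realize_ex_one, realize_inst]
    exact fun h => ⟨_, h⟩
  refine ⟨Quotient r, ⟨⟨fun φ => t (φ.relabel out), hv.valid, hv.not, hv.and, ?_, ?_⟩, ?_⟩,
    Quotient.mk r, Quotient.mk_surjective, hrel⟩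
  · intro φ
    obtain ⟨a, ha⟩ := hfull' φ
    refine ⟨?_, fun c hc => ha.trans (hc ⟨a, rfl⟩)⟩
    rintro _ ⟨b, rfl⟩
    exact hle φ b
  · intro a b hab
    rw [lt_top_iff_ne_top]
    intro h
    apply hab
    rw [← Quotient.out_eq a, ← Quotient.out_eq b]
    refine Quotient.sound (Eq.trans ?_ h : t _ = ⊤)
    exact ht.congr fun N _ _ x => by simp [out]
  · intro φ
    obtain ⟨a, ha⟩ := hfull' φ
    exact ⟨a, le_antisymm (hle φ a) ha⟩

/-- Compactness for full Boolean-valued structures. -/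
theorem exists_full_structure (φ : K → L.Formula α) (b : K → B)
    (h : ∀ s : Finset K, s.inf b ≠ ⊥ → ∃ (N : Type u) (_ : L.Structure N)
      (_ : Nonempty N) (a : α → N), ∀ k ∈ s, (φ k).Realize a) :
    ∃ (M : Type u) (S : FullBVStructure L B M) (g : α → M), ∀ k, b k ≤ S.val ((φ k).relabel g) := by
  obtain ⟨W, N, _, _, a, G, hG, hc, hle⟩ := exists_hom_worlds φ b h
  -- All elements of the product of the worlds serve as variables. A witness can then be chosen in
  -- each world separately, which gives fullness.
  obtain ⟨M, S, g, -, hg⟩ := (isValuation_of_hom (L := L) (N := N) hG hc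
    (fun i (x : ∀ i, N i) => x i)).exists_full (fun ψ => by
      classical
      let x : ∀ i, N i := fun i =>
        if h : ∃ y, ψ.Realize (Sum.elim (fun x : ∀ i, N i => x i) fun _ => y) then h.choose
        else Classical.arbitrary _
      refine ⟨x, hG.mono fun i hi => ?_⟩
      simp only [Set.mem_ofPred_eq, realize_exF] at hi
      have hi' : ∃ y, ψ.Realize (Sum.elim (fun x : ∀ i, N i => x i) fun _ => y) := by
        obtain ⟨y, hy⟩ := hi
        exact ⟨y (), hy⟩
      have : x i = hi'.choose := dif_pos hi'
      simp only [Set.mem_ofPred_eq, Formula.realize_relabel]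
      convert hi'.choose_spec using 1
      ext (j | j)
      · rfl
      · exact this)
  refine ⟨M, S, g ∘ fun j i => a i j, fun k => (hle k).trans (le_of_eq ?_)⟩
  have := hg ((φ k).relabel fun j i => a i j)
  refine Eq.trans ?_ (this.symm.trans ?_)
  · simp [Function.comp_def]
  · exact S.isValuation.congr fun N _ _ x => by simp [Function.comp_def]

end Compactness

/-! ## The theorem of Łoś for specializations -/

section Los

variable {L : FirstOrder.Language.{0, 0}} {B : Type u} [CompleteBooleanAlgebra B]
  {M : Type u}

theorem BVStructure.mem_of_entails_cons (S : BVStructure L B M) (U : Order.PFilter B) {ι : Type*}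
    (s : Finset ι) (f : ι → L.Formula M) (h : ∀ i ∈ s, S.val (f i) ∈ U) {φ χ ψ : L.Formula M}
    (hφ : S.val φ ∈ U) (hχ : S.val χ ∈ U)
    (hψ : ∀ (N : Type u) [L.Structure N] [Nonempty N] (a : M → N), φ.Realize a → χ.Realize a →
      (∀ i ∈ s, (f i).Realize a) → ψ.Realize a) : S.val ψ ∈ U := by
  have h1 : S.val (infF s f) ∈ U :=
    U.mem_of_le (S.isValuation.inf_le_infF s f) (pfilter_finset_inf_mem_iff.2 h)
  have h2 := U.inf_mem hφ (U.inf_mem hχ h1)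
  rw [← S.val_and, ← S.val_and] at h2
  refine U.mem_of_le (S.isValuation.mono fun N _ _ a => ?_) h2
  rw [Formula.realize_inf, Formula.realize_inf, realize_infF]
  exact fun h => hψ N a h.1 h.2.1 h.2.2

theorem FullBVStructure.exists_witness (S : FullBVStructure L B M) (φ : L.Formula (M ⊕ Unit)) :
    ∃ b, S.val (φ.relabel (Sum.elim id fun _ => b)) = S.val (exF φ) := by
  obtain ⟨b, hb⟩ := S.full (toBound φ)
  refine ⟨b, Eq.trans ?_ (hb.trans ?_)⟩
  · refine S.isValuation.congr fun N _ _ a => ?_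
    rw [Formula.realize_relabel, realize_inst, realize_toBound]
    refine iff_of_eq (congrArg _ ?_)
    ext (i | i) <;> rfl
  · refine S.isValuation.congr fun N _ _ a => ?_
    rw [realize_toBound_ex, realize_exF]
    exact ⟨fun ⟨x, hx⟩ => ⟨fun _ => x, hx⟩, fun ⟨x, hx⟩ => ⟨x (), hx⟩⟩

theorem FullBVStructure.nonempty (S : FullBVStructure L B M) : Nonempty M :=
  let ⟨b, _⟩ := S.exists_witness ⊤
  ⟨b⟩

instance (S : FullBVStructure L B M) (U : Order.PFilter B) : Nonempty (S.Spec U) :=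
  S.nonempty.map (S.toSpec U)

variable (S : FullBVStructure L B M) {U : Order.PFilter B}

theorem FullBVStructure.toSpec_eq_iff {a b : M} :
    S.toSpec U a = S.toSpec U b ↔ S.val (eqF L a b) ∈ U :=
  Quotient.eq (r := S.setoid U)

theorem FullBVStructure.toSpec_surjective : Function.Surjective (S.toSpec U) :=
  Quotient.mk_surjective (s := S.setoid U)

theorem FullBVStructure.toSpec_out (x : S.Spec U) : S.toSpec U (Quotient.out x) = x :=
  Quotient.out_eq x

theorem FullBVStructure.realize_term_spec {α : Type*} (t : L.Term α) (a : α → M) (b : M) :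
    t.realize (fun i => S.toSpec U (a i)) = S.toSpec U b ↔
      S.val ((t.relabel a).equal (Term.var b)) ∈ U := by
  induction t generalizing b with
  | var i => exact S.toSpec_eq_iff
  | @func n f ts ih =>
    let y : Fin n → S.Spec U := fun k => (ts k).realize fun i => S.toSpec U (a i)
    let c : Fin n → M := fun k => Quotient.out (y k)
    have hc : ∀ k, S.val (((ts k).relabel a).equal (Term.var (c k))) ∈ U := fun k =>
      (ih k (c k)).1 (S.toSpec_out (y k)).symm
    let d := (S.exists_funF f c).choose
    have hd : S.val (funF f c d) ∈ U := by
      rw [(S.exists_funF f c).choose_spec]; exact U.top_mem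
    change S.toSpec U d = S.toSpec U b ↔ _
    rw [S.toSpec_eq_iff]
    constructor <;> intro h
    all_goals
      refine S.mem_of_entails_cons U Finset.univ _ (fun k _ => hc k) h hd fun N _ _ x h1 h2 h3 => ?_
      have h3 := fun k => h3 k (Finset.mem_univ _)
      simp only [funF, eqF, Formula.realize_equal, Term.realize_relabel, Term.realize_func,
        Term.realize_var, Term.relabel] at h1 h2 h3 ⊢
      simp only [h3] at h1 h2 ⊢
    · rw [h2, h1]
    · rw [← h2, h1]

theorem realize_toFormula_relabel {α : Type*} {n : ℕ} (φ : L.BoundedFormula α n) (a : α → M)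
    (xs : Fin n → M) {N : Type*} [L.Structure N] (x : M → N) :
    Formula.Realize (φ.toFormula.relabel (Sum.elim a xs)) x ↔ φ.Realize (x ∘ a) (x ∘ xs) := by
  rw [Formula.realize_relabel, BoundedFormula.realize_toFormula]
  exact iff_of_eq rfl

theorem FullBVStructure.realize_boundedFormula_spec (hU : IsUltrafilter U) {α : Type*} {n : ℕ}
    (φ : L.BoundedFormula α n) (a : α → M) (xs : Fin n → M) :
    φ.Realize (fun i => S.toSpec U (a i)) (fun i => S.toSpec U (xs i)) ↔
      S.val (φ.toFormula.relabel (Sum.elim a xs)) ∈ U := by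
  have hS := S.isValuation
  induction φ with
  | falsum =>
    refine iff_of_false id fun h => hU.bot_notMem ?_
    have h1 : S.val (BoundedFormula.not ⊥) = ⊤ := hS.eq_top fun N _ _ x => by
      rw [Formula.realize_not]; exact id
    rw [S.val_not, compl_eq_top] at h1
    exact U.mem_of_le (h1.le.trans' (hS.mono fun N _ _ x => by
      rw [realize_toFormula_relabel]; exact id)) h
  | equal t₁ t₂ =>
    have h : (BoundedFormula.equal t₁ t₂).Realize (fun i => S.toSpec U (a i))
        (fun i => S.toSpec U (xs i)) ↔ t₁.realize (fun i => S.toSpec U (Sum.elim a xs i)) =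
          t₂.realize (fun i => S.toSpec U (Sum.elim a xs i)) := by
      have : (fun i => S.toSpec U (Sum.elim a xs i)) =
          Sum.elim (fun i => S.toSpec U (a i)) (fun i => S.toSpec U (xs i)) := by
        ext (i | i) <;> rfl
      rw [this]; rfl
    rw [h]
    obtain ⟨b, hb⟩ := S.toSpec_surjective (t₂.realize (fun i => S.toSpec U (Sum.elim a xs i)))
    have h2 := (S.realize_term_spec t₂ _ b).1 hb.symm
    rw [← hb, S.realize_term_spec]
    constructor <;> intro h
    all_goals
      refine S.mem_of_entails_cons U (∅ : Finset Empty) Empty.elim (by simp) h h2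
        fun N _ _ x h1 h2 _ => ?_
      simp only [realize_toFormula_relabel] at h1 ⊢
      simp only [BoundedFormula.Realize, ← Sum.comp_elim, Formula.realize_equal, Term.realize_relabel,
        Term.realize_var] at h1 h2 ⊢
      simp_all
  | @rel n l R ts =>
    let y : Fin l → S.Spec U := fun k => (ts k).realize (fun i => S.toSpec U (Sum.elim a xs i))
    have h : (BoundedFormula.rel R ts).Realize (fun i => S.toSpec U (a i))
        (fun i => S.toSpec U (xs i)) ↔ S.val (relF R fun k => (y k).out) ∈ U := by
      have : (fun i => S.toSpec U (Sum.elim a xs i)) =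
          Sum.elim (fun i => S.toSpec U (a i)) (fun i => S.toSpec U (xs i)) := by
        ext (i | i) <;> rfl
      simp only [y, this]; rfl
    rw [h]
    have hy : ∀ k, S.val (((ts k).relabel (Sum.elim a xs)).equal (Term.var (y k).out)) ∈ U := fun k =>
      (S.realize_term_spec (ts k) _ _).1 (S.toSpec_out (y k)).symm
    constructor <;> intro h
    all_goals
      refine S.mem_of_entails_cons U Finset.univ _ (fun k _ => hy k) h h
        fun N _ _ x h1 _ h2 => ?_
      have h2 := fun k => h2 k (Finset.mem_univ _)
      simp only [realize_toFormula_relabel] at h1 ⊢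
      simp only [BoundedFormula.Realize, ← Sum.comp_elim, Formula.realize_equal, Term.realize_relabel,
        Term.realize_var, relF, Formula.realize_rel] at h1 h2 ⊢
      simp_all
  | @imp n φ ψ ih₁ ih₂ =>
    refine BoundedFormula.realize_imp.trans ((imp_congr (ih₁ xs) (ih₂ xs)).trans ?_)
    have : S.val ((φ.imp ψ).toFormula.relabel (Sum.elim a xs)) =
        (S.val (φ.toFormula.relabel (Sum.elim a xs)) ⊓
          (S.val (ψ.toFormula.relabel (Sum.elim a xs)))ᶜ)ᶜ := by
      rw [← S.val_not, ← S.val_and, ← S.val_not]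
      refine hS.congr fun N _ _ x => ?_
      rw [Formula.realize_not, Formula.realize_inf, Formula.realize_not]
      simp only [realize_toFormula_relabel, BoundedFormula.realize_imp]
      tauto
    rw [this, hU.compl_mem, pfilter_inf_mem_iff, hU.compl_mem]
    tauto
  | @all n φ ih =>
    rw [BoundedFormula.realize_all]
    -- Fullness enters here: a single `b` is a counterexample with the largest possible value, so it
    -- is one at `U` whenever the universal formula fails there.
    let χ : L.Formula (M ⊕ Unit) := φ.not.toFormula.relabel
      (Sum.elim (Sum.inl ∘ a) (Fin.snoc (α := fun _ => M ⊕ Unit) (Sum.inl ∘ xs) (Sum.inr ())))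
    have hχ : ∀ (N : Type u) [L.Structure N] [Nonempty N] (x : M → N) (y : Unit → N),
        χ.Realize (Sum.elim x y) ↔ ¬ φ.Realize (x ∘ a) (Fin.snoc (x ∘ xs) (y ())) := by
      intro N _ _ x y
      simp only [χ]
      rw [Formula.realize_relabel, BoundedFormula.realize_toFormula, BoundedFormula.realize_not]
      refine not_congr (iff_of_eq ?_)
      congr 1
      ext i
      refine Fin.lastCases ?_ (fun i => ?_) i <;> simp
    obtain ⟨b, hb⟩ := S.exists_witness χ
    constructor
    · intro h
      by_contra hn
      rw [← hU.compl_mem, ← S.val_not] at hn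
      have h1 : S.val (χ.relabel (Sum.elim id fun _ => b)) ∈ U := by
        rw [hb]
        refine U.mem_of_le (hS.mono fun N _ _ x => ?_) hn
        rw [Formula.realize_not, realize_toFormula_relabel, BoundedFormula.realize_all, realize_exF]
        intro h
        obtain ⟨y, hy⟩ := not_forall.1 h
        exact ⟨fun _ => y, (hχ N _ _).2 hy⟩
      have h2 := h (S.toSpec U b)
      have h3 : (Fin.snoc (fun i => S.toSpec U (xs i)) (S.toSpec U b) : Fin (n + 1) → S.Spec U) =
          fun i => S.toSpec U (Fin.snoc (α := fun _ => M) xs b i) := by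
        ext i
        refine Fin.lastCases ?_ (fun i => ?_) i <;> simp
      rw [h3] at h2
      have h2 := (ih (Fin.snoc (α := fun _ => M) xs b)).1 h2
      refine hU.compl_mem.1 ?_ h2
      rw [← S.val_not]
      refine (U.mem_of_le (hS.mono fun N _ _ x => ?_) h1)
      rw [Formula.realize_relabel (φ := χ), Formula.realize_not, Sum.comp_elim, hχ,
        realize_toFormula_relabel, Fin.comp_snoc]
      exact id
    · intro h y
      obtain ⟨b, rfl⟩ := S.toSpec_surjective y
      have h3 : (Fin.snoc (fun i => S.toSpec U (xs i)) (S.toSpec U b) : Fin (n + 1) → S.Spec U) =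
          fun i => S.toSpec U (Fin.snoc (α := fun _ => M) xs b i) := by
        ext i
        refine Fin.lastCases ?_ (fun i => ?_) i <;> simp
      rw [h3]
      refine (ih (Fin.snoc (α := fun _ => M) xs b)).2 ?_
      refine U.mem_of_le (hS.mono fun N _ _ x => ?_) h
      rw [realize_toFormula_relabel, realize_toFormula_relabel, Fin.comp_snoc]
      intro h
      exact h (x b)

/-- The theorem of Łoś for specializations of full Boolean-valued structures. -/
theorem FullBVStructure.realize_spec (hU : IsUltrafilter U) {α : Type*} (φ : L.Formula α)
    (a : α → M) : φ.Realize (fun i => S.toSpec U (a i)) ↔ S.val (φ.relabel a) ∈ U := by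
  have := S.realize_boundedFormula_spec hU φ a Fin.elim0
  rw [Formula.Realize, Subsingleton.elim default fun i => S.toSpec U (Fin.elim0 i), this]
  refine iff_of_eq (congrArg (· ∈ U) ?_)
  refine S.isValuation.congr fun N _ _ x => ?_
  rw [realize_toFormula_relabel, Formula.realize_relabel, Formula.Realize]
  rw [Subsingleton.elim (x ∘ Fin.elim0) default]

theorem BVStructure.relabel_relabel {α β : Type*} (S : BVStructure L B M) (φ : L.Formula α)
    (f : α → β) (g : β → M) : S.val ((φ.relabel f).relabel g) = S.val (φ.relabel (g ∘ f)) :=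
  S.isValuation.congr fun N _ _ x => by simp [Function.comp_assoc]

end Los

/-! ## Small elementary substructures and saturation -/

section Saturation

variable {L : FirstOrder.Language.{0, 0}} {B : Type u} [CompleteBooleanAlgebra B]
  {N : Type u}

/-- The language of Skolem functions for formulas of `L`. -/
def skolemLang (L : FirstOrder.Language.{0, 0}) : FirstOrder.Language.{0, 0} :=
  ⟨fun n => L.Formula (Fin n ⊕ Unit), fun _ => Empty⟩

/-- The downward Löwenheim–Skolem argument: take the hull of `X` under Skolem functions that choose
elements attaining the value of an existential formula. There are countably many of them, since the
language is countable. -/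
theorem FullBVStructure.exists_small [Countable L.Symbols] (S : FullBVStructure L B N)
    {κ : Cardinal.{u}} (hκ : ℵ₀ ≤ κ) (X : Set N) (hX : #X ≤ κ) :
    ∃ Y : Set N, X ⊆ Y ∧ #Y ≤ κ ∧ ∃ P : FullBVStructure L B Y,
      P.toBVStructure.IsElementary S.toBVStructure (fun y => (y : N)) := by
  let _ : (skolemLang L).Structure N :=
    { funMap := fun {n} ψ x =>
        (S.exists_witness (Formula.relabel (Sum.map x id) (ψ : L.Formula (Fin n ⊕ Unit)))).choose
      RelMap := fun r => r.elim }
  let Y' : (skolemLang L).Substructure N := Substructure.closure (skolemLang L) X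
  let Y : Set N := Y'
  have hYc : #Y ≤ κ := by
    have h1 := Substructure.lift_card_closure_le (L := skolemLang L) (s := X)
    have h2 : #(Σ i, (skolemLang L).Functions i) ≤ ℵ₀ := by
      have : ∀ i, Countable ((skolemLang L).Functions i) := fun i =>
        inferInstanceAs (Countable (L.BoundedFormula (Fin i ⊕ Unit) 0))
      exact Cardinal.mk_le_aleph0
    rw [← Cardinal.lift_le.{0}]
    refine h1.trans (max_le (by simpa using hκ) ?_)
    refine (Cardinal.add_le_of_le (by simpa using hκ) (by simpa using hX) ?_)
    refine (Cardinal.lift_le.2 h2).trans ?_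
    simpa using hκ
  have hY : ∀ φ : L.Formula (Y ⊕ Unit), ∃ y : Y,
      S.val (φ.relabel (Sum.elim (fun y : Y => (y : N)) fun _ => (y : N))) =
        S.val ((exF φ).relabel (fun y : Y => (y : N))) := by
    intro φ
    have : Nonempty Y := ⟨⟨Structure.funMap (L := skolemLang L) (n := 0)
      (show L.Formula (Fin 0 ⊕ Unit) from ⊤) Fin.elim0, Y'.fun_mem _ _ fun i => i.elim0⟩⟩
    -- A formula with parameters in `Y` is an instance of a parameter-free one of finite arity, and
    -- that is a Skolem function symbol.
    obtain ⟨m, φ', h'⟩ := exists_fin_code.{u} ((codeF φ).relabel Sum.swap)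
    let ψ : L.Formula (Fin m ⊕ Unit) := φ'.relabel Sum.swap
    let x : Fin m → N := fun i => (codeV φ i : Y)
    have hψ : ∀ (N' : Type u) [L.Structure N'] (a : N → N') (b : Unit → N'),
        ψ.Realize (Sum.elim (a ∘ x) b) ↔ φ.Realize (Sum.elim (a ∘ (fun y : Y => (y : N))) b) := by
      intro N' _ a b
      rw [← realize_codeF φ, Formula.realize_relabel]
      have := h' N' b ((a ∘ fun y : Y => (y : N)) ∘ codeV (α := Y) φ)
      rw [Formula.realize_relabel] at this
      refine (iff_of_eq ?_).trans (this.trans (iff_of_eq ?_))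
      all_goals
        congr 1
        ext (i | i) <;> rfl
    refine ⟨⟨_, Y'.fun_mem (n := m) ψ x fun i => (codeV φ i).2⟩, ?_⟩
    have := (S.exists_witness (ψ.relabel (Sum.map x id))).choose_spec
    refine Eq.trans ?_ (this.trans ?_)
    · refine S.isValuation.congr fun N' _ _ a => ?_
      simp only [Formula.realize_relabel]
      refine Iff.trans ?_ ((hψ N' a fun _ =>
        a (S.exists_witness (ψ.relabel (Sum.map x id))).choose).symm.trans (iff_of_eq ?_))
      · refine iff_of_eq ?_
        congr 1
        ext (i | i) <;> rfl
      · congr 1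
        ext (i | i) <;> rfl
    · refine S.isValuation.congr fun N' _ _ a => ?_
      simp only [Formula.realize_relabel, realize_exF, ← hψ]
      refine exists_congr fun b => iff_of_eq ?_
      congr 1
      ext (i | i) <;> rfl
  have hv := S.isValuation.comap (fun y : Y => (y : N))
  refine ⟨Y, Substructure.subset_closure, hYc, ⟨⟨fun φ => S.val (φ.relabel fun y : Y => (y : N)),
    hv.valid, hv.not, hv.and, ?_, ?_⟩, ?_⟩, fun φ => rfl⟩
  · intro φ
    obtain ⟨y, hy⟩ := hY (ofBound φ)
    refine ⟨?_, fun c hc => le_trans (le_of_eq ?_) (hc ⟨y, rfl⟩)⟩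
    · rintro _ ⟨b, rfl⟩
      refine hv.mono fun N' _ _ a => ?_
      rw [realize_inst, realize_ex_one]
      exact fun h => ⟨_, h⟩
    · refine Eq.trans (hv.congr fun N' _ _ a => ?_) (hy.symm.trans ?_)
      · rw [realize_exF, realize_ex_one]
        simp only [realize_ofBound]
        exact ⟨fun ⟨y, hy⟩ => ⟨fun _ => y, hy⟩, fun ⟨y, hy⟩ => ⟨y (), hy⟩⟩
      · refine S.isValuation.congr fun N' _ _ a => ?_
        simp only [Formula.realize_relabel, realize_ofBound, realize_inst]
        exact iff_of_eq rfl
  · intro a b hab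
    have := S.val_eq_lt a b fun h => hab (Subtype.ext h)
    refine lt_of_eq_of_lt (S.isValuation.congr fun N' _ _ a => ?_) this
    simp
  · intro φ
    obtain ⟨y, hy⟩ := hY (ofBound φ)
    refine ⟨y, Eq.trans ?_ (hy.trans (hv.congr fun N' _ _ a => ?_))⟩
    · refine S.isValuation.congr fun N' _ _ a => ?_
      simp only [Formula.realize_relabel, realize_ofBound, realize_inst]
      exact iff_of_eq rfl
    · rw [realize_exF, realize_ex_one]
      simp only [realize_ofBound]
      exact ⟨fun ⟨y, hy⟩ => ⟨y (), hy⟩, fun ⟨y, hy⟩ => ⟨fun _ => y, hy⟩⟩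

/-- In a `κ⁺`-saturated full structure, a system of at most `κ` elements satisfying lower bounds on
the values of formulas exists as soon as finitely many of the bounds are satisfied at a time in the
specializations. -/
theorem FullBVStructure.exists_realization [Countable L.Symbols] (S : FullBVStructure L B N)
    {κ : Cardinal.{u}} (hκ : ℵ₀ ≤ κ) (hS : S.IsSuccSaturated κ) {P C K : Type u} (hP : #P ≤ κ)
    (hC : #C ≤ κ) (p : P → N) (ψ : K → L.Formula (P ⊕ C)) (b : K → B)
    (h : ∀ (s : Finset K) (U : Order.PFilter B), IsUltrafilter U → (∀ k ∈ s, b k ∈ U) →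
      ∃ g : C → S.Spec U, ∀ k ∈ s, (ψ k).Realize (Sum.elim (fun i => S.toSpec U (p i)) g)) :
    ∃ g : C → N, ∀ k, b k ≤ S.val ((ψ k).relabel (Sum.elim p g)) := by
  -- The constraints to be satisfied are the bounds together with all values of formulas over a
  -- small elementary `Y` containing the parameters. Only parameters and unknowns are counted; there
  -- may be any number of bounds.
  obtain ⟨Y, hXY, hY, Q₀, hQ₀⟩ := S.exists_small hκ (Set.range p) (mk_range_le.trans hP)
  let p' : P → Y := fun i => ⟨p i, hXY ⟨i, rfl⟩⟩
  let φ : L.Formula Y ⊕ K → L.Formula (Y ⊕ C) :=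
    Sum.elim (Formula.relabel Sum.inl) fun k => (ψ k).relabel (Sum.map p' id)
  obtain ⟨M, S', g, hg⟩ := exists_full_structure φ (Sum.elim Q₀.val b) (fun s hs => by
    classical
    -- At an ultrafilter containing the required values, the specialization of `S` itself is a model
    -- of finitely many constraints.
    obtain ⟨U, hU, hm⟩ := exists_ultrafilter hs
    rw [pfilter_finset_inf_mem_iff] at hm
    obtain ⟨g, hg⟩ := h (s.preimage Sum.inr Sum.inr_injective.injOn) U hU fun k hk =>
      hm (Sum.inr k) (by simpa using hk)
    refine ⟨S.Spec U, inferInstance, inferInstance,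
      Sum.elim (fun y => S.toSpec U y) g, ?_⟩
    rintro (χ | k) hk
    · have := hm _ hk
      simp only [Sum.elim_inl] at this
      rw [← hQ₀ χ, ← S.realize_spec hU] at this
      simpa [φ, Formula.realize_relabel] using this
    · have := hg k (by simpa using hk)
      simp only [φ, Sum.elim_inr, Formula.realize_relabel]
      convert this using 1
      ext (i | i) <;> rfl)
  -- The lower bounds for a formula and for its negation together pin down its value.
  have hgY : ∀ χ : L.Formula Y, S'.val (χ.relabel (g ∘ Sum.inl)) = Q₀.val χ := by
    have h1 : ∀ χ : L.Formula Y, Q₀.val χ ≤ S'.val (χ.relabel (g ∘ Sum.inl)) := fun χ => by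
      refine (hg (Sum.inl χ)).trans (le_of_eq ?_)
      exact S'.isValuation.congr fun N' _ _ a => by simp [φ, Function.comp_assoc]
    intro χ
    refine le_antisymm ?_ (h1 χ)
    have := h1 (BoundedFormula.not χ)
    rw [Q₀.val_not, compl_le_iff_compl_le, ← S'.val_not] at this
    refine le_trans (S'.isValuation.mono fun N' _ _ a => ?_) this
    rw [Formula.realize_not, Formula.realize_relabel, Formula.realize_relabel, Formula.realize_not]
    exact not_not.2
  obtain ⟨Z, hgZ, hZ, Q₁, hQ₁⟩ := S'.exists_small hκ (Set.range g)
    (mk_range_le.trans (by rw [mk_sum, lift_id, lift_id]; exact add_le_of_le hκ hY hC))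
  let g' : Y ⊕ C → Z := fun i => ⟨g i, hgZ ⟨i, rfl⟩⟩
  obtain ⟨f, hf, hfe⟩ := hS Y Z Q₀.toBVStructure Q₁.toBVStructure (fun y => (y : N))
    (g' ∘ Sum.inl) hY hZ hQ₀
    (fun χ => by
      rw [← hQ₁, ← hgY χ]
      exact S'.relabel_relabel _ _ _)
  refine ⟨fun c => f (g' (Sum.inr c)), fun k => (hg (Sum.inr k)).trans (le_of_eq ?_)⟩
  have h1 : S'.val ((φ (Sum.inr k)).relabel g) = Q₁.val ((φ (Sum.inr k)).relabel g') := by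
    rw [← hQ₁, S'.relabel_relabel]
    rfl
  rw [h1, ← hf, S.relabel_relabel]
  simp only [φ, Sum.elim_inr]
  rw [S.relabel_relabel]
  congr 2
  ext (i | i)
  · exact hfe (p' i)
  · rfl

end Saturation

/-! ## Existence of saturated full Boolean-valued models -/

section Existence

variable {L : FirstOrder.Language.{0, 0}} {B : Type u} [CompleteBooleanAlgebra B]

theorem IsValuation.relabel_relabel {γ : Type u} {α β : Type*} {t : L.Formula γ → B}
    (ht : IsValuation t) (φ : L.Formula α) (f : α → β) (g : β → γ) :
    t ((φ.relabel f).relabel g) = t (φ.relabel (g ∘ f)) :=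
  ht.congr fun N _ _ x => by simp [Function.comp_assoc]

theorem IsValuation.eq_of_le {α : Type u} {t t' : L.Formula α → B} (ht : IsValuation t)
    (ht' : IsValuation t') (h : ∀ φ, t φ ≤ t' φ) (φ : L.Formula α) : t φ = t' φ := by
  refine le_antisymm (h φ) ?_
  have := h (BoundedFormula.not φ)
  rwa [ht.not, ht'.not, compl_le_compl_iff_le] at this

/-- A supply of elements: `new p Q i` is the `i`-th element of an extension with theory `Q` of
the family `p`. -/
inductive Tower (K F : Type u) : Type u
  | base : Tower K F
  | new (p : K → Tower K F) (Q : F) (i : K) : Tower K F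

/-- The extensions that may be added to a family indexed by `K`. -/
abbrev ExtTheory (L : FirstOrder.Language.{0, 0}) (B : Type u) (K : Type u) : Type u :=
  L.Formula (K ⊕ K) → B

variable {K : Type u}

/-- A Boolean-valued theory `t` on a set `C` of elements that realizes all the consistent
extensions whose elements belong to `C`. -/
structure IsPartialTower (T : L.Theory) (C : Set (Tower K (ExtTheory L B K)))
    (t : L.Formula (Tower K (ExtTheory L B K)) → B) : Prop where
  val : IsValuation t
  model : ∀ σ ∈ T, t (Formula.relabel (Empty.elim : Empty → _) σ) = ⊤
  base : Tower.base ∈ C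
  closed : ∀ p Q i, Tower.new p Q i ∈ C → ∀ j, p j ∈ C
  all : ∀ p Q i, Tower.new p Q i ∈ C → ∀ j, Tower.new p Q j ∈ C
  ext : ∀ p Q, IsValuation Q → (∀ i, Tower.new p Q i ∈ C) →
    (∀ φ : L.Formula K, t (φ.relabel p) = Q (φ.relabel Sum.inl)) →
    ∀ ψ : L.Formula (K ⊕ K), t (ψ.relabel (Sum.elim p (Tower.new p Q))) = Q ψ

/-- Extension of partial towers. -/
def TowerLE {X : Type u} (a b : Set X × (L.Formula X → B)) : Prop :=
  a.1 ⊆ b.1 ∧ ∀ φ : L.Formula a.1, b.2 (φ.relabel (↑)) = a.2 (φ.relabel (↑))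

theorem TowerLE.relabel {X : Type u} {a b : Set X × (L.Formula X → B)} (h : TowerLE a b)
    (ha : IsValuation a.2) (hb : IsValuation b.2) {β : Type*} (φ : L.Formula β) (f : β → X)
    (hf : ∀ i, f i ∈ a.1) : b.2 (φ.relabel f) = a.2 (φ.relabel f) := by
  have := h.2 (φ.relabel fun i => ⟨f i, hf i⟩)
  rwa [ha.relabel_relabel, hb.relabel_relabel] at this

/-- Members of the chain agree where both are defined, so any finite part of the union belongs to a
single member (`hdir`), and compactness yields a common extension. The closure conditions concern
one family `p` at a time and are inherited from a member that contains it. -/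
theorem exists_upper_tower [Nonempty K] {T : L.Theory}
    (c : Set (Set (Tower K (ExtTheory L B K)) × (L.Formula (Tower K (ExtTheory L B K)) → B)))
    (hc : ∀ a ∈ c, IsPartialTower T a.1 a.2) (hch : IsChain TowerLE c) (hne : c.Nonempty) :
    ∃ b : Set (Tower K (ExtTheory L B K)) × (L.Formula (Tower K (ExtTheory L B K)) → B),
      IsPartialTower T b.1 b.2 ∧ ∀ a ∈ c, TowerLE a b := by
  have hdir : ∀ s : Finset c, ∃ a ∈ c, ∀ b ∈ s, TowerLE b.1 a := by
    classical
    intro s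
    induction s using Finset.induction_on with
    | empty => exact ⟨hne.some, hne.some_mem, by simp⟩
    | insert x s hx ih =>
      obtain ⟨a, ha, h⟩ := ih
      have htr : ∀ {x y z : Set (Tower K (ExtTheory L B K)) ×
          (L.Formula (Tower K (ExtTheory L B K)) → B)}, x ∈ c → y ∈ c → z ∈ c →
          TowerLE x y → TowerLE y z → TowerLE x z := fun {x y z} hx hy hz h1 h2 =>
        ⟨h1.1.trans h2.1, fun φ => (h2.relabel (hc _ hy).val (hc _ hz).val φ _
          fun i => h1.1 i.2).trans (h1.2 φ)⟩
      have : TowerLE x.1 a ∨ TowerLE a x.1 := by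
        by_cases hxa : x.1 = a
        · rw [hxa]; exact Or.inl ⟨subset_rfl, fun _ => rfl⟩
        · exact hch x.2 ha hxa
      rcases this with h' | h'
      · exact ⟨a, ha, by simpa using ⟨h', fun a ha b hb => h _ hb⟩⟩
      · refine ⟨x.1, x.2, fun b hb => ?_⟩
        rcases Finset.mem_insert.1 hb with rfl | hb
        · exact ⟨subset_rfl, fun _ => rfl⟩
        · exact htr b.2 ha x.2 (h b hb) h'
  obtain ⟨t, ht, hle⟩ := exists_valuation
    (fun k : Σ a : c, L.Formula a.1.1 => k.2.relabel Subtype.val)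
    (fun k => k.1.1.2 (k.2.relabel Subtype.val)) (fun s hs => by
      classical
      obtain ⟨a, ha, h⟩ := hdir (s.image Sigma.fst)
      have h1 : (s.inf fun k : Σ a : c, L.Formula a.1.1 =>
          k.1.1.2 (k.2.relabel Subtype.val)) ≤
          a.2 (infF s fun k => k.2.relabel Subtype.val) := by
        refine le_trans (Finset.le_inf fun k hk => ?_) ((hc _ ha).val.inf_le_infF _ _)
        exact (Finset.inf_le hk).trans ((h k.1 (Finset.mem_image_of_mem _ hk)).2 k.2).ge
      obtain ⟨N, i, j, x, hx⟩ := (hc _ ha).val.exists_realize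
        (fun h0 => hs (bot_unique (h1.trans h0.le)))
      refine ⟨N, i, j, x, ?_⟩
      simpa using hx)
  have hb : ∀ a ∈ c, TowerLE a (⋃ a ∈ c, a.1, t) := fun a ha =>
    ⟨Set.subset_biUnion_of_mem (u := fun a => a.1) ha, fun φ => (((hc a ha).val.comap _).eq_of_le
      (ht.comap _) (fun φ => hle ⟨⟨a, ha⟩, φ⟩) φ).symm⟩
  refine ⟨(⋃ a ∈ c, a.1, t), ⟨ht, ?_, ?_, ?_, ?_, ?_⟩, hb⟩
  · intro σ hσ
    obtain ⟨a, ha⟩ := hne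
    rw [(hb a ha).relabel (hc a ha).val ht σ _ fun i => i.elim]
    exact (hc a ha).model σ hσ
  · obtain ⟨a, ha⟩ := hne
    exact (hb a ha).1 (hc a ha).base
  · intro p Q i h j
    obtain ⟨a, ha, h⟩ := Set.mem_iUnion₂.1 h
    exact (hb a ha).1 ((hc a ha).closed p Q i h j)
  · intro p Q i h j
    obtain ⟨a, ha, h⟩ := Set.mem_iUnion₂.1 h
    exact (hb a ha).1 ((hc a ha).all p Q i h j)
  · intro p Q hQ h hφ ψ
    obtain ⟨a, ha, h⟩ := Set.mem_iUnion₂.1 (h (Classical.arbitrary K))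
    have h1 := (hc a ha).all p Q _ h
    have h2 := (hc a ha).closed p Q _ h
    rw [(hb a ha).relabel (hc a ha).val ht ψ _ (by rintro (i | i); exacts [h2 i, h1 i])]
    refine (hc a ha).ext p Q hQ h1 (fun φ => ?_) ψ
    rw [← hφ φ, ← (hb a ha).relabel (hc a ha).val ht φ _ h2]

/-- Amalgamation: if `Q` agrees with `t` on `p`, then `Q ψ` is at most the value of `∃ y, ψ(p, y)`
under `t`, so finite parts of `t` over `C` and of `Q` hold together in some structure. If `Q` does
not agree, nothing is required of the new names. -/
theorem exists_tower_step [Nonempty K] {T : L.Theory} {C : Set (Tower K (ExtTheory L B K))}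
    {t : L.Formula (Tower K (ExtTheory L B K)) → B} (h : IsPartialTower T C t)
    (p : K → Tower K (ExtTheory L B K)) (Q : ExtTheory L B K) (hp : ∀ j, p j ∈ C) :
    ∃ b : Set (Tower K (ExtTheory L B K)) × (L.Formula (Tower K (ExtTheory L B K)) → B),
      IsPartialTower T b.1 b.2 ∧ TowerLE (C, t) b ∧ ∀ i, Tower.new p Q i ∈ b.1 := by
  classical
  by_cases h0 : ∃ i, Tower.new p Q i ∈ C
  · obtain ⟨i, hi⟩ := h0
    exact ⟨(C, t), h, ⟨subset_rfl, fun _ => rfl⟩, h.all p Q i hi⟩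
  push Not at h0
  obtain ⟨t', ht', hle, hext⟩ : ∃ t' : L.Formula (Tower K (ExtTheory L B K)) → B,
      IsValuation t' ∧ (∀ φ : L.Formula C, t' (φ.relabel (↑)) = t (φ.relabel (↑))) ∧
      (IsValuation Q → (∀ φ : L.Formula K, t' (φ.relabel p) = Q (φ.relabel Sum.inl)) →
      ∀ ψ : L.Formula (K ⊕ K), t' (ψ.relabel (Sum.elim p (Tower.new p Q))) = Q ψ) := by
    by_cases hQ : IsValuation Q ∧ ∀ φ : L.Formula K, t (φ.relabel p) = Q (φ.relabel Sum.inl)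
    swap
    · exact ⟨t, h.val, fun _ => rfl, fun h1 h2 => absurd ⟨h1, h2⟩ hQ⟩
    obtain ⟨hQ, hpQ⟩ := hQ
    obtain ⟨t', ht', hle⟩ := exists_valuation (Sum.elim
      (fun φ : L.Formula C => φ.relabel Subtype.val)
      (fun ψ : L.Formula (K ⊕ K) => ψ.relabel (Sum.elim p (Tower.new p Q))))
      (Sum.elim (fun φ => t (φ.relabel Subtype.val)) Q)
      (fun s hs => by
        let χ : L.Formula (Tower K (ExtTheory L B K)) :=
          infF (s.preimage Sum.inl Sum.inl_injective.injOn) fun φ : L.Formula C =>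
            φ.relabel Subtype.val
        let ψ : L.Formula (K ⊕ K) := infF (s.preimage Sum.inr Sum.inr_injective.injOn) id
        have h1 : s.inf (Sum.elim (fun φ : L.Formula C =>
            t (φ.relabel Subtype.val)) Q) ≤
            t (χ ⊓ (exF ψ).relabel p) := by
          rw [h.val.and]
          refine le_inf (le_trans (Finset.le_inf fun φ hφ => ?_) (h.val.inf_le_infF _ _)) ?_
          · exact Finset.inf_le (f := Sum.elim (fun φ : L.Formula C =>
              t (φ.relabel Subtype.val)) Q)
              (Finset.mem_preimage.1 hφ)
          · rw [hpQ]
            refine le_trans (le_trans (Finset.le_inf fun φ hφ => ?_) (hQ.inf_le_infF _ id))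
              (hQ.mono (φ := ψ) fun N _ _ x hx => ?_)
            · exact Finset.inf_le (f := Sum.elim (fun φ : L.Formula C =>
                t (φ.relabel Subtype.val)) Q)
                (Finset.mem_preimage.1 hφ)
            · rw [Formula.realize_relabel, realize_exF]
              refine ⟨x ∘ Sum.inr, ?_⟩
              convert hx
              ext (i | i) <;> rfl
        obtain ⟨N, hN, hN', x, hx⟩ := h.val.exists_realize
          (fun h0 => hs (bot_unique (h1.trans h0.le)))
        rw [Formula.realize_inf, Formula.realize_relabel, realize_exF] at hx
        obtain ⟨hx1, y, hy⟩ := hx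
        -- The new names lie outside `C`, so they can be reinterpreted by the solution `y` without
        -- affecting formulas over `C`.
        let x' : Tower K (ExtTheory L B K) → N := fun e => match e with
          | Tower.base => x Tower.base
          | Tower.new p' Q' i => if p' = p ∧ Q' = Q then y i else x (Tower.new p' Q' i)
        have hxC : ∀ e ∈ C, x' e = x e := by
          rintro (_ | ⟨p', Q', i⟩) he
          · rfl
          · refine if_neg ?_
            rintro ⟨rfl, rfl⟩
            exact h0 i he
        have hxn : ∀ i, x' (Tower.new p Q i) = y i := fun i => if_pos ⟨rfl, rfl⟩
        refine ⟨N, hN, hN', x', ?_⟩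
        rintro (φ | φ) hφ
        · simp only [Sum.elim_inl, Formula.realize_relabel]
          simp only [χ, realize_infF, Formula.realize_relabel] at hx1
          convert hx1 φ (Finset.mem_preimage.2 hφ) using 1
          ext i
          exact hxC i i.2
        · simp only [Sum.elim_inr, Formula.realize_relabel]
          simp only [ψ, realize_infF] at hy
          have : φ.Realize _ := hy φ (Finset.mem_preimage.2 hφ)
          convert this using 1
          apply funext
          rintro (i | i)
          · exact hxC _ (hp i)
          · exact hxn i)
    refine ⟨t', ht', fun φ => (((h.val.comap _).eq_of_le (ht'.comap _)
      fun φ => hle (Sum.inl φ)) φ).symm, fun _ _ ψ => ?_⟩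
    exact ((hQ.eq_of_le (ht'.comap _) fun φ => hle (Sum.inr φ)) ψ).symm
  let C' := C ∪ Set.range (Tower.new p Q)
  have hb : TowerLE (C, t) (C', t') := ⟨Set.subset_union_left, hle⟩
  refine ⟨(C', t'), ⟨ht', ?_, ?_, ?_, ?_, ?_⟩, hb, fun i => Or.inr ⟨i, rfl⟩⟩
  · intro σ hσ
    rw [hb.relabel h.val ht' σ _ fun i => i.elim]
    exact h.model σ hσ
  · exact Or.inl h.base
  · rintro p' Q' i (hi | ⟨j, hj⟩) l
    · exact Or.inl (h.closed p' Q' i hi l)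
    · cases hj
      exact Or.inl (hp l)
  · rintro p' Q' i (hi | ⟨j, hj⟩) l
    · exact Or.inl (h.all p' Q' i hi l)
    · cases hj
      exact Or.inr ⟨l, rfl⟩
  · intro p' Q' hQ' hnew hφ ψ
    rcases hnew (Classical.arbitrary K) with hi | ⟨j, hj⟩
    · have h1 := h.all p' Q' _ hi
      have h2 := h.closed p' Q' _ hi
      have h3 := hb.relabel h.val ht' ψ (Sum.elim p' (Tower.new p' Q'))
        (by rintro (i | i); exacts [h2 i, h1 i])
      refine h3.trans (h.ext p' Q' hQ' h1 (fun φ => ?_) ψ)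
      rw [← hφ φ]
      exact (hb.relabel h.val ht' φ _ h2).symm
    · cases hj
      exact hext hQ' hφ ψ

/-- There is a Boolean-valued theory that realizes all small extensions. -/
theorem exists_full_tower [Nonempty K] {T : L.Theory} (hT : T.IsSatisfiable) :
    ∃ t : L.Formula (Tower K (ExtTheory L B K)) → B, IsPartialTower T Set.univ t := by
  classical
  obtain ⟨M₀⟩ := hT
  let M : Theory.ModelType.{0, 0, u} T := Theory.ModelType.ulift.{0, 0, 0, u} M₀
  let m₀ : M := Classical.arbitrary M
  -- The starting point is two-valued: all names denote one element of an ordinary model of `T`, and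
  -- only `base` is counted as settled.
  have h₀ : IsPartialTower (B := B) (K := K) T {Tower.base}
      fun φ => if φ.Realize (fun _ => m₀) then ⊤ else ⊥ := by
    refine ⟨⟨fun φ h => if_pos (h.realize_formula M), fun φ => ?_, fun φ ψ => ?_⟩,
      fun σ hσ => if_pos ?_, rfl, ?_, ?_, ?_⟩
    · by_cases h : φ.Realize (fun _ => m₀)
      · rw [if_pos h, if_neg (fun h' => Formula.realize_not.1 h' h), compl_top]
      · rw [if_neg h, if_pos (Formula.realize_not.2 h), compl_bot]
    · by_cases h : φ.Realize (fun _ => m₀) <;> by_cases h' : ψ.Realize (fun _ => m₀) <;>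
        simp [h, h']
    · have := Theory.realize_sentence_of_mem (M := M) T hσ
      rw [Formula.realize_relabel]
      rw [Sentence.Realize] at this
      convert this
    · rintro p Q i hi
      cases hi
    · rintro p Q i hi
      cases hi
    · intro p Q _ h
      cases h (Classical.arbitrary K)
  let Γ := {a : Set (Tower K (ExtTheory L B K)) × (L.Formula (Tower K (ExtTheory L B K)) → B) //
    IsPartialTower T a.1 a.2}
  obtain ⟨m, hm⟩ := exists_maximal_of_chains_bounded (r := fun a b : Γ => TowerLE a.1 b.1)
    (fun c hc => by
      rcases c.eq_empty_or_nonempty with rfl | hne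
      · exact ⟨⟨(_, _), h₀⟩, by simp⟩
      · obtain ⟨b, hb, hle⟩ := exists_upper_tower (Subtype.val '' c)
          (by rintro _ ⟨a, -, rfl⟩; exact a.2)
          (by
            rintro _ ⟨a, ha, rfl⟩ _ ⟨b, hb, rfl⟩ hab
            exact hc ha hb fun h => hab (congrArg _ h)) (hne.image _)
        exact ⟨⟨b, hb⟩, fun a ha => hle _ ⟨a, ha, rfl⟩⟩)
    (fun {a b c} h1 h2 => ⟨h1.1.trans h2.1, fun φ => (h2.relabel b.2.val c.2.val φ _
          fun i => h1.1 i.2).trans (h1.2 φ)⟩)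
  -- A name is built from earlier names, so a maximal tower contains all names by induction. The
  -- well-founded type of names replaces a transfinite iteration of extensions.
  have huniv : ∀ x, x ∈ m.1.1 := by
    intro x
    induction x with
    | base => exact m.2.base
    | new p Q i ih =>
      obtain ⟨b, hb, hle, hnew⟩ := exists_tower_step m.2 p Q ih
      exact (hm ⟨b, hb⟩ hle).1 (hnew i)
  refine ⟨m.1.2, ?_⟩
  have := m.2
  rwa [Set.eq_univ_of_forall huniv] at this

/-- In the full tower every compatible extension by a family indexed by `K` is realized. Structures
of size at most `κ` are enumerated by `K`, so their theories are such extensions, and this gives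
saturation. Fullness is the extension by one Henkin witness. -/
theorem exists_saturated [Nontrivial B] {T : L.Theory} (hT : T.IsSatisfiable) {κ : Cardinal.{u}}
    (hκ : ℵ₀ ≤ κ) : ∃ (N : Type u) (S : FullBVStructure L B N), S.IsModel T ∧
      S.IsSuccSaturated κ := by
  classical
  let K : Type u := κ.out
  have hK : #K = κ := mk_out κ
  have : Infinite K := by rw [Cardinal.infinite_iff, hK]; exact hκ
  obtain ⟨t, h⟩ := exists_full_tower (B := B) (K := K) hT
  have ht := h.val
  have hreal : ∀ (p : K → Tower K (ExtTheory L B K)) (Q : ExtTheory L B K), IsValuation Q →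
      (∀ φ : L.Formula K, t (φ.relabel p) = Q (φ.relabel Sum.inl)) →
      ∃ q : K → Tower K (ExtTheory L B K), ∀ ψ : L.Formula (K ⊕ K),
        t (ψ.relabel (Sum.elim p q)) = Q ψ := fun p Q hQ hp =>
    ⟨Tower.new p Q, h.ext p Q hQ (fun _ => trivial) hp⟩
  have : Nonempty (Tower K (ExtTheory L B K)) := ⟨Tower.base⟩
  obtain ⟨M, S, g, hg, hSt⟩ := ht.exists_full (fun φ => by
    obtain ⟨t', ht', hle⟩ := exists_valuation
      (Sum.elim (Formula.relabel Sum.inl) (fun _ : PUnit.{u + 1} => (φ.relabel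
        (Sum.map id fun _ => PUnit.unit) : L.Formula (Tower K (ExtTheory L B K) ⊕ PUnit.{u + 1}))))
      (Sum.elim t fun _ => t (exF φ)) (fun s hs => by
        have h1 : s.inf (Sum.elim t fun _ => t (exF φ)) ≤
            t (infF (s.preimage Sum.inl Sum.inl_injective.injOn) id ⊓
              if Sum.inr PUnit.unit ∈ s then exF φ else ⊤) := by
          rw [ht.and]
          refine le_inf (le_trans (Finset.le_inf fun φ hφ => ?_) (ht.inf_le_infF _ id)) ?_
          · exact Finset.inf_le (f := Sum.elim t fun _ => _) (Finset.mem_preimage.1 hφ)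
          · split_ifs with h2
            · exact Finset.inf_le (f := Sum.elim t fun _ => t (exF φ)) h2
            · exact le_top.trans (ht.eq_top (φ := ⊤) fun N _ _ x => by simp).ge
        obtain ⟨N, hN, hN', x, hx⟩ := ht.exists_realize (fun h0 => hs (bot_unique (h1.trans h0.le)))
        rw [Formula.realize_inf, realize_infF] at hx
        have h2 : ∃ y : N, Sum.inr PUnit.unit ∈ s → φ.Realize (Sum.elim x fun _ => y) := by
          by_cases h2 : Sum.inr PUnit.unit ∈ s
          · have := hx.2
            rw [if_pos h2, realize_exF] at this
            obtain ⟨y, hy⟩ := this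
            exact ⟨y (), fun _ => hy⟩
          · exact ⟨Classical.arbitrary N, fun h => absurd h h2⟩
        obtain ⟨y, hy⟩ := h2
        refine ⟨N, hN, hN', Sum.elim x fun _ => y, ?_⟩
        rintro (χ | ⟨⟩) hχ
        · simpa [Formula.realize_relabel] using hx.1 χ (Finset.mem_preimage.2 hχ)
        · simp only [Sum.elim_inr, Formula.realize_relabel]
          convert hy hχ using 1
          ext (i | i) <;> rfl)
    have h1 : ∀ χ, t' (χ.relabel Sum.inl) = t χ := fun χ =>
      ((ht.eq_of_le (ht'.comap _) fun φ => hle (Sum.inl φ)) χ).symm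
    -- The parameters of `φ` form a sequence, which is spread over a family indexed by `K`; this
    -- needs `K` infinite. All new elements of the extension denote the same witness.
    obtain ⟨e⟩ : Nonempty (ℕ ↪ K) := ⟨Infinite.natEmbedding K⟩
    let p : K → Tower K (ExtTheory L B K) := fun k => codeV φ (Function.invFun e k)
    obtain ⟨q, hq⟩ := hreal p (fun ψ => t' (ψ.relabel (Sum.map p fun _ => PUnit.unit)))
      (ht'.comap _) (fun χ => by
        rw [ht'.relabel_relabel, ← h1, ht'.relabel_relabel]
        rfl)
    let i₀ := e 0
    refine ⟨q i₀, (hle (Sum.inr PUnit.unit)).trans (le_of_eq ?_)⟩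
    have h2 := hq ((codeF φ).relabel (Sum.map e fun _ => i₀))
    have h3 : ∀ n, p (e n) = codeV φ n := fun n => by
      simp only [p]
      rw [Function.leftInverse_invFun e.injective n]
    rw [ht.relabel_relabel, ht'.relabel_relabel] at h2
    refine Eq.trans ?_ (h2.symm.trans ?_)
    · refine ht'.congr fun N _ _ x => ?_
      simp only [Sum.elim_inr, Formula.realize_relabel]
      have := realize_codeF φ (fun i => x (Sum.inl i)) (fun _ => x (Sum.inr PUnit.unit))
      refine Iff.trans (iff_of_eq ?_) (this.symm.trans (iff_of_eq ?_))
      · congr 1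
        ext (i | i) <;> rfl
      · congr 1
        ext (i | i)
        · simp [h3]
        · rfl
    · refine ht.congr fun N _ _ x => ?_
      simp only [Formula.realize_relabel]
      have := realize_codeF φ x (fun _ => x (q i₀))
      refine Iff.trans (iff_of_eq ?_) (this.trans (iff_of_eq ?_))
      · congr 1
        ext (i | i)
        · simp [h3]
        · rfl
      · congr 1
        ext (i | i) <;> rfl)
  refine ⟨M, S, fun σ hσ => ?_, ?_⟩
  · rw [← h.model σ hσ, ← hSt]
    exact S.isValuation.congr fun N _ _ x => by
      simp only [Formula.realize_relabel]
      exact iff_of_eq (congrArg _ (Subsingleton.elim _ _))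
  intro M₀ M₁ P Q e₀ e₁ hM₀ hM₁ he₀ he₁
  have hne : ∀ {X : Type u} (R : BVStructure L B X), Nonempty X := by
    intro X R
    by_contra hX
    rw [not_nonempty_iff] at hX
    have h1 := R.val_ex ⊤
    have h2 : R.val (BoundedFormula.ex ⊤) = ⊤ := R.isValuation.eq_top fun N _ _ x => by
      rw [realize_ex_one]; exact ⟨Classical.arbitrary N, by simp⟩
    rw [h2, Set.range_eq_empty, isLUB_empty_iff] at h1
    exact bot_ne_top (h1.eq_bot).symm
  have := hne P
  have := hne Q
  have hsurj : ∀ {X : Type u} [Nonempty X], #X ≤ κ → ∃ f : K → X, Function.Surjective f := by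
    intro X _ hX
    rw [← hK] at hX
    obtain ⟨e⟩ := hX
    exact ⟨Function.invFun e, Function.invFun_surjective e.injective⟩
  obtain ⟨k₀, hk₀⟩ := hsurj hM₀
  obtain ⟨k₁, hk₁⟩ := hsurj hM₁
  let out := Function.surjInv hg
  have hout : ∀ x, g (out x) = x := Function.surjInv_eq hg
  let r := Function.surjInv hk₁
  have hr : ∀ x, k₁ (r x) = x := Function.surjInv_eq hk₁
  have hSt' : ∀ {β : Type u} (φ : L.Formula β) (f : β → Tower K (ExtTheory L B K)),
      t (φ.relabel f) = S.val (φ.relabel (g ∘ f)) := fun φ f => by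
    rw [← hSt, S.relabel_relabel]
  obtain ⟨q, hq⟩ := hreal (fun k => out (e₀ (k₀ k)))
    (fun ψ => Q.val (ψ.relabel (Sum.elim (e₁ ∘ k₀) k₁))) (Q.isValuation.comap _) (fun φ => by
      rw [Q.relabel_relabel, hSt']
      have h1 := he₀ (φ.relabel k₀)
      have h2 := he₁ (φ.relabel k₀)
      rw [S.relabel_relabel] at h1
      rw [Q.relabel_relabel] at h2
      refine Eq.trans ?_ (h1.trans (h2.symm.trans ?_))
      · congr 2
        ext i
        exact hout _
      · rfl)
  refine ⟨fun x => g (q (r x)), fun ψ => ?_, fun a => ?_⟩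
  · have h1 := hq (ψ.relabel fun x => Sum.inr (r x))
    rw [ht.relabel_relabel, Q.relabel_relabel, hSt'] at h1
    refine Eq.trans ?_ (h1.trans ?_)
    · rfl
    · refine Q.isValuation.congr fun N _ _ x => ?_
      simp [Formula.realize_relabel, Function.comp_def, hr]
  · obtain ⟨i, rfl⟩ := hk₀ a
    by_contra hne
    have h1 := hq (eqF L (Sum.inr (r (e₁ (k₀ i)))) (Sum.inl i))
    rw [hSt'] at h1
    have h2 := S.val_eq_lt _ _ hne
    refine h2.ne (Eq.trans ?_ (h1.trans ?_))
    · refine S.isValuation.congr fun N _ _ x => ?_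
      simp [Formula.realize_relabel, hout]
    · refine Q.isValuation.eq_top fun N _ _ x => ?_
      simp [Formula.realize_relabel, hr]

end Existence

/-! ## The cardinal invariants -/

section Invariants

theorem lt_sInf_coe_iff (κ : Cardinal.{u}) (S : Set Cardinal.{u}) :
    (κ : WithTop Cardinal.{u}) < sInf ((↑) '' S) ↔ ∀ μ ∈ S, κ < μ := by
  constructor
  · intro h μ hμ
    exact WithTop.coe_lt_coe.1 (h.trans_le (sInf_le ⟨μ, hμ, rfl⟩))
  · intro h
    rcases S.eq_empty_or_nonempty with rfl | hne
    · simp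
    · obtain ⟨μ, hμ, e⟩ := csInf_mem (hne.image ((↑) : Cardinal.{u} → WithTop Cardinal.{u}))
      rw [← e]
      exact WithTop.coe_lt_coe.2 (h μ hμ)

variable {B : Type u} [CompleteBooleanAlgebra B] {U : Order.PFilter B}

theorem lt_lambdaPattern_iff {I : Type*} (Δ : Pattern I) (κ : Cardinal.{u}) :
    (κ : WithTop Cardinal.{u}) < lambdaPattern U Δ ↔ ∀ (J : Type u) (A : Finset J → B), #J ≤ κ →
      IsPatternDistribution Δ A → (∀ s, A s ∈ U) → HasMultiplicativeRefinement U A := by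
  unfold lambdaPattern
  rw [lt_sInf_coe_iff]
  constructor
  · intro h J A hJ hA hm
    by_contra hc
    exact absurd (h _ ⟨J, A, rfl, hA, hm, hc⟩) hJ.not_gt
  · rintro h _ ⟨J, A, rfl, hA, hm, hc⟩
    by_contra hJ
    exact hc (h J A (not_lt.1 hJ) hA hm)

theorem lt_lambdaModel_iff {V : ZFSet.{u}} {W : Type u} [setLang.Structure W] (j : V → W)
    (Δ I : V) (κ : Cardinal.{u}) : (κ : WithTop Cardinal.{u}) < lambdaModel j Δ I ↔
      ∀ X : Set W, IsPseudofinite X → (∀ x ∈ X, E x (j I)) → #X ≤ κ →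
        (∀ s : Finset W, ↑s ⊆ X → ∃ d : W, E d (j Δ) ∧ ∀ y, E y d ↔ y ∈ s) →
        ∃ d : W, E d (j Δ) ∧ ∀ x ∈ X, E x d := by
  unfold lambdaModel
  rw [lt_sInf_coe_iff]
  constructor
  · intro h X h1 h2 h3 h4
    by_contra hc
    exact absurd (h _ ⟨X, h1, h2, le_rfl, h4, hc⟩) h3.not_gt
  · rintro h μ ⟨X, h1, h2, h3, h4, hc⟩
    by_contra hJ
    exact hc (h X h1 h2 (h3.trans (not_lt.1 hJ)) h4)

/-- A multiplicative distribution consists of the finite meets of its values at singletons, and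
these may be any elements of `U`. -/
theorem hasMultiplicativeRefinement_iff (hU : IsUltrafilter U) {J : Type*} {A : Finset J → B} :
    HasMultiplicativeRefinement U A ↔ ∃ a : J → B, (∀ j, a j ∈ U) ∧ ∀ s, s.inf a ≤ A s := by
  constructor
  · rintro ⟨A', -, hm, hA', hle⟩
    exact ⟨fun j => A' {j}, fun j => hA' _, fun s => (hm s).symm.le.trans (hle s)⟩
  · rintro ⟨a, ha, hle⟩
    have h : ∀ s : Finset J, s.inf a ∈ U := fun s =>
      pfilter_finset_inf_mem_iff.2 fun j _ => ha j
    refine ⟨fun s => s.inf a, ⟨fun s => hU.ne_bot (h s), Finset.inf_empty,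
      fun s t hst => Finset.inf_mono hst⟩, fun s => ?_, h, hle⟩
    simp

/-- The constant value `A univ` at singletons works. This disposes of all finite cardinals. -/
theorem hasMultiplicativeRefinement_of_finite (hU : IsUltrafilter U) {J : Type*} [Finite J]
    {A : Finset J → B} (hA : IsDistribution A) (hm : ∀ s, A s ∈ U) :
    HasMultiplicativeRefinement U A := by
  cases nonempty_fintype J
  refine (hasMultiplicativeRefinement_iff hU).2 ⟨fun _ => A Finset.univ, fun _ => hm _, fun s => ?_⟩
  rcases s.eq_empty_or_nonempty with rfl | ⟨j, hj⟩
  · rw [hA.empty]; exact le_top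
  · exact (Finset.inf_le hj).trans (hA.anti _ _ (Finset.subset_univ s))

-- An ultrafilter contains an element deciding all `A t` for `t ⊆ s`, and each nonzero deciding `c`
-- lies in an ultrafilter with the same decisions. So the condition concerns only the trace of `A`
-- at ultrafilters.
open Classical in
theorem isPatternDistribution_iff {I J : Type*} {Δ : Pattern I} {A : Finset J → B} :
    IsPatternDistribution Δ A ↔ IsDistribution A ∧
      ∀ (s : Finset J) (U : Order.PFilter B), IsUltrafilter U → ∃ f : s → I, ∀ t : Finset s,
        A (t.map (Function.Embedding.subtype _)) ∈ U ↔ t.image f ∈ Δ.carrier := by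
  refine and_congr_right fun hA => ⟨fun h s U hU => ?_, fun h s c hc hdec => ?_⟩
  · let c : B := s.powerset.inf fun t => if A t ∈ U then A t else (A t)ᶜ
    have hcU : c ∈ U := pfilter_finset_inf_mem_iff.2 fun t _ => by
      split_ifs with h1
      · exact h1
      · exact hU.compl_mem.2 h1
    have hc1 : ∀ t ⊆ s, A t ∈ U → c ≤ A t := fun t ht h1 => by
      have := Finset.inf_le (f := fun t => if A t ∈ U then A t else (A t)ᶜ) (Finset.mem_powerset.2 ht)
      simpa [h1] using this
    have hc2 : ∀ t ⊆ s, A t ∉ U → c ≤ (A t)ᶜ := fun t ht h1 => by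
      have := Finset.inf_le (f := fun t => if A t ∈ U then A t else (A t)ᶜ) (Finset.mem_powerset.2 ht)
      simpa [h1] using this
    obtain ⟨f, hf⟩ := h s c (hU.ne_bot hcU) fun t ht => by
      by_cases h1 : A t ∈ U
      · exact Or.inl (hc1 t ht h1)
      · exact Or.inr (hc2 t ht h1)
    refine ⟨f, fun t => ?_⟩
    rw [← hf]
    exact ⟨hc1 _ (Finset.map_subtype_subset t), fun h1 => U.mem_of_le h1 hcU⟩
  · obtain ⟨U, hU, hcU⟩ := exists_ultrafilter hc
    obtain ⟨f, hf⟩ := h s U hU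
    refine ⟨f, fun t => ?_⟩
    rw [← hf]
    refine ⟨fun h1 => U.mem_of_le h1 hcU, fun h1 => ?_⟩
    rcases hdec _ (Finset.map_subtype_subset t) with h2 | h2
    · exact h2
    · exact absurd h1 (hU.compl_mem.1 (U.mem_of_le h2 hcU))

end Invariants

/-! ## Formulas of set theory -/

section SetFormulas

variable {α : Type*}

/-- `a ∈ b` -/
def memF (a b : α) : setLang.Formula α :=
  Relations.formula (L := setLang) (SetRel.mem : setLang.Relations 2) fun k => Term.var (![a, b] k)

variable {N : Type*} [setLang.Structure N]

@[simp]
theorem realize_memF (a b : α) (x : α → N) : (memF a b).Realize x ↔ E (x a) (x b) := by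
  refine (Formula.realize_rel (L := setLang)
    (R := (SetRel.mem : setLang.Relations 2))).trans (iff_of_eq ?_)
  unfold E
  congr 1
  ext i
  fin_cases i <;> rfl

/-- The set of the `x j`, for `j ∈ t`, is an element of `D`. -/
def Coded {ι : Type*} (D : N) (x : ι → N) (t : Finset ι) : Prop :=
  ∃ d, E d D ∧ ∀ y, E y d ↔ ∃ j ∈ t, y = x j

/-- The formula defining `Coded`. -/
def codedF {ι : Type*} (D : α) (x : ι → α) (t : Finset ι) : setLang.Formula α :=
  exF (β := Unit) (memF (.inr ()) (.inl D) ⊓ allF (β := Unit)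
    ((memF (.inr ()) (.inl (.inr ()))).iff
      (infF t fun j => (eqv (.inr ()) (.inl (.inl (x j)))).not).not))

variable [Nonempty N]

theorem exists_unit_fun {X : Type*} {P : (Unit → X) → Prop} : (∃ f, P f) ↔ ∃ x, P fun _ => x :=
  ⟨fun ⟨f, h⟩ => ⟨f (), h⟩, fun ⟨_, h⟩ => ⟨_, h⟩⟩

theorem forall_unit_fun {X : Type*} {P : (Unit → X) → Prop} : (∀ f, P f) ↔ ∀ x, P fun _ => x :=
  ⟨fun h _ => h _, fun h f => h (f ())⟩

@[simp]
theorem realize_codedF {ι : Type*} (D : α) (x : ι → α) (t : Finset ι) (v : α → N) :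
    (codedF D x t).Realize v ↔ Coded (v D) (fun j => v (x j)) t := by
  simp [codedF, Coded, exists_unit_fun, forall_unit_fun]

/-- The formula defining `IsUPair`. -/
def upairF (z x y : α) : setLang.Formula α :=
  allF (β := Unit) ((memF (.inr ()) (.inl z)).iff (eqv (.inr ()) (.inl x) ⊔ eqv (.inr ()) (.inl y)))

@[simp]
theorem realize_upairF (z x y : α) (v : α → N) :
    (upairF z x y).Realize v ↔ IsUPair (v z) (v x) (v y) := by
  simp [upairF, IsUPair, forall_unit_fun]

/-- The formula defining `IsOPair`. -/
def opairF (p x y : α) : setLang.Formula α :=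
  exF (β := Unit) (exF (β := Unit) (upairF (.inl (.inr ())) (.inl (.inl x)) (.inl (.inl x)) ⊓
    (upairF (.inr ()) (.inl (.inl x)) (.inl (.inl y)) ⊓
      upairF (.inl (.inl p)) (.inl (.inr ())) (.inr ()))))

@[simp]
theorem realize_opairF (p x y : α) (v : α → N) :
    (opairF p x y).Realize v ↔ IsOPair (v p) (v x) (v y) := by
  simp [opairF, IsOPair, exists_unit_fun]

/-- The formula defining `Rel`. -/
def relationF (r x y : α) : setLang.Formula α :=
  exF (β := Unit) (opairF (.inr ()) (.inl x) (.inl y) ⊓ memF (.inr ()) (.inl r))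

@[simp]
theorem realize_relationF (r x y : α) (v : α → N) :
    (relationF r x y).Realize v ↔ Rel (v r) (v x) (v y) := by
  simp [relationF, Rel, exists_unit_fun]

/-- The formula defining `IsNat`. -/
def natF (n : α) : setLang.Formula α :=
  allF (β := Unit) (allF (β := Unit) ((memF (.inl (.inr ())) (.inl (.inl n))).imp
    ((memF (.inr ()) (.inl (.inr ()))).imp (memF (.inr ()) (.inl (.inl n)))))) ⊓
  (allF (β := Unit) (allF (β := Unit) ((memF (.inl (.inr ())) (.inl (.inl n))).imp
    ((memF (.inr ()) (.inl (.inl n))).imp (memF (.inl (.inr ())) (.inr ()) ⊔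
      (eqv (.inl (.inr ())) (.inr ()) ⊔ memF (.inr ()) (.inl (.inr ()))))))) ⊓
  allF (β := Unit) ((memF (.inr ()) (.inl n) ⊔ eqv (.inr ()) (.inl n)).imp
    ((exF (β := Unit) (memF (.inr ()) (.inl (.inr ())))).imp
      (exF (β := Unit) (allF (β := Unit) ((memF (.inr ()) (.inl (.inl (.inr ())))).iff
        (memF (.inr ()) (.inl (.inr ())) ⊔ eqv (.inr ()) (.inl (.inr ())))))))))

@[simp]
theorem realize_natF (n : α) (v : α → N) : (natF n).Realize v ↔ IsNat (v n) := by
  simp [natF, IsNat, exists_unit_fun, forall_unit_fun]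

/-- The formula defining `IsBij`. -/
def bijF (f x y : α) : setLang.Formula α :=
  allF (β := Unit) ((memF (.inr ()) (.inl x)).imp
    (exF (β := Unit) ((memF (.inr ()) (.inl (.inl y)) ⊓
      relationF (.inl (.inl f)) (.inl (.inr ())) (.inr ())) ⊓
      allF (β := Unit) ((memF (.inr ()) (.inl (.inl (.inl y)))).imp
        ((relationF (.inl (.inl (.inl f))) (.inl (.inl (.inr ()))) (.inr ())).imp
        (eqv (.inr ()) (.inl (.inr ())))))))) ⊓
  allF (β := Unit) ((memF (.inr ()) (.inl y)).imp
    (exF (β := Unit) ((memF (.inr ()) (.inl (.inl x)) ⊓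
      relationF (.inl (.inl f)) (.inr ()) (.inl (.inr ()))) ⊓
      allF (β := Unit) ((memF (.inr ()) (.inl (.inl (.inl x)))).imp
        ((relationF (.inl (.inl (.inl f))) (.inr ()) (.inl (.inl (.inr ())))).imp
        (eqv (.inr ()) (.inl (.inr ()))))))))

@[simp]
theorem realize_bijF (f x y : α) (v : α → N) :
    (bijF f x y).Realize v ↔ IsBij (v f) (v x) (v y) := by
  simp [bijF, IsBij, exists_unit_fun, forall_unit_fun, ExistsUnique]

/-- The formula defining `IsFin`. -/
def finF (x : α) : setLang.Formula α :=
  exF (β := Unit) (exF (β := Unit) (natF (.inl (.inr ())) ⊓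
    bijF (.inr ()) (.inl (.inl x)) (.inl (.inr ()))))

@[simp]
theorem realize_finF (x : α) (v : α → N) : (finF x).Realize v ↔ IsFin (v x) := by
  simp [finF, IsFin, exists_unit_fun]

end SetFormulas

/-! ## Finite sets in transitive models -/

section TransitiveModels

variable {V : ZFSet.{u}}

theorem E_iff (x y : V) : E x y ↔ (x : ZFSet.{u}) ∈ (y : ZFSet.{u}) := Iff.rfl

variable (hV : V.IsTransitive)
include hV

theorem isUPair_iff (z x y : V) : IsUPair z x y ↔
    (z : ZFSet.{u}) = {(x : ZFSet.{u}), (y : ZFSet.{u})} := by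
  constructor
  · intro h
    ext t
    rw [ZFSet.mem_pair]
    constructor
    · intro ht
      exact ((h ⟨t, hV.mem_trans ht z.2⟩).1 ht).imp (congrArg Subtype.val) (congrArg Subtype.val)
    · rintro (rfl | rfl)
      · exact (h x).2 (Or.inl rfl)
      · exact (h y).2 (Or.inr rfl)
  · intro h t
    rw [E_iff, h, ZFSet.mem_pair, Subtype.ext_iff, Subtype.ext_iff]

theorem isOPair_inj {p x y x' y' : V} (h : IsOPair p x y) (h' : IsOPair p x' y') :
    x = x' ∧ y = y' := by
  have key : ∀ {x y : V}, IsOPair p x y → (p : ZFSet.{u}) = ZFSet.pair x y := by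
    rintro x y ⟨a, b, h1, h2, h3⟩
    rw [isUPair_iff hV] at h1 h2 h3
    rw [h3, h1, h2, ZFSet.pair]
    congr 1
    ext; simp
  have := ZFSet.pair_injective ((key h).symm.trans (key h'))
  exact ⟨Subtype.ext this.1, Subtype.ext this.2⟩

variable (hZ : IsModelZFCMinus V)
include hZ

omit hV in
theorem exists_sep (φ : setLang.Formula (V ⊕ Unit)) (a : V) :
    ∃ b : V, ∀ x, E x b ↔ E x a ∧ φ.Realize (Sum.elim id fun _ => x) := by
  refine hZ.separation {x | φ.Realize (Sum.elim id fun _ => x)} ?_ a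
  rw [Set.Definable₁, Set.definable_iff_exists_formula_sum]
  refine ⟨φ.relabel (Sum.map (fun x => ⟨x, trivial⟩) fun _ => 0), ?_⟩
  ext v
  simp only [Set.mem_ofPred_eq, Formula.realize_relabel]
  refine iff_of_eq ?_
  congr 1
  ext (i | i) <;> rfl

omit hV in
theorem exists_insert (x y : V) : ∃ z : V, ∀ t, E t z ↔ E t x ∨ t = y := by
  have : Nonempty V := ⟨x⟩
  obtain ⟨p, hp, -⟩ := hZ.pairing y y
  obtain ⟨q, hq⟩ := exists_sep hZ (eqv (.inr ()) (.inl y)) p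
  obtain ⟨r, hr, hr'⟩ := hZ.pairing x q
  obtain ⟨t, ht⟩ := hZ.union r
  obtain ⟨z, hz⟩ := exists_sep hZ (memF (.inr ()) (.inl x) ⊔ eqv (.inr ()) (.inl y)) t
  refine ⟨z, fun s => ?_⟩
  rw [hz]
  simp only [Formula.realize_sup, realize_memF, realize_eqv, Sum.elim_inr, Sum.elim_inl, id]
  refine and_iff_right_of_imp ?_
  rintro (h | rfl)
  · exact ht x s hr h
  · refine ht q s hr' ((hq s).2 ⟨hp, by simp⟩)

omit hV in
theorem exists_empty : ∃ e : V, ∀ t, ¬ E t e := by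
  obtain ⟨t, ⟨e, -, he⟩, -⟩ := hZ.infinity
  exact ⟨e, he⟩

omit hV in
theorem exists_upair (x y : V) : ∃ z : V, IsUPair z x y := by
  obtain ⟨e, he⟩ := exists_empty hZ
  obtain ⟨a, ha⟩ := exists_insert hZ e x
  obtain ⟨b, hb⟩ := exists_insert hZ a y
  refine ⟨b, fun t => ?_⟩
  rw [hb, ha]
  simp [he]

omit hV in
theorem exists_opair (x y : V) : ∃ p : V, IsOPair p x y := by
  obtain ⟨a, ha⟩ := exists_upair hZ x x
  obtain ⟨b, hb⟩ := exists_upair hZ x y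
  obtain ⟨p, hp⟩ := exists_upair hZ a b
  exact ⟨p, a, b, ha, hb, hp⟩

/-- Elements are added one at a time; a bijection with `n` is extended by the pair `(a, n)` to one
with `n ∪ {n}`. -/
theorem exists_isFin (s : Finset V) : ∃ Y : V, IsFin Y ∧ ∀ x ∈ s, E x Y := by
  classical
  -- The induction also records that `f` relates nothing outside `Y` and `n`; otherwise the added
  -- pair could spoil uniqueness.
  suffices ∃ Y n f : V, IsNat n ∧ (∀ x, E x Y ↔ x ∈ s) ∧ (∀ a b, Rel f a b → E a Y ∧ E b n) ∧
      IsBij f Y n by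
    obtain ⟨Y, n, f, h1, h2, -, h3⟩ := this
    exact ⟨Y, ⟨n, f, h1, h3⟩, fun x hx => (h2 x).2 hx⟩
  induction s using Finset.induction_on with
  | empty =>
    obtain ⟨e, he⟩ := exists_empty hZ
    refine ⟨e, e, e, ⟨fun x y h => absurd h (he _), fun x y h => absurd h (he _), ?_⟩,
      by simp [he], fun a b ⟨p, _, h⟩ => absurd h (he _), fun s h => absurd h (he _),
      fun s h => absurd h (he _)⟩
    rintro m (h | rfl) ⟨y, hy⟩
    · exact absurd h (he _)
    · exact absurd hy (he _)
  | insert a s ha ih =>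
    obtain ⟨Y, n, f, hn, hY, hf, hb⟩ := ih
    obtain ⟨Y', hY'⟩ := exists_insert hZ Y a
    obtain ⟨n', hn'⟩ := exists_insert hZ n n
    obtain ⟨p, hp⟩ := exists_opair hZ a n
    obtain ⟨f', hf'⟩ := exists_insert hZ f p
    have hR : ∀ x y, Rel f' x y ↔ Rel f x y ∨ (x = a ∧ y = n) := by
      intro x y
      constructor
      · rintro ⟨q, hq, h⟩
        rcases (hf' q).1 h with h | rfl
        · exact Or.inl ⟨q, hq, h⟩
        · exact Or.inr (isOPair_inj hV hq hp)
      · rintro (⟨q, hq, h⟩ | ⟨rfl, rfl⟩)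
        · exact ⟨q, hq, (hf' q).2 (Or.inl h)⟩
        · exact ⟨p, hp, (hf' p).2 (Or.inr rfl)⟩
    have hnn : ¬ E n n := ZFSet.mem_irrefl _
    have haY : ¬ E a Y := fun h => ha ((hY a).1 h)
    refine ⟨Y', n', f', ⟨?_, ?_, ?_⟩, ?_, ?_, ?_, ?_⟩
    · intro x y hx hy
      rcases (hn' x).1 hx with hx | rfl
      · exact (hn' y).2 (Or.inl (hn.1 x y hx hy))
      · exact (hn' y).2 (Or.inl hy)
    · intro x y hx hy
      rcases (hn' x).1 hx with hx | rfl <;> rcases (hn' y).1 hy with hy | rfl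
      · exact hn.2.1 x y hx hy
      · exact Or.inl hx
      · exact Or.inr (Or.inr hy)
      · exact Or.inr (Or.inl rfl)
    · rintro m (hm | rfl) hne
      · exact hn.2.2 m ((hn' m).1 hm) hne
      · exact ⟨n, hn'⟩
    · intro x
      rw [hY', hY, Finset.mem_insert, or_comm]
    · intro x y h
      rw [hY', hn']
      rcases (hR x y).1 h with h | ⟨rfl, rfl⟩
      · exact ⟨Or.inl (hf x y h).1, Or.inl (hf x y h).2⟩
      · exact ⟨Or.inr rfl, Or.inr rfl⟩
    · intro x hx
      rcases (hY' x).1 hx with hx | rfl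
      · obtain ⟨t, ⟨ht, ht'⟩, hu⟩ := hb.1 x hx
        refine ⟨t, ⟨(hn' t).2 (Or.inl ht), (hR _ _).2 (Or.inl ht')⟩, ?_⟩
        rintro t' ⟨h1, h2⟩
        rcases (hR _ _).1 h2 with h2 | ⟨rfl, rfl⟩
        · exact hu t' ⟨(hf _ _ h2).2, h2⟩
        · exact absurd hx haY
      · refine ⟨n, ⟨(hn' n).2 (Or.inr rfl), (hR _ _).2 (Or.inr ⟨rfl, rfl⟩)⟩, ?_⟩
        rintro t' ⟨h1, h2⟩
        rcases (hR _ _).1 h2 with h2 | ⟨-, rfl⟩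
        · exact absurd (hf _ _ h2).1 haY
        · rfl
    · intro t ht
      rcases (hn' t).1 ht with ht | rfl
      · obtain ⟨x, ⟨hx, hx'⟩, hu⟩ := hb.2 t ht
        refine ⟨x, ⟨(hY' x).2 (Or.inl hx), (hR _ _).2 (Or.inl hx')⟩, ?_⟩
        rintro x' ⟨h1, h2⟩
        rcases (hR _ _).1 h2 with h2 | ⟨rfl, rfl⟩
        · exact hu x' ⟨(hf _ _ h2).1, h2⟩
        · exact absurd ht hnn
      · refine ⟨a, ⟨(hY' a).2 (Or.inr rfl), (hR _ _).2 (Or.inr ⟨rfl, rfl⟩)⟩, ?_⟩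
        rintro t' ⟨h1, h2⟩
        rcases (hR _ _).1 h2 with h2 | ⟨rfl, -⟩
        · exact absurd (hf _ _ h2).2 hnn
        · rfl

end TransitiveModels

/-! ## Patterns in models of set theory -/

instance (n : ℕ) : Countable (SetRel n) :=
  have : Subsingleton (SetRel n) := ⟨fun a b => by cases a; cases b; rfl⟩
  inferInstance

instance : Countable setLang.Symbols := by
  have h1 (n : ℕ) : Countable (setLang.Functions n) := inferInstanceAs (Countable Empty)
  have h2 (n : ℕ) : Countable (setLang.Relations n) := inferInstanceAs (Countable (SetRel n))
  unfold Language.Symbols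
  infer_instance

open Classical in
theorem isPatternDistribution_iff_of_nonempty {B I J : Type*} [CompleteBooleanAlgebra B]
    [Nonempty I] {Δ : Pattern I} {A : Finset J → B} :
    IsPatternDistribution Δ A ↔ IsDistribution A ∧
      ∀ (s : Finset J) (U : Order.PFilter B), IsUltrafilter U → ∃ f : J → I, ∀ t ⊆ s,
        A t ∈ U ↔ t.image f ∈ Δ.carrier := by
  rw [isPatternDistribution_iff]
  refine and_congr_right fun _ => forall₃_congr fun s U _ => ⟨fun ⟨f, hf⟩ => ?_, fun ⟨f, hf⟩ => ?_⟩
  · refine ⟨fun j => if h : j ∈ s then f ⟨j, h⟩ else Classical.arbitrary I, fun t ht => ?_⟩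
    have := hf (t.subtype (· ∈ s))
    rw [Finset.subtype_map_of_mem ht] at this
    rw [this]
    refine iff_of_eq (congrArg (· ∈ Δ.carrier) ?_)
    ext x
    simp only [Finset.mem_image, Finset.mem_subtype]
    constructor
    · rintro ⟨⟨j, hj⟩, h, rfl⟩
      exact ⟨j, h, by simp [hj]⟩
    · rintro ⟨j, h, rfl⟩
      exact ⟨⟨j, ht h⟩, h, by simp [ht h]⟩
  · refine ⟨fun j => f j, fun t => ?_⟩
    refine (hf _ (Finset.map_subtype_subset t)).trans (iff_of_eq (congrArg (· ∈ Δ.carrier) ?_))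
    rw [Finset.map_eq_image, Finset.image_image]
    rfl

/-- The theorem of Łoś for formulas with parameters. -/
theorem FullBVStructure.realize_toSpec {L : FirstOrder.Language.{0, 0}} {B M : Type u}
    [CompleteBooleanAlgebra B] (S : FullBVStructure L B M) {U : Order.PFilter B}
    (hU : IsUltrafilter U) (φ : L.Formula M) : φ.Realize (S.toSpec U) ↔ S.val φ ∈ U := by
  refine (S.realize_spec hU φ id).trans (iff_of_eq (congrArg (· ∈ U) ?_))
  exact S.isValuation.congr fun N _ _ x => by simp

section ElementaryInto

variable {B : Type u} [CompleteBooleanAlgebra B] {V : ZFSet.{u}} {N : Type u}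
  (S : FullBVStructure setLang B N) {i : V → N} (hi : IsElementaryInto S.toBVStructure i)
  {U : Order.PFilter B} (hU : IsUltrafilter U)

-- Elementarity is needed in specializations at all ultrafilters, since these are used to compare
-- values. A formula false in `V` is treated through its negation.
include hi hU in
theorem realize_spec_iff {α : Type*} (φ : setLang.Formula α) (a : α → V) :
    φ.Realize (fun x => S.toSpec U (i (a x))) ↔ φ.Realize a := by
  have key : ∀ ψ : setLang.Formula α, ψ.Realize a →
      ψ.Realize (fun x => S.toSpec U (i (a x))) := by
    intro ψ h
    rw [S.realize_spec hU ψ fun x => i (a x)]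
    have := hi (ψ.relabel a) (Formula.realize_relabel.2 h)
    rw [BVStructure.relabel_relabel] at this
    exact (congrArg (· ∈ U) this).mpr U.top_mem
  refine ⟨fun h => ?_, key φ⟩
  by_contra hn
  exact Formula.realize_not.1 (key φ.not (Formula.realize_not.2 hn)) h

theorem coded_congr {W ι : Type*} [setLang.Structure W] {D : W} {x y : ι → W} {t : Finset ι}
    (h : ∀ j ∈ t, x j = y j) : Coded D x t ↔ Coded D y t := by
  refine exists_congr fun d => and_congr_right fun _ => forall_congr' fun z => iff_congr Iff.rfl ?_
  exact exists_congr fun j => and_congr_right fun hj => by rw [h j hj]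

variable (hV : V.IsTransitive) {I Δ : V} (hΔ : IsPatternOn (Δ : ZFSet.{u}) (I : ZFSet.{u}))
include hV hΔ

theorem coded_iff {_ : DecidableEq (I : ZFSet.{u})} {ι : Type*} (x : ι → (I : ZFSet.{u})) (y : ι → V)
    (hxy : ∀ j, (y j : ZFSet.{u}) = x j) (t : Finset ι) :
    Coded Δ y t ↔ t.image x ∈ (setPattern hΔ).carrier := by
  constructor
  · rintro ⟨d, hd, h⟩
    refine ⟨d, hd, fun z => ?_⟩
    constructor
    · intro hz
      obtain ⟨j, hj, e⟩ := (h ⟨z, hV.mem_trans hz d.2⟩).1 hz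
      exact ⟨x j, Finset.mem_image_of_mem _ hj, by rw [← hxy, ← e]⟩
    · rintro ⟨z, hz, rfl⟩
      obtain ⟨j, hj, rfl⟩ := Finset.mem_image.1 hz
      rw [← hxy]
      exact (h (y j)).2 ⟨j, hj, rfl⟩
  · rintro ⟨d, hd, h⟩
    refine ⟨⟨d, hV.mem_trans hd Δ.2⟩, hd, fun z => ?_⟩
    rw [E_iff]
    constructor
    · intro hz
      obtain ⟨w, hw, e⟩ := (h z).1 hz
      obtain ⟨j, hj, rfl⟩ := Finset.mem_image.1 hw
      exact ⟨j, hj, Subtype.ext (by rw [hxy, e])⟩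
    · rintro ⟨j, hj, rfl⟩
      exact (h _).2 ⟨x j, Finset.mem_image_of_mem _ hj, (hxy j).symm⟩

theorem coded_of_mem {ι : Type*} {x : ι → V} {d : V} (hd : E d Δ) {s : Finset ι}
    (h : ∀ j ∈ s, E (x j) d) : Coded Δ x s := by
  have hs := hΔ.2 _ hd (ZFSet.sep (fun z => ∃ j ∈ s, (x j : ZFSet.{u}) = z) d) ZFSet.sep_subset
  refine ⟨⟨_, hV.mem_trans hs Δ.2⟩, hs, fun y => ?_⟩
  rw [E_iff, ZFSet.mem_sep]
  constructor
  · rintro ⟨-, j, hj, e⟩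
    exact ⟨j, hj, Subtype.ext e.symm⟩
  · rintro ⟨j, hj, rfl⟩
    exact ⟨h j hj, j, hj, rfl⟩

-- For a fixed finite `s`, closure of `Δ` under subsets is a first-order property of `Δ`, true in
-- `V` and therefore in the specialization.
include hi hU in
theorem coded_spec_of_mem {ι : Type*} {x : ι → S.Spec U} {d : S.Spec U}
    (hd : E d (S.toSpec U (i Δ))) {s : Finset ι} (h : ∀ j ∈ s, E (x j) d) :
    Coded (S.toSpec U (i Δ)) x s := by
  let φ : setLang.Formula Unit := allF (β := Unit ⊕ ι)
    ((memF (.inr (.inl ())) (.inl ()) ⊓ infF s fun j => memF (.inr (.inr j)) (.inr (.inl ()))).imp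
      (codedF (.inl ()) (fun j => .inr (.inr j)) s))
  have : Nonempty V := ⟨Δ⟩
  have := (realize_spec_iff S hi hU φ fun _ => Δ).2 (by
    simp only [φ, realize_allF, Formula.realize_imp, Formula.realize_inf, realize_memF,
      realize_infF, realize_codedF, Sum.elim_inr, Sum.elim_inl]
    exact fun b hb => coded_of_mem hV hΔ hb.1 hb.2)
  simp only [φ, realize_allF, Formula.realize_imp, Formula.realize_inf, realize_memF,
      realize_infF, realize_codedF, Sum.elim_inr, Sum.elim_inl] at this
  exact this (Sum.elim (fun _ => d) x) ⟨hd, h⟩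

variable {κ : Cardinal.{u}} (hκ : ℵ₀ ≤ κ) (hS : S.IsSuccSaturated κ)
include hi hU hκ hS

-- Saturation yields elements `g (some j)` such that the set of those with `j ∈ s` lies in `i Δ`
-- with value exactly `A s`, and an internally finite set `g none` containing all of them. Their
-- classes thus form a pseudofinite set, and a cover `d` gives the refinement by the values of `d ∈
-- i Δ ∧ g (some j) ∈ d`.
open Classical in
theorem hasMultiplicativeRefinement_of_lt_lambdaModel (hZ : IsModelZFCMinus V)
    [Nonempty (I : ZFSet.{u})]
    (h : (κ : WithTop Cardinal.{u}) < lambdaModel (fun a : V => S.toSpec U (i a)) Δ I)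
    {J : Type u} {A : Finset J → B} (hJ : #J ≤ κ) (hA : IsPatternDistribution (setPattern hΔ) A)
    (hm : ∀ s, A s ∈ U) : HasMultiplicativeRefinement U A := by
  rw [lt_lambdaModel_iff] at h
  obtain ⟨hA, hA'⟩ := isPatternDistribution_iff_of_nonempty.1 hA
  let p0 : ULift.{u} Bool → V := fun b => if b.down then Δ else I
  let ψ : Finset J ⊕ Finset J ⊕ Option J → setLang.Formula (ULift.{u} Bool ⊕ Option J) :=
    Sum.elim (fun s => codedF (.inl ⟨true⟩) (fun j => .inr (some j)) s)
      (Sum.elim (fun s => (codedF (.inl ⟨true⟩) (fun j => .inr (some j)) s).not)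
        fun k => k.elim (finF (.inr none)) fun j => memF (.inr (some j)) (.inl ⟨false⟩) ⊓
          memF (.inr (some j)) (.inr none))
  -- Lower bounds `A s` for a formula and `(A s)ᶜ` for its negation force the value `A s`.
  let b : Finset J ⊕ Finset J ⊕ Option J → B :=
    Sum.elim A (Sum.elim (fun s => (A s)ᶜ) fun _ => ⊤)
  obtain ⟨g, hg⟩ := S.exists_realization hκ hS (P := ULift.{u} Bool) (C := Option J)
    ((Cardinal.lt_aleph0_of_finite _).le.trans hκ)
    (by rw [Cardinal.mk_option]; exact Cardinal.add_le_of_le hκ hJ (Cardinal.one_le_aleph0.trans hκ))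
    (fun x => i (p0 x)) ψ b (by
      intro s 𝒱 h𝒱 hs
      -- Finitely many constraints involve only the indices in `s'`. There the trace of `A` at the
      -- ultrafilter is a pattern of `Δ`, realized by points of `V` itself.
      let s' : Finset J := s.biUnion (Sum.elim id (Sum.elim id fun k => k.elim ∅ fun j => {j}))
      have hsub : ∀ k ∈ s, Sum.elim id (Sum.elim id fun k : Option J => k.elim ∅ fun j => {j}) k ⊆
          s' := fun k hk => Finset.subset_biUnion_of_mem
            (Sum.elim id (Sum.elim id fun k : Option J => k.elim ∅ fun j => {j})) hk
      obtain ⟨f, hf⟩ := hA' s' 𝒱 h𝒱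
      let f' : J → V := fun j => ⟨f j, hV.mem_trans (f j).2 I.2⟩
      obtain ⟨Y, hY, hY'⟩ := exists_isFin hV hZ (s'.image f')
      let g0 : Option J → V := fun k => k.elim Y f'
      have hg0 : ∀ t ⊆ s', Coded Δ f' t ↔ A t ∈ 𝒱 := fun t ht =>
        (coded_iff hV hΔ f f' (fun _ => rfl) t).trans (hf t ht).symm
      refine ⟨fun k => S.toSpec 𝒱 (i (g0 k)), fun k hk => ?_⟩
      have : Nonempty V := ⟨Δ⟩
      have e : (Sum.elim (fun x => S.toSpec 𝒱 (i (p0 x))) fun k => S.toSpec 𝒱 (i (g0 k))) =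
          fun x => S.toSpec 𝒱 (i (Sum.elim p0 g0 x)) := by
        ext (x | x) <;> rfl
      rw [e, realize_spec_iff S hi h𝒱]
      rcases k with t | t | (_ | j)
      · simp only [ψ, Sum.elim_inl, realize_codedF, Sum.elim_inr]
        exact (hg0 t (hsub _ hk)).2 (hs _ hk)
      · simp only [ψ, Sum.elim_inl, realize_codedF, Sum.elim_inr, Formula.realize_not]
        exact fun hc => h𝒱.compl_mem.1 (hs _ hk) ((hg0 t (hsub _ hk)).1 hc)
      · simpa [ψ, g0] using hY
      · simp only [ψ, Sum.elim_inr, Option.elim, Formula.realize_inf, realize_memF, Sum.elim_inl]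
        refine ⟨(f j).2, hY' _ (Finset.mem_image_of_mem _ (hsub _ hk ?_))⟩
        simp)
  have real : ∀ {𝒱 : Order.PFilter B}, IsUltrafilter 𝒱 → ∀ k, b k ∈ 𝒱 → (ψ k).Realize
      (Sum.elim (fun x => S.toSpec 𝒱 (i (p0 x))) fun k => S.toSpec 𝒱 (g k)) := by
    intro 𝒱 h𝒱 k hk
    have := (S.realize_spec h𝒱 (ψ k) (Sum.elim (fun x => i (p0 x)) g)).2 (𝒱.mem_of_le (hg k) hk)
    convert this using 1
    ext (x | x) <;> rfl
  have hcode : ∀ {𝒱 : Order.PFilter B}, IsUltrafilter 𝒱 → ∀ s, A s ∈ 𝒱 ↔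
      Coded (S.toSpec 𝒱 (i Δ)) (fun j => S.toSpec 𝒱 (g (some j))) s := by
    intro 𝒱 h𝒱 s
    constructor
    · intro hs
      have := real h𝒱 (.inl s) hs
      simp only [ψ, Sum.elim_inl, realize_codedF, Sum.elim_inr] at this
      exact this
    · intro hs
      by_contra hc
      have := real h𝒱 (.inr (.inl s)) (h𝒱.compl_mem.2 hc)
      simp only [ψ, Sum.elim_inl, realize_codedF, Sum.elim_inr, Formula.realize_not] at this
      exact this hs
  have hfin := real hU (.inr (.inr none)) U.top_mem
  simp only [ψ, Sum.elim_inr, Option.elim, realize_finF] at hfin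
  have hmem : ∀ j, E (S.toSpec U (g (some j))) (S.toSpec U (i I)) ∧
      E (S.toSpec U (g (some j))) (S.toSpec U (g none)) := fun j => by
    have := real hU (.inr (.inr (some j))) U.top_mem
    simp only [ψ, Sum.elim_inr, Option.elim, Formula.realize_inf, realize_memF,
      Sum.elim_inl] at this
    exact this
  obtain ⟨d, hd, hd'⟩ := h (Set.range fun j => S.toSpec U (g (some j)))
    ⟨_, hfin, by rintro _ ⟨j, rfl⟩; exact (hmem j).2⟩ (by rintro _ ⟨j, rfl⟩; exact (hmem j).1)
    (Cardinal.mk_range_le.trans hJ) (by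
      intro s hs
      obtain ⟨t, rfl⟩ : ∃ t : Finset J, s = t.image fun j => S.toSpec U (g (some j)) := by
        obtain ⟨t, -, rfl⟩ := Finset.subset_set_image_iff.1 (by simpa using hs :
          (s : Set _) ⊆ (fun j => S.toSpec U (g (some j))) '' Set.univ)
        exact ⟨t, rfl⟩
      obtain ⟨d, hd, h⟩ := (hcode hU t).1 (hm t)
      exact ⟨d, hd, fun y => (h y).trans (by simp [eq_comm])⟩)
  obtain ⟨d, rfl⟩ := S.toSpec_surjective d
  have hval : ∀ {𝒱 : Order.PFilter B}, IsUltrafilter 𝒱 → ∀ j,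
      S.val (memF d (i Δ) ⊓ memF (g (some j)) d) ∈ 𝒱 ↔ E (S.toSpec 𝒱 d) (S.toSpec 𝒱 (i Δ)) ∧
        E (S.toSpec 𝒱 (g (some j))) (S.toSpec 𝒱 d) := by
    intro 𝒱 h𝒱 j
    rw [← S.realize_toSpec h𝒱]
    simp
  refine (hasMultiplicativeRefinement_iff hU).2
    ⟨fun j => S.val (memF d (i Δ) ⊓ memF (g (some j)) d), fun j => ?_, fun s => ?_⟩
  · exact (hval hU j).2 ⟨hd, hd' _ ⟨j, rfl⟩⟩
  · rcases s.eq_empty_or_nonempty with rfl | ⟨j₀, hj₀⟩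
    · rw [hA.empty]; exact le_top
    refine le_of_forall_ultrafilter fun 𝒱 h𝒱 hs => ?_
    rw [pfilter_finset_inf_mem_iff] at hs
    exact (hcode h𝒱 s).2 (coded_spec_of_mem S hi h𝒱 hV hΔ ((hval h𝒱 j₀).1 (hs _ hj₀)).1
      fun j hj => ((hval h𝒱 j).1 (hs j hj)).2)

-- The values of `{f j : j ∈ s} ∈ i Δ` form a pattern distribution: its trace at an ultrafilter is a
-- finite configuration in the specialization, and elementarity reflects it into `V`. A refinement
-- `a` gives the bounds `a j ≤ ‖f j ∈ d‖`, which one `d` can meet.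
open Classical in
theorem exists_cover_of_lt_lambdaPattern [Nonempty (I : ZFSet.{u})]
    (h : (κ : WithTop Cardinal.{u}) < lambdaPattern U (setPattern hΔ))
    {X : Set (S.Spec U)} (hXI : ∀ x ∈ X, E x (S.toSpec U (i I))) (hX : #X ≤ κ)
    (hc : ∀ s : Finset (S.Spec U), ↑s ⊆ X → ∃ d, E d (S.toSpec U (i Δ)) ∧ ∀ y, E y d ↔ y ∈ s) :
    ∃ d, E d (S.toSpec U (i Δ)) ∧ ∀ x ∈ X, E x d := by
  rw [lt_lambdaPattern_iff] at h
  -- Representatives must lie in `i I` at all ultrafilters, not only at `U`. Where a given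
  -- representative `q` fails to do so, it is replaced by some other element of `i I`.
  have hf : ∀ x : X, ∃ r : N, S.toSpec U r = x ∧ ∀ 𝒱 : Order.PFilter B, IsUltrafilter 𝒱 →
      E (S.toSpec 𝒱 r) (S.toSpec 𝒱 (i I)) := by
    intro x
    obtain ⟨q, hq⟩ := S.toSpec_surjective (x : S.Spec U)
    let φ : setLang.Formula (N ⊕ Unit) := memF (.inr ()) (.inl (i I)) ⊓
      (memF (.inl q) (.inl (i I))).imp (eqv (.inr ()) (.inl q))
    obtain ⟨r, hr⟩ := S.exists_witness φ
    have key : ∀ 𝒱 : Order.PFilter B, IsUltrafilter 𝒱 → E (S.toSpec 𝒱 r) (S.toSpec 𝒱 (i I)) ∧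
        (E (S.toSpec 𝒱 q) (S.toSpec 𝒱 (i I)) → S.toSpec 𝒱 r = S.toSpec 𝒱 q) := by
      intro 𝒱 h𝒱
      have h1 : S.val (exF φ) ∈ 𝒱 := by
        rw [← S.realize_toSpec h𝒱]
        simp only [φ, realize_exF, exists_unit_fun, Formula.realize_inf, realize_memF,
          Formula.realize_imp, realize_eqv, Sum.elim_inr, Sum.elim_inl]
        by_cases hqI : E (S.toSpec 𝒱 q) (S.toSpec 𝒱 (i I))
        · exact ⟨_, hqI, fun _ => rfl⟩
        · obtain ⟨z⟩ := ‹Nonempty (I : ZFSet.{u})›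
          refine ⟨S.toSpec 𝒱 (i ⟨z, hV.mem_trans z.2 I.2⟩), ?_, fun h => absurd h hqI⟩
          have := (realize_spec_iff S hi h𝒱 (memF (0 : Fin 2) 1)
            ![⟨z, hV.mem_trans z.2 I.2⟩, I]).2 ((realize_memF _ _ _).2 z.2)
          simpa using this
      rw [← hr] at h1
      have := (S.realize_spec h𝒱 φ (Sum.elim id fun _ => r)).2 h1
      simpa [φ] using this
    exact ⟨r, ((key U hU).2 (hq ▸ hXI x x.2)).trans hq, fun 𝒱 h𝒱 => (key 𝒱 h𝒱).1⟩
  choose f hfU hfI using hf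
  let A : Finset X → B := fun s => S.val (codedF (i Δ) f s)
  have hval : ∀ {𝒱 : Order.PFilter B}, IsUltrafilter 𝒱 → ∀ s, A s ∈ 𝒱 ↔
      Coded (S.toSpec 𝒱 (i Δ)) (fun j => S.toSpec 𝒱 (f j)) s := by
    intro 𝒱 h𝒱 s
    rw [← S.realize_toSpec h𝒱, realize_codedF]
  have hAU : ∀ s, A s ∈ U := by
    intro s
    obtain ⟨d, hd, h⟩ := hc (s.map (Function.Embedding.subtype _)) (by
      intro x hx; simp at hx; exact hx.1)
    refine (hval hU s).2 ⟨d, hd, fun y => (h y).trans ?_⟩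
    simp only [Finset.mem_map, hfU]
    exact exists_congr fun j => and_congr_right fun _ => eq_comm
  have : Nonempty V := ⟨Δ⟩
  have hcov : ∀ {𝒱 : Order.PFilter B}, IsUltrafilter 𝒱 → ∀ s, A s ∈ 𝒱 → ∃ d,
      E d (S.toSpec 𝒱 (i Δ)) ∧ ∀ j ∈ s, E (S.toSpec 𝒱 (f j)) d := by
    intro 𝒱 h𝒱 s hs
    obtain ⟨d, hd, h⟩ := (hval h𝒱 s).1 hs
    exact ⟨d, hd, fun j hj => (h _).2 ⟨j, hj, rfl⟩⟩
  have hdist : IsPatternDistribution (setPattern hΔ) A := by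
    refine isPatternDistribution_iff_of_nonempty.2
      ⟨⟨fun s => hU.ne_bot (hAU s), ?_, fun s t hst => ?_⟩, fun s 𝒱 h𝒱 => ?_⟩
    · refine top_unique (le_of_forall_ultrafilter fun 𝒱 h𝒱 _ => (hval h𝒱 _).2 ?_)
      have h1 := (hval hU ∅).1 (hAU ∅)
      have h2 := (realize_spec_iff S hi hU (codedF () (fun j : X => ()) ∅) fun _ => Δ).1
        (by rw [realize_codedF]; rwa [coded_congr (y := fun j => S.toSpec U (f j)) (by simp)])
      have h3 := (realize_spec_iff S hi h𝒱 (codedF () (fun j : X => ()) ∅) fun _ => Δ).2 h2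
      rw [realize_codedF] at h3
      rwa [coded_congr (y := fun j => S.toSpec 𝒱 (f j)) (by simp)] at h3
    · refine le_of_forall_ultrafilter fun 𝒱 h𝒱 ht => (hval h𝒱 _).2 ?_
      obtain ⟨d, hd, h⟩ := hcov h𝒱 t ht
      exact coded_spec_of_mem S hi h𝒱 hV hΔ hd fun j hj => h j (hst hj)
    · let φ : setLang.Formula Bool := exF (β := X) (infF s (fun j => memF (.inr j) (.inl false)) ⊓
        combF {P | ∀ t : s.powerset, t ∈ P ↔ A t ∈ 𝒱}
          fun t : s.powerset => codedF (.inl true) (fun j => .inr j) (t : Finset X))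
      obtain ⟨x, hx, hx'⟩ : ∃ x : X → V, (∀ j ∈ s, E (x j) I) ∧ ∀ t : s.powerset,
          Coded Δ x t ↔ A t ∈ 𝒱 := by
        have := (realize_spec_iff S hi h𝒱 φ fun b => if b then Δ else I).1 (by
          simp only [φ, realize_exF, Formula.realize_inf, realize_infF, realize_memF,
            realize_combF, realize_codedF, Sum.elim_inr, Sum.elim_inl, Set.mem_ofPred_eq]
          exact ⟨fun j => S.toSpec 𝒱 (f j), fun j _ => hfI j 𝒱 h𝒱, fun t => (hval h𝒱 t).symm⟩)
        simp only [φ, realize_exF, Formula.realize_inf, realize_infF, realize_memF,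
          realize_combF, realize_codedF, Sum.elim_inr, Sum.elim_inl, Set.mem_ofPred_eq] at this
        exact this
      obtain ⟨z⟩ := ‹Nonempty (I : ZFSet.{u})›
      let g : X → (I : ZFSet.{u}) := fun j => if h : j ∈ s then ⟨x j, hx j h⟩ else z
      refine ⟨g, fun t ht => ?_⟩
      refine (hx' ⟨t, Finset.mem_powerset.2 ht⟩).symm.trans (Iff.trans ?_
        (coded_iff hV hΔ g (fun j => ⟨g j, hV.mem_trans (g j).2 I.2⟩) (fun _ => rfl) t))
      exact coded_congr fun j hj => Subtype.ext (by simp [g, ht hj])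
  obtain ⟨a, ha, haA⟩ := (hasMultiplicativeRefinement_iff hU).1 (h X A hX hdist hAU)
  let p : Option X → N := fun k => k.elim (i Δ) f
  let ψ : Option X → setLang.Formula (Option X ⊕ PUnit.{u + 1}) := fun k =>
    k.elim (memF (.inr .unit) (.inl none)) fun j => memF (.inl (some j)) (.inr .unit)
  obtain ⟨g, hg⟩ := S.exists_realization hκ hS (P := Option X) (C := PUnit.{u + 1})
    (by rw [Cardinal.mk_option]; exact Cardinal.add_le_of_le hκ hX (Cardinal.one_le_aleph0.trans hκ))
    ((Cardinal.lt_aleph0_of_finite _).le.trans hκ) p ψ (fun k => k.elim ⊤ a) (by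
      intro s 𝒱 h𝒱 hs
      obtain ⟨d, hd, h⟩ := hcov h𝒱 s.eraseNone (𝒱.mem_of_le (haA _)
        (pfilter_finset_inf_mem_iff.2 fun j hj => hs (some j) (Finset.mem_eraseNone.1 hj)))
      refine ⟨fun _ => d, fun k hk => ?_⟩
      rcases k with _ | j
      · simpa [ψ, p] using hd
      · simpa [ψ, p] using h j (Finset.mem_eraseNone.2 hk))
  have real : ∀ k, (k.elim ⊤ a : B) ∈ U → (ψ k).Realize
      (fun x => S.toSpec U (Sum.elim p g x)) := fun k hk =>
    (S.realize_spec hU (ψ k) (Sum.elim p g)).2 (U.mem_of_le (hg k) hk)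
  refine ⟨S.toSpec U (g .unit), by simpa [ψ, p] using real none U.top_mem, fun x hx => ?_⟩
  have := real (some ⟨x, hx⟩) (ha _)
  simpa [ψ, p, hfU] using this

end ElementaryInto

/-- The invariant of a pattern can be computed in the specialization of a saturated
Boolean-valued elementary extension of a transitive model of set theory. -/
theorem lt_lambdaPattern_iff_lt_lambdaModel {B : Type u} [CompleteBooleanAlgebra B]
    {U : Order.PFilter B} (hU : IsUltrafilter U) {κ : Cardinal.{u}} {V : ZFSet.{u}}
    (hV : V.IsTransitive) (hZ : IsModelZFCMinus V) {N : Type u} (S : FullBVStructure setLang B N)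
    {i : V → N} (hi : IsElementaryInto S.toBVStructure i) (hS : S.IsSuccSaturated κ) (I Δ : V)
    (hΔ : IsPatternOn (Δ : ZFSet.{u}) (I : ZFSet.{u})) :
    (κ : WithTop Cardinal.{u}) < lambdaPattern U (setPattern hΔ) ↔
      (κ : WithTop Cardinal.{u}) < lambdaModel (fun a : V => S.toSpec U (i a)) Δ I := by
  classical
  -- For finite `κ` both sides hold: finite distributions have refinements, and a finite `X` is
  -- covered by its own code.
  rcases lt_or_ge κ ℵ₀ with hκ | hκ
  · rw [lt_lambdaPattern_iff, lt_lambdaModel_iff]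
    refine iff_of_true (fun J A hJ hA hm => ?_) fun X _ _ hX h => ?_
    · have : Finite J := Cardinal.lt_aleph0_iff_finite.1 (hJ.trans_lt hκ)
      exact hasMultiplicativeRefinement_of_finite hU hA.1 hm
    · have : Finite X := Cardinal.lt_aleph0_iff_finite.1 (hX.trans_lt hκ)
      obtain ⟨d, hd, h⟩ := h (Set.toFinite X).toFinset (by simp)
      exact ⟨d, hd, fun x hx => (h x).2 (by simpa using hx)⟩
  · constructor
    · intro h
      rw [lt_lambdaModel_iff]
      intro X _ hXI hX hc
      rcases isEmpty_or_nonempty (I : ZFSet.{u}) with he | hne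
      · obtain ⟨d, hd, -⟩ := hc ∅ (by simp)
        refine ⟨d, hd, fun x hx => ?_⟩
        have : Nonempty V := ⟨Δ⟩
        have h1 := (realize_spec_iff S hi hU (exF (β := Unit) (memF (.inr ()) (.inl ())))
          fun _ => I).1 (by simpa [exists_unit_fun] using ⟨x, hXI x hx⟩)
        simp only [realize_exF, exists_unit_fun, realize_memF, Sum.elim_inr, Sum.elim_inl] at h1
        obtain ⟨z, hz⟩ := h1
        exact he.elim ⟨z, hz⟩
      · exact exists_cover_of_lt_lambdaPattern S hi hU hV hΔ hκ hS h hXI hX hc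
    · intro h
      rw [lt_lambdaPattern_iff]
      intro J A hJ hA hm
      rcases isEmpty_or_nonempty (I : ZFSet.{u}) with he | hne
      · have : IsEmpty J := ⟨fun j => by
          obtain ⟨f, -⟩ := (isPatternDistribution_iff.1 hA).2 {j} U hU
          exact he.elim (f ⟨j, by simp⟩)⟩
        exact hasMultiplicativeRefinement_of_finite hU hA.1 hm
      · exact hasMultiplicativeRefinement_of_lt_lambdaModel S hi hU hV hΔ hκ hS hZ h hJ hA hm

/-! ## Saturated specializations realize tuples -/

section Tuples

variable {L : FirstOrder.Language.{0, 0}}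

/-- The sentence expressing that a formula has a solution. -/
def existsF {α : Type*} (φ : L.Formula α) : L.Sentence := exF (α := Empty) (φ.relabel Sum.inr)

theorem realize_existsF {α N : Type*} [L.Structure N] [Nonempty N] (φ : L.Formula α) :
    N ⊨ existsF φ ↔ ∃ a : α → N, φ.Realize a := by
  simp [existsF, Sentence.Realize, Formula.realize_relabel]

/-- The complete theory decides whether a formula has a solution. This moves finite configurations
between `M` and the specializations at different ultrafilters. -/
theorem exists_realize_of_isComplete {T : L.Theory} (hT : T.IsComplete) {N : Type v} {N' : Type w}
    [L.Structure N] [L.Structure N'] [Nonempty N] [Nonempty N'] (hN : N ⊨ T) (hN' : N' ⊨ T)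
    {α : Type*} (φ : L.Formula α) (h : ∃ a : α → N, φ.Realize a) : ∃ a : α → N', φ.Realize a :=
  (realize_existsF φ).1 ((hT.realize_sentence_iff _ N').2
    ((hT.realize_sentence_iff _ N).1 ((realize_existsF φ).2 h)))

variable {X Y J : Type*}

/-- The finitely many formulas `Φ j (x, b j)` with `j ∈ s` have a common solution. -/
def Cons {W : Type*} [L.Structure W] (Φ : J → L.Formula (X ⊕ Y)) (b : J → Y → W) (s : Finset J) :
    Prop :=
  ∃ x : X → W, ∀ j ∈ s, (Φ j).Realize (Sum.elim x (b j))

/-- The formula defining `Cons`. -/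
def consF (Φ : J → L.Formula (X ⊕ Y)) (s : Finset J) : L.Formula (J × Y) :=
  exF (β := X) (infF s fun j => (Φ j).relabel (Sum.elim Sum.inr fun y => Sum.inl (j, y)))

theorem realize_relabel_elim {α β γ W : Type*} [L.Structure W] (φ : L.Formula (α ⊕ β)) (f : α → γ)
    (g : β → γ) (v : γ → W) : (φ.relabel (Sum.elim f g)).Realize v ↔
      φ.Realize (Sum.elim (fun i => v (f i)) fun i => v (g i)) := by
  rw [Formula.realize_relabel, Sum.comp_elim]
  rfl

@[simp]
theorem realize_consF {W : Type*} [L.Structure W] [Nonempty W] (Φ : J → L.Formula (X ⊕ Y))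
    (s : Finset J) (c : J × Y → W) :
    (consF Φ s).Realize c ↔ Cons Φ (fun j y => c (j, y)) s := by
  simp only [consF, Cons, realize_exF, realize_infF, realize_relabel_elim, Sum.elim_inr,
    Sum.elim_inl]

theorem Cons.mono {W : Type*} [L.Structure W] {Φ : J → L.Formula (X ⊕ Y)} {b : J → Y → W}
    {s t : Finset J} (h : Cons Φ b t) (hst : s ⊆ t) : Cons Φ b s :=
  h.imp fun _ hx j hj => hx j (hst hj)

/-- The subsets of `s` that are consistent are those satisfying `P`. -/
def patternF (Φ : J → L.Formula (X ⊕ Y)) (s : Finset J) (P : Finset J → Prop) : L.Formula (J × Y) :=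
  combF {Q | ∀ t : s.powerset, t ∈ Q ↔ P t} fun t : s.powerset => consF Φ t.1

theorem realize_patternF {W : Type*} [L.Structure W] [Nonempty W] (Φ : J → L.Formula (X ⊕ Y))
    (s : Finset J) (P : Finset J → Prop) (c : J × Y → W) : (patternF Φ s P).Realize c ↔
      ∀ t ⊆ s, P t ↔ Cons Φ (fun j y => c (j, y)) t := by
  simp only [patternF, realize_combF, Set.mem_ofPred_eq, realize_consF, Subtype.forall,
    Finset.mem_powerset]
  exact forall₂_congr fun _ _ => iff_comm

/-- The first coordinate `x₀` realizes the projections of all finite parts of the type; the other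
coordinates are then found over the parameters extended by `x₀`. -/
theorem IsSuccSaturated.exists_tuple {κ : Cardinal.{u}} (hκ : ℵ₀ ≤ κ) {W : Type u} [L.Structure W]
    [Nonempty W] (h : IsSuccSaturated L W κ) (n : ℕ) :
    ∀ {P : Type u}, #P ≤ κ → ∀ (a : P → W) (p : Set (L.Formula (P ⊕ Fin n))),
      (∀ s : Finset (L.Formula (P ⊕ Fin n)), ↑s ⊆ p →
        ∃ x : Fin n → W, ∀ φ ∈ s, φ.Realize (Sum.elim a x)) →
      ∃ x : Fin n → W, ∀ φ ∈ p, φ.Realize (Sum.elim a x) := by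
  classical
  induction n with
  | zero =>
    intro P hP a p hp
    refine ⟨Fin.elim0, fun φ hφ => ?_⟩
    obtain ⟨x, hx⟩ := hp {φ} (by simpa using hφ)
    rw [Subsingleton.elim Fin.elim0 x]
    exact hx φ (by simp)
  | succ n ih =>
    intro P hP a p hp
    let split : P ⊕ Fin (n + 1) → (P ⊕ Unit) ⊕ Fin n :=
      Sum.elim (fun i => .inl (.inl i)) (Fin.cases (.inl (.inr ())) .inr)
    have hsplit : ∀ (x₀ : W) (x : Fin n → W), Sum.elim (Sum.elim a fun _ => x₀) x ∘ split =
        Sum.elim a (Fin.cons x₀ x) := by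
      intro x₀ x
      ext (i | i)
      · rfl
      · refine Fin.cases ?_ (fun i => ?_) i <;> simp [split]
    let Q : Finset (L.Formula (P ⊕ Fin (n + 1))) → L.Formula (P ⊕ Unit) := fun s =>
      exF (β := Fin n) (infF s fun φ => φ.relabel split)
    have hQ : ∀ s x₀, (Q s).Realize (Sum.elim a fun _ => x₀) ↔
        ∃ x : Fin n → W, ∀ φ ∈ s, φ.Realize (Sum.elim a (Fin.cons x₀ x)) := by
      intro s x₀
      simp only [Q, realize_exF, realize_infF, Formula.realize_relabel, hsplit]
    let ra : P ⊕ Unit → Set.range a ⊕ Unit := Sum.map (fun i => ⟨a i, i, rfl⟩) id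
    have hra : ∀ (χ : L.Formula (P ⊕ Unit)) (x₀ : W), (χ.relabel ra).Realize
        (Sum.elim (fun i : Set.range a => (i : W)) fun _ => x₀) ↔
          χ.Realize (Sum.elim a fun _ => x₀) := by
      intro χ x₀
      rw [Formula.realize_relabel]
      refine iff_of_eq (congrArg χ.Realize ?_)
      ext (i | i) <;> rfl
    obtain ⟨x₀, hx₀⟩ := h (Set.range a) (mk_range_le.trans hP)
      {χ | ∃ s : Finset (L.Formula (P ⊕ Fin (n + 1))), ↑s ⊆ p ∧ χ = (Q s).relabel ra} (by
        intro t ht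
        choose! s hs hs' using ht
        obtain ⟨x, hx⟩ := hp (t.biUnion s) (by
          intro φ hφ
          simp only [Finset.coe_biUnion, Set.mem_iUnion] at hφ
          obtain ⟨χ, hχ, h⟩ := hφ
          exact hs hχ h)
        refine ⟨x 0, fun χ hχ => ?_⟩
        rw [hs' hχ, hra, hQ]
        refine ⟨Fin.tail x, fun φ hφ => ?_⟩
        rw [Fin.cons_self_tail]
        exact hx φ (Finset.mem_biUnion.2 ⟨χ, hχ, hφ⟩))
    obtain ⟨x, hx⟩ := ih (P := P ⊕ PUnit.{u + 1}) (by
        rw [Cardinal.mk_sum, Cardinal.lift_id, Cardinal.lift_id]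
        exact Cardinal.add_le_of_le hκ hP ((Cardinal.lt_aleph0_of_finite _).le.trans hκ))
      (Sum.elim a fun _ => x₀)
      ((fun φ => φ.relabel (Sum.map (Sum.map id fun _ => PUnit.unit) id ∘ split)) '' p) (by
        intro t ht
        obtain ⟨s, hs, rfl⟩ := Finset.subset_set_image_iff.1 ht
        obtain ⟨x, hx⟩ := (hQ s x₀).1 ((hra _ _).1 (hx₀ _ ⟨s, hs, rfl⟩))
        refine ⟨x, fun χ hχ => ?_⟩
        obtain ⟨φ, hφ, rfl⟩ := Finset.mem_image.1 hχ
        rw [Formula.realize_relabel]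
        convert hx φ hφ using 1
        rw [← hsplit]
        ext (i | i)
        · rfl
        · refine Fin.cases ?_ (fun i => ?_) i <;> simp [split])
    refine ⟨Fin.cons x₀ x, fun φ hφ => ?_⟩
    have := hx _ ⟨φ, hφ, rfl⟩
    rw [Formula.realize_relabel] at this
    convert this using 1
    rw [← hsplit]
    ext (i | i)
    · rfl
    · refine Fin.cases ?_ (fun i => ?_) i <;> simp [split]

variable {B : Type u} [CompleteBooleanAlgebra B] {N : Type u}

theorem FullBVStructure.model_spec (S : FullBVStructure L B N) {T : L.Theory} (hS : S.IsModel T)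
    {U : Order.PFilter B} (hU : IsUltrafilter U) : S.Spec U ⊨ T := by
  refine ⟨fun σ hσ => ?_⟩
  have := (S.realize_spec hU σ (Empty.elim : Empty → N)).2 ((hS σ hσ).symm ▸ U.top_mem)
  rw [Sentence.Realize]
  convert this

-- Which subfamilies of finitely many instances of `φ` are consistent is expressed by a first-order
-- formula in the parameters, so `M` may be replaced by the specializations of any full
-- Boolean-valued model.
open Classical in
theorem isPatternDistribution_formulaPattern_iff {T : L.Theory} (hT : T.IsComplete) {M : Type w}
    [L.Structure M] [Nonempty M] (hM : M ⊨ T) (S : FullBVStructure L B N) (hS : S.IsModel T)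
    {n m : ℕ} (φ : L.Formula (Fin n ⊕ Fin m)) {J : Type u} {A : Finset J → B} :
    IsPatternDistribution (formulaPattern M φ) A ↔ IsDistribution A ∧
      ∀ (s : Finset J) (𝒱 : Order.PFilter B), IsUltrafilter 𝒱 → ∃ f : J → Fin m → S.Spec 𝒱,
        ∀ t ⊆ s, A t ∈ 𝒱 ↔ Cons (fun _ => φ) f t := by
  rw [isPatternDistribution_iff_of_nonempty]
  refine and_congr_right fun _ => forall₃_congr fun s 𝒱 h𝒱 => ?_
  let χ : L.Formula (J × Fin m) := patternF (fun _ => φ) s (A · ∈ 𝒱)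
  have hpat : ∀ {_ : DecidableEq (Fin m → M)} (f : J → Fin m → M) (t : Finset J),
      t.image f ∈ (formulaPattern M φ).carrier ↔ Cons (fun _ => φ) f t := by
    intro _ f t
    simp [formulaPattern, Cons]
  constructor
  · rintro ⟨f, hf⟩
    obtain ⟨c, hc⟩ := exists_realize_of_isComplete hT hM (S.model_spec hS h𝒱) χ
      ⟨fun x => f x.1 x.2, (realize_patternF _ _ _ _).2 fun t ht => (hf t ht).trans (hpat f t)⟩
    exact ⟨fun j y => c (j, y), (realize_patternF _ _ _ _).1 hc⟩
  · rintro ⟨f, hf⟩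
    obtain ⟨c, hc⟩ := exists_realize_of_isComplete hT (S.model_spec hS h𝒱) hM χ
      ⟨fun x => f x.1 x.2, (realize_patternF _ _ _ _).2 hf⟩
    exact ⟨fun j y => c (j, y), fun t ht => ((realize_patternF _ _ _ _).1 hc t ht).trans (hpat _ t).symm⟩

/-- If `U` saturates `T`, then distributions for the patterns of `T` have multiplicative
refinements. -/
theorem lt_lambdaFormula_of_succSaturates [Countable L.Symbols] {U : Order.PFilter B}
    (hU : IsUltrafilter U) {T : L.Theory} (hT : T.IsComplete) {M : Type w} [L.Structure M]
    [Nonempty M] (hM : M ⊨ T) {κ : Cardinal.{u}} (hκ : ℵ₀ ≤ κ) (h : SuccSaturates U T κ) {n m : ℕ}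
    (φ : L.Formula (Fin n ⊕ Fin m)) : (κ : WithTop Cardinal.{u}) < lambdaFormula U M φ := by
  classical
  obtain ⟨N, S, hST, hS, hSU⟩ := h
  rw [lambdaFormula, lt_lambdaPattern_iff]
  intro J A hJ hA hAU
  obtain ⟨-, hA⟩ := (isPatternDistribution_formulaPattern_iff hT hM S hST φ).1 hA
  have hC : #(J × Fin m) ≤ κ := by
    rw [Cardinal.mk_prod, Cardinal.lift_uzero, Cardinal.mk_fin, Cardinal.lift_natCast]
    exact Cardinal.mul_le_of_le hκ hJ (Cardinal.natCast_lt_aleph0.le.trans hκ)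
  -- As for models of set theory, bounds on both sides produce parameters `g` whose consistency
  -- values are exactly those of `A`.
  let ψ : Finset J ⊕ Finset J → L.Formula (PEmpty.{u + 1} ⊕ (J × Fin m)) :=
    Sum.elim (fun s => (consF (fun _ => φ) s).relabel Sum.inr)
      (fun s => (consF (fun _ => φ) s).not.relabel Sum.inr)
  obtain ⟨g, hg⟩ := S.exists_realization hκ hS (P := PEmpty.{u + 1}) (by simp) hC PEmpty.elim ψ
    (Sum.elim A fun s => (A s)ᶜ) (by
      intro s 𝒱 h𝒱 hs
      obtain ⟨f, hf⟩ := hA (s.biUnion (Sum.elim id id)) 𝒱 h𝒱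
      refine ⟨fun x => f x.1 x.2, fun k hk => ?_⟩
      have hk' := hf _ (Finset.subset_biUnion_of_mem (Sum.elim id id) hk)
      have := hs k hk
      rcases k with t | t
      · simp only [ψ, Sum.elim_inl, Formula.realize_relabel, Sum.elim_comp_inr, realize_consF]
        exact hk'.1 this
      · simp only [ψ, Sum.elim_inr, Formula.realize_relabel, Sum.elim_comp_inr, realize_consF,
          Formula.realize_not]
        exact fun hc => h𝒱.compl_mem.1 this (hk'.2 hc))
  have hcons : ∀ {𝒱 : Order.PFilter B}, IsUltrafilter 𝒱 → ∀ s, A s ∈ 𝒱 ↔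
      Cons (fun _ => φ) (fun j y => S.toSpec 𝒱 (g (j, y))) s := by
    intro 𝒱 h𝒱 s
    have h1 := fun k h => (S.realize_spec h𝒱 (ψ k) (Sum.elim PEmpty.elim g)).2
      (𝒱.mem_of_le (hg k) h)
    constructor
    · intro hs
      have := h1 (.inl s) hs
      simpa only [ψ, Sum.elim_inl, Formula.realize_relabel, Function.comp_def, Sum.elim_inr,
        realize_consF] using this
    · intro hs
      by_contra hc
      have := h1 (.inr s) (h𝒱.compl_mem.2 hc)
      simp only [ψ, Sum.elim_inr, Formula.realize_relabel, Function.comp_def,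
        realize_consF, Formula.realize_not] at this
      exact this hs
  let ρ : J → L.Formula ((J × Fin m) ⊕ Fin n) := fun j =>
    φ.relabel (Sum.elim Sum.inr fun y => Sum.inl (j, y))
  have hρ : ∀ {W : Type u} [L.Structure W] (c : J × Fin m → W) (x : Fin n → W) (j : J),
      (ρ j).Realize (Sum.elim c x) ↔ φ.Realize (Sum.elim x fun y => c (j, y)) := by
    intro W _ c x j
    simp only [ρ, realize_relabel_elim, Sum.elim_inr, Sum.elim_inl]
  obtain ⟨x, hx⟩ := hSU.exists_tuple hκ n hC (fun i => S.toSpec U (g i)) (Set.range ρ) (by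
    intro s hs
    obtain ⟨t, rfl⟩ : ∃ t : Finset J, s = t.image ρ := by
      obtain ⟨t, -, rfl⟩ := Finset.subset_set_image_iff.1 (by simpa using hs :
        (s : Set _) ⊆ ρ '' Set.univ)
      exact ⟨t, rfl⟩
    obtain ⟨x, hx⟩ := (hcons hU t).1 (hAU t)
    refine ⟨x, fun χ hχ => ?_⟩
    obtain ⟨j, hj, rfl⟩ := Finset.mem_image.1 hχ
    exact (hρ _ _ _).2 (hx j hj))
  choose e he using fun i => S.toSpec_surjective (x i)
  -- At `U` the tuple `e` solves all instances, so these values are in `U`. At any ultrafilter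
  -- containing `a j` for all `j ∈ s`, the same tuple witnesses the consistency of `s`.
  let a : J → B := fun j => S.val ((ρ j).relabel (Sum.elim g e))
  have ha : ∀ {𝒱 : Order.PFilter B}, IsUltrafilter 𝒱 → ∀ j, a j ∈ 𝒱 ↔
      φ.Realize (Sum.elim (fun k => S.toSpec 𝒱 (e k)) fun y => S.toSpec 𝒱 (g (j, y))) := by
    intro 𝒱 h𝒱 j
    rw [← hρ (fun i => S.toSpec 𝒱 (g i)), ← S.realize_spec h𝒱]
    refine iff_of_eq (congrArg (ρ j).Realize ?_)
    ext (i | i) <;> rfl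
  refine (hasMultiplicativeRefinement_iff hU).2 ⟨a, fun j => (ha hU j).2 ?_, fun s => ?_⟩
  · simp only [he]
    exact (hρ _ _ _).1 (hx _ ⟨j, rfl⟩)
  · refine le_of_forall_ultrafilter fun 𝒱 h𝒱 hs => (hcons h𝒱 s).2 ?_
    rw [pfilter_finset_inf_mem_iff] at hs
    exact ⟨_, fun j hj => (ha h𝒱 j).1 (hs j hj)⟩

end Tuples

/-! ## Refinements from formulas in a single variable -/

section Refinements

variable {L : FirstOrder.Language.{0, 0}}

/-- The values of `Cons` in a Boolean-valued structure. -/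
def consVal {X Y J N : Type*} {B : Type*} [CompleteBooleanAlgebra B] (S : FullBVStructure L B N)
    (Φ : J → L.Formula (X ⊕ Y)) (b : J → Y → N) (s : Finset J) : B :=
  S.val ((consF Φ s).relabel fun x => b x.1 x.2)

variable {B : Type u} [CompleteBooleanAlgebra B] {N : Type u} (S : FullBVStructure L B N)
  {U : Order.PFilter B} (hU : IsUltrafilter U)

section ConsVal

variable {X Y J : Type*} (Φ : J → L.Formula (X ⊕ Y)) (b : J → Y → N)

include hU in
theorem consVal_mem (s : Finset J) :
    consVal S Φ b s ∈ U ↔ Cons Φ (fun j y => S.toSpec U (b j y)) s := by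
  rw [consVal, ← S.realize_spec hU, realize_consF]

theorem consVal_empty : consVal S Φ b ∅ = ⊤ := by
  refine top_unique (le_of_forall_ultrafilter fun _ h𝒱 _ => (consVal_mem S h𝒱 Φ b ∅).2 ?_)
  exact ⟨fun _ => Classical.arbitrary _, by simp⟩

include hU in
theorem isDistribution_consVal (h : ∀ s, consVal S Φ b s ∈ U) : IsDistribution (consVal S Φ b) :=
  ⟨fun s => hU.ne_bot (h s), consVal_empty S Φ b, fun s t hst =>
    le_of_forall_ultrafilter fun _ h𝒱 ht =>
      (consVal_mem S h𝒱 Φ b s).2 (((consVal_mem S h𝒱 Φ b t).1 ht).mono hst)⟩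

end ConsVal

include hU in
theorem FullBVStructure.nontrivial_spec {T : L.Theory} (hT : T.IsComplete) {M : Type w}
    [L.Structure M] [Nonempty M] (hM : M ⊨ T) [Nontrivial M] (hS : S.IsModel T) :
    Nontrivial (S.Spec U) := by
  obtain ⟨p, q, hpq⟩ := exists_pair_ne M
  obtain ⟨a, ha⟩ := exists_realize_of_isComplete hT hM (S.model_spec hS hU)
    (eqv (0 : Fin 2) 1).not ⟨![p, q], by simpa using hpq⟩
  exact ⟨a 0, a 1, by simpa using ha⟩

include hU in
/-- Distributions that are locally given by finitely many formulas have refinements, as finitely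
many formulas can be coded in a single one. -/
theorem exists_refinement {T : L.Theory} (hT : T.IsComplete) {M : Type w} [L.Structure M]
    [Nontrivial M] (hM : M ⊨ T) (hS : S.IsModel T) {κ : Cardinal.{u}}
    (h : ∀ (m : ℕ) (φ : L.Formula (Fin 1 ⊕ Fin m)), (κ : WithTop Cardinal.{u}) < lambdaFormula U M φ)
    (Φ : ℕ → L.Formula (Fin 1 ⊕ ℕ)) (K : ℕ) {J : Type u} (hJ : #J ≤ κ) {A : Finset J → B}
    (hA : IsDistribution A) (hAU : ∀ s, A s ∈ U)
    (hloc : ∀ (s : Finset J) (𝒱 : Order.PFilter B), IsUltrafilter 𝒱 → ∃ k : J → ℕ,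
      (∀ j ∈ s, k j < K) ∧ ∃ f : J → ℕ → S.Spec 𝒱, ∀ t ⊆ s,
        A t ∈ 𝒱 ↔ Cons (fun j => Φ (k j)) f t) :
    ∃ a : J → B, (∀ j, a j ∈ U) ∧ ∀ s, s.inf a ≤ A s := by
  -- The parameter `y 0` is compared with the entries `y (2 * k + 2)` to select formulas `Φ k`,
  -- whose own parameters are stored at odd places.
  let φ : L.Formula (Fin 1 ⊕ ℕ) := (infF (Finset.range K) fun k =>
    (eqv (.inr 0) (.inr (2 * k + 2)) ⊓
      (Φ k).relabel (Sum.elim Sum.inl fun i => Sum.inr (2 * i + 1))).not).not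
  have hφ : ∀ {W : Type u} [L.Structure W] (x : Fin 1 → W) (y : ℕ → W),
      φ.Realize (Sum.elim x y) ↔ ∃ k < K, y 0 = y (2 * k + 2) ∧
        (Φ k).Realize (Sum.elim x fun i => y (2 * i + 1)) := by
    intro W _ x y
    simp only [φ, Formula.realize_not, realize_infF, Finset.mem_range, Formula.realize_inf,
      realize_eqv, Sum.elim_inr, realize_relabel_elim, Sum.elim_inl]
    push Not
    rfl
  obtain ⟨m, φ', hφ'⟩ := exists_fin_code.{u} φ
  refine (hasMultiplicativeRefinement_iff hU).1 ((lt_lambdaPattern_iff _ _).1 (h m φ') J A hJ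
    ((isPatternDistribution_formulaPattern_iff hT hM S hS φ').2 ⟨hA, fun s 𝒱 h𝒱 => ?_⟩) hAU)
  obtain ⟨k, hk, f, hf⟩ := hloc s 𝒱 h𝒱
  have := S.nontrivial_spec h𝒱 hT hM hS
  obtain ⟨p, q, hpq⟩ := exists_pair_ne (S.Spec 𝒱)
  -- With `p` at the places `0` and `2 * k j + 2` and `q ≠ p` at the other even places, exactly the
  -- formula `Φ (k j)` is selected.
  let f' : J → ℕ → S.Spec 𝒱 := fun j n =>
    if n % 2 = 1 then f j (n / 2) else if n = 0 ∨ n = 2 * k j + 2 then p else q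
  have key : ∀ j ∈ s, ∀ x : Fin 1 → S.Spec 𝒱, φ.Realize (Sum.elim x (f' j)) ↔
      (Φ (k j)).Realize (Sum.elim x (f j)) := by
    intro j hj x
    have hodd : (fun i => f' j (2 * i + 1)) = f j := by
      ext i
      have h1 : (2 * i + 1) % 2 = 1 := by omega
      have h2 : (2 * i + 1) / 2 = i := by omega
      simp only [f', h1, h2, if_true]
    have heven : ∀ i, f' j 0 = f' j (2 * i + 2) ↔ i = k j := by
      intro i
      have h1 : (2 * i + 2) % 2 = 0 := by omega
      have h2 : (2 * i + 2 = 0 ∨ 2 * i + 2 = 2 * k j + 2) ↔ i = k j := by omega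
      by_cases h3 : i = k j
      · simp [f', h3]
      · simp [f', h1, h3, hpq]
    rw [hφ]
    simp only [heven, hodd]
    constructor
    · rintro ⟨i, -, rfl, h⟩
      exact h
    · exact fun h => ⟨_, hk j hj, rfl, h⟩
  refine ⟨fun j i => f' j i, fun t ht => (hf t ht).trans ?_⟩
  refine exists_congr fun x => forall₂_congr fun j hj => ?_
  rw [hφ', key j (ht hj)]

/-- The formula `ψ(x, y)` has the order property of length `R`. -/
def HasOrder {X : Type*} (W : Type*) [L.Structure W] (ψ : L.Formula (X ⊕ ℕ)) (R : ℕ) : Prop :=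
  ∃ (x : ℕ → X → W) (y : ℕ → ℕ → W), ∀ n < R, ∀ i < R,
    ψ.Realize (Sum.elim (x n) (y i)) ↔ n < i

theorem HasOrder.transfer {X : Type*} {T : L.Theory} (hT : T.IsComplete) {W : Type v} {W' : Type w}
    [L.Structure W] [L.Structure W'] [Nonempty W] [Nonempty W'] (hW : W ⊨ T) (hW' : W' ⊨ T)
    {ψ : L.Formula (X ⊕ ℕ)} {R : ℕ} (h : HasOrder W ψ R) : HasOrder W' ψ R := by
  let χ : L.Formula ((ℕ × X) ⊕ (ℕ × ℕ)) := infF (Finset.range R ×ˢ Finset.range R) fun p =>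
    combF {Q : Set Unit | () ∈ Q ↔ p.1 < p.2} fun _ =>
      ψ.relabel (Sum.elim (fun i => .inl (p.1, i)) fun i => .inr (p.2, i))
  obtain ⟨x, y, h⟩ := h
  obtain ⟨a, ha⟩ := exists_realize_of_isComplete hT hW hW' χ
    ⟨Sum.elim (fun p => x p.1 p.2) fun p => y p.1 p.2, by
      simp only [χ, realize_infF, realize_combF, realize_relabel_elim, Set.mem_ofPred_eq,
        Finset.mem_product, Finset.mem_range, Sum.elim_inl, Sum.elim_inr]
      exact fun p hp => h _ hp.1 _ hp.2⟩
  simp only [χ, realize_infF, realize_combF, realize_relabel_elim, Set.mem_ofPred_eq,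
    Finset.mem_product, Finset.mem_range] at ha
  exact ⟨fun n i => a (.inl (n, i)), fun n i => a (.inr (n, i)), fun n hn i hi =>
    ha (n, i) ⟨hn, hi⟩⟩

section Context

variable [Countable L.Symbols] {T : L.Theory} (hT : T.IsComplete) {M : Type w} [L.Structure M]
  [Nontrivial M] (hM : M ⊨ T) (hS : S.IsModel T) {κ : Cardinal.{u}} (hκ : ℵ₀ ≤ κ)
  (hsat : S.IsSuccSaturated κ)
  (h : ∀ (m : ℕ) (φ : L.Formula (Fin 1 ⊕ Fin m)), (κ : WithTop Cardinal.{u}) < lambdaFormula U M φ)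
  {Φ : ℕ → L.Formula (Fin 1 ⊕ ℕ)} (hΦ : Function.Surjective Φ) {J : Type u} (hJ : #J ≤ κ)
  (k : J → ℕ) (b : J → ℕ → N) (hb : ∀ s, consVal S (fun j => Φ (k j)) b s ∈ U)

-- Indices with `k j ≥ K` receive `⊤`. The refinements for different `K` are unrelated, and the meet
-- over all `K` may leave `U`; the combination for unbounded `k` is the remaining problem.
include hU hT hM hS h hJ hb in
omit [Countable L.Symbols] in
theorem exists_bounded_refinement (K : ℕ) : ∃ a : J → B, (∀ j, a j ∈ U) ∧
    ∀ s : Finset J, (∀ j ∈ s, k j < K) → s.inf a ≤ consVal S (fun j => Φ (k j)) b s := by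
  classical
  have hmem : ∀ {𝒱 : Order.PFilter B}, IsUltrafilter 𝒱 → ∀ s : Finset {j : J // k j < K},
      consVal S (fun j : {j : J // k j < K} => Φ (k j)) (fun j => b j) s ∈ 𝒱 ↔
        consVal S (fun j => Φ (k j)) b (s.map (Function.Embedding.subtype _)) ∈ 𝒱 := by
    intro 𝒱 h𝒱 s
    rw [consVal_mem S h𝒱, consVal_mem S h𝒱]
    simp [Cons]
  have hU' : ∀ s : Finset {j : J // k j < K},
      consVal S (fun j : {j : J // k j < K} => Φ (k j)) (fun j => b j) s ∈ U := fun s =>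
    (hmem hU s).2 (hb _)
  obtain ⟨a, ha, hle⟩ := exists_refinement S hU hT hM hS h Φ K (J := {j : J // k j < K})
    ((Cardinal.mk_subtype_le _).trans hJ) (isDistribution_consVal S hU _ _ hU') hU'
    (fun s 𝒱 h𝒱 => ⟨fun j => k j, fun j _ => j.2, fun j n => S.toSpec 𝒱 (b j n), fun t _ =>
      consVal_mem S h𝒱 _ _ _⟩)
  refine ⟨fun j => if hj : k j < K then a ⟨j, hj⟩ else ⊤, fun j => ?_, fun s hs => ?_⟩
  · dsimp only
    split_ifs with hj
    · exact ha _
    · exact U.top_mem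
  · refine le_of_forall_ultrafilter fun 𝒱 h𝒱 hm => ?_
    rw [pfilter_finset_inf_mem_iff] at hm
    have := (hmem h𝒱 (s.subtype (k · < K))).1 (𝒱.mem_of_le (hle _)
      (pfilter_finset_inf_mem_iff.2 fun j hj => by
        simpa [j.2] using hm j (Finset.mem_subtype.1 hj)))
    rwa [Finset.subtype_map_of_mem hs] at this

include hU hT hM hS hκ hsat h hΦ hJ hb in
/-- The case of an unstable theory. -/
theorem exists_refinement_of_hasOrder {ψ : L.Formula (Fin 1 ⊕ ℕ)} (hψ : ∀ R, HasOrder M ψ R) :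
    ∃ a : J → B, (∀ j, a j ∈ U) ∧
      ∀ s : Finset J, s.inf a ≤ consVal S (fun j => Φ (k j)) b s := by
  classical
  choose a haU ha using exists_bounded_refinement S hU hT hM hS h (Φ := Φ) hJ k b hb
  -- The meet of what the levels up to `n` demand of `j`; it decreases with `n`. A finite set whose
  -- largest index has `k j₀` needs only `e j (k j₀ + 1)` for its members `j`.
  let e : J → ℕ → B := fun j n => (Finset.Ioc (k j) n).inf fun K => a K j
  have heU : ∀ j n, e j n ∈ U := fun j n => pfilter_finset_inf_mem_iff.2 fun K _ => haU K j
  have hanti : ∀ j {n n' : ℕ}, n ≤ n' → e j n' ≤ e j n := fun j n n' hn =>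
    Finset.inf_mono (Finset.Ioc_subset_Ioc_right hn)
  -- At an ultrafilter, `j` is placed at the point `y i` of a long order, with `i` the first `n` for
  -- which `e j n` is missing. Then `ψ(x, y i)` is consistent with the negations of `ψ(x, y 0), …,
  -- ψ(x, y n)` exactly if `n < i`, that is, if `e j n` is in the ultrafilter.
  let Ψ : ℕ ⊕ J → L.Formula (Fin 1 ⊕ ℕ) := Sum.elim (fun _ => ψ.not) fun _ => ψ
  let χ : (J × ℕ) ⊕ (Finset J × ℕ) → L.Formula (PEmpty.{u + 1} ⊕ ((ℕ ⊕ J) × ℕ)) :=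
    Sum.elim (fun p => (consF Ψ ((Finset.range (p.2 + 1)).disjSum {p.1})).not.relabel Sum.inr)
      fun p => (consF Ψ ((Finset.range (p.2 + 1)).disjSum p.1)).relabel Sum.inr
  have hIdx : #(ℕ ⊕ J) ≤ κ := by
    rw [Cardinal.mk_sum]
    simpa using Cardinal.add_le_of_le hκ hκ hJ
  obtain ⟨g, hg⟩ := S.exists_realization hκ hsat (P := PEmpty.{u + 1}) (C := (ℕ ⊕ J) × ℕ) (by simp)
    (by
      rw [Cardinal.mk_prod, Cardinal.lift_uzero, Cardinal.mk_nat, Cardinal.lift_aleph0]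
      exact Cardinal.mul_le_of_le hκ hIdx hκ)
    PEmpty.elim χ (Sum.elim (fun p => (e p.1 p.2)ᶜ) fun p => p.1.inf fun j => e j p.2) (by
      intro s 𝒱 h𝒱 hs
      -- The order is long enough for every level mentioned in `s`, with one more position, `R - 1`,
      -- for indices `j` that miss none of the `e j n`.
      let R : ℕ := s.sup (Sum.elim Prod.snd Prod.snd) + 2
      have hR : ∀ k ∈ s, Sum.elim Prod.snd Prod.snd k + 1 < R := fun k hk => by
        have := Finset.le_sup (f := Sum.elim Prod.snd Prod.snd) hk
        omega
      obtain ⟨x, y, hxy⟩ := (hψ R).transfer hT hM (S.model_spec hS h𝒱)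
      have hi : ∀ j, ∃ i < R, (∀ n, e j n ∈ 𝒱 → n + 1 < R → n < i) ∧
          ∀ n, e j n ∉ 𝒱 → n + 1 < R → i ≤ n := by
        intro j
        by_cases hex : ∃ n, e j n ∉ 𝒱 ∧ n + 1 < R
        · have hsp := Nat.find_spec hex
          refine ⟨Nat.find hex, by omega, fun n hn _ => ?_, fun n hn hnR =>
            Nat.find_min' hex ⟨hn, hnR⟩⟩
          by_contra hc
          exact hsp.1 (𝒱.mem_of_le (hanti j (not_lt.1 hc)) hn)
        · push Not at hex
          refine ⟨R - 1, by omega, fun n _ hnR => by omega, fun n hn hnR => ?_⟩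
          have := hex n hn
          omega
      choose i hiR hi1 hi2 using hi
      refine ⟨fun p => Sum.elim y (fun j => y (i j)) p.1 p.2, fun p hp => ?_⟩
      have hpR := hR p hp
      have hpV := hs p hp
      rcases p with ⟨j, n⟩ | ⟨t, n⟩
      · simp only [χ, Sum.elim_inl, Formula.realize_relabel, Sum.elim_comp_inr, realize_consF,
          Formula.realize_not] at hpR hpV ⊢
        rintro ⟨z, hz⟩
        have hle := hi2 j n (h𝒱.compl_mem.1 hpV) hpR
        have h1 := hz (.inl (i j)) (by simp; omega)
        have h2 := hz (.inr j) (by simp)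
        simp only [Ψ, Sum.elim_inl, Sum.elim_inr, Formula.realize_not] at h1 h2
        exact h1 h2
      · simp only [χ, Sum.elim_inr, Formula.realize_relabel, Sum.elim_comp_inr,
          realize_consF] at hpR hpV ⊢
        rw [pfilter_finset_inf_mem_iff] at hpV
        refine ⟨x n, ?_⟩
        rintro (i' | j) hj
        · have hin : i' < n + 1 := by simpa using hj
          simp only [Ψ, Sum.elim_inl, Formula.realize_not]
          rw [hxy n (by omega) i' (by omega)]
          omega
        · have hjt : j ∈ t := by simpa using hj
          simp only [Ψ, Sum.elim_inr]
          rw [hxy n (by omega) _ (hiR j)]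
          exact hi1 j n (hpV j hjt) hpR)
  have real : ∀ {𝒱 : Order.PFilter B}, IsUltrafilter 𝒱 → ∀ p,
      Sum.elim (fun p => (e p.1 p.2)ᶜ) (fun p => p.1.inf fun j => e j p.2) p ∈ 𝒱 →
      (χ p).Realize fun i => S.toSpec 𝒱 (Sum.elim PEmpty.elim g i) := fun h𝒱 p hp =>
    (S.realize_spec h𝒱 (χ p) _).2 (Order.PFilter.mem_of_le (hg p) hp)
  have hneg : ∀ {𝒱 : Order.PFilter B}, IsUltrafilter 𝒱 → ∀ j n,
      consVal S Ψ (fun i y => g (i, y)) ((Finset.range (n + 1)).disjSum {j}) ∈ 𝒱 → e j n ∈ 𝒱 := by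
    intro 𝒱 h𝒱 j n hc
    by_contra hn
    have := real h𝒱 (.inl (j, n)) (h𝒱.compl_mem.2 hn)
    simp only [χ, Sum.elim_inl, Formula.realize_relabel, Function.comp_def, Sum.elim_inr,
      realize_consF, Formula.realize_not] at this
    exact this ((consVal_mem S h𝒱 _ _ _).1 hc)
  have hD : ∀ u, consVal S Ψ (fun i y => g (i, y)) u ∈ U := by
    intro u
    have := real hU (.inr (u.toRight, u.toLeft.sup id))
      (pfilter_finset_inf_mem_iff.2 fun j _ => heU j _)
    simp only [χ, Formula.realize_relabel, Function.comp_def, Sum.elim_inr, realize_consF] at this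
    refine (consVal_mem S hU _ _ _).2 (this.mono ?_)
    rintro (i | j) hj
    · have := Finset.le_sup (f := id) (Finset.mem_toLeft.2 hj)
      simp only [Finset.inl_mem_disjSum, Finset.mem_range]
      simp only [id] at this
      omega
    · simpa using hj
  obtain ⟨i₁, hi₁⟩ := hΦ ψ
  obtain ⟨i₂, hi₂⟩ := hΦ ψ.not
  -- Only `ψ` and its negation occur in this distribution, so it has a refinement.
  obtain ⟨d, hdU, hd⟩ := exists_refinement S hU hT hM hS h Φ (i₁ + i₂ + 1) hIdx
    (isDistribution_consVal S hU _ _ hD) hD (fun s 𝒱 h𝒱 => ⟨Sum.elim (fun _ => i₂) fun _ => i₁,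
      by rintro (j | j) _ <;> simp, fun i y => S.toSpec 𝒱 (g (i, y)), fun t _ => by
        rw [consVal_mem S h𝒱]
        refine iff_of_eq (congrArg (fun Φ => Cons Φ _ t) ?_)
        ext (j | j) <;> simp [Ψ, hi₁, hi₂]⟩)
  -- An index `j₀` with `k j₀` maximal contributes the negated instances up to `k j₀ + 1`; together
  -- with `d (.inr j)` they force `e j (k j₀ + 1)` for every `j` in the set.
  refine ⟨fun j => d (.inr j) ⊓ (Finset.range (k j + 2)).inf fun i => d (.inl i), fun j =>
    pfilter_inf_mem_iff.2 ⟨hdU _, pfilter_finset_inf_mem_iff.2 fun i _ => hdU _⟩, fun s => ?_⟩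
  rcases s.eq_empty_or_nonempty with rfl | hne
  · rw [consVal_empty]
    exact le_top
  obtain ⟨j₀, hj₀, hmax⟩ := s.exists_max_image k hne
  refine le_of_forall_ultrafilter fun 𝒱 h𝒱 hm => ?_
  rw [pfilter_finset_inf_mem_iff] at hm
  simp only [pfilter_inf_mem_iff, pfilter_finset_inf_mem_iff] at hm
  refine 𝒱.mem_of_le (ha (k j₀ + 1) s fun j hj => Nat.lt_succ_of_le (hmax j hj))
    (pfilter_finset_inf_mem_iff.2 fun j hj => ?_)
  have h1 : e j (k j₀ + 1) ∈ 𝒱 := by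
    refine hneg h𝒱 j _ (𝒱.mem_of_le (hd _) (pfilter_finset_inf_mem_iff.2 ?_))
    rintro (i | j') hi
    · exact (hm j₀ hj₀).2 i (by simpa [Nat.lt_succ_iff] using hi)
    · have : j' = j := by simpa using hi
      exact this ▸ (hm j hj).1
  exact pfilter_finset_inf_mem_iff.1 h1 _
    (Finset.mem_Ioc.2 ⟨Nat.lt_succ_of_le (hmax j hj), le_rfl⟩)

end Context

end Refinements

/-! ## Approximations of types in stable theories -/

section Stable

variable {L : FirstOrder.Language.{0, 0}} {X : Type*}

theorem HasOrder.mono {W : Type*} [L.Structure W] {ψ : L.Formula (X ⊕ ℕ)} {R R' : ℕ}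
    (h : HasOrder W ψ R') (hR : R ≤ R') : HasOrder W ψ R := by
  obtain ⟨x, y, h⟩ := h
  exact ⟨x, y, fun n hn i hi => h n (hn.trans_le hR) i (hi.trans_le hR)⟩

/-- A sequence of points such that few of them violate a formula that holds almost everywhere. -/
theorem exists_approximation {W : Type*} [L.Structure W] [Nonempty W] (F : Ultrafilter (X → W))
    {ι : Type*} (s : Finset ι) (Ψ : ι → L.Formula (X ⊕ ℕ)) : ∃ a : ℕ → X → W, ∀ j ∈ s, ∀ m,
      ¬ HasOrder W (Ψ j) m → ∀ y : ℕ → W, (∀ᶠ x in F, (Ψ j).Realize (Sum.elim x y)) →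
      ∀ bad : Finset ℕ, (∀ i ∈ bad, ¬ (Ψ j).Realize (Sum.elim (a i) y)) → bad.card < m := by
  classical
  let good : ι → Finset (X → W) → (ℕ → W) → Prop := fun j Z y =>
    (∀ᶠ x in F, (Ψ j).Realize (Sum.elim x y)) ∧ ∀ z ∈ Z, ¬ (Ψ j).Realize (Sum.elim z y)
  -- For each set `Z`, fix one parameter, if there is any, whose formula holds almost everywhere but
  -- fails on all of `Z`.
  have hw : ∀ j Z, ∃ y, (∃ y, good j Z y) → good j Z y := by
    intro j Z
    by_cases h : ∃ y, good j Z y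
    · obtain ⟨y, hy⟩ := h
      exact ⟨y, fun _ => hy⟩
    · exact ⟨fun _ => Classical.arbitrary W, fun h' => absurd h' h⟩
  choose w hw using hw
  -- The next point satisfies all conditions coming from sets of earlier points: they are finitely
  -- many, and each holds almost everywhere.
  have hpick : ∀ Z : Finset (X → W), ∃ x, ∀ j ∈ s, ∀ Z' ∈ Z.powerset, good j Z' (w j Z') →
      (Ψ j).Realize (Sum.elim x (w j Z')) := by
    intro Z
    have : ∀ᶠ x in F, ∀ j ∈ s, ∀ Z' ∈ Z.powerset, good j Z' (w j Z') →
        (Ψ j).Realize (Sum.elim x (w j Z')) := by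
      rw [Filter.eventually_all_finset]
      intro j _
      rw [Filter.eventually_all_finset]
      intro Z' _
      by_cases h : good j Z' (w j Z')
      · filter_upwards [h.1] with x hx _ using hx
      · exact Filter.Eventually.of_forall fun x h' => absurd h' h
    exact this.exists
  choose pick hpick using hpick
  let g : ℕ → Finset (X → W) := fun n => Nat.rec ∅ (fun _ Z => insert (pick Z) Z) n
  have hg : ∀ {i n}, i < n → pick (g i) ∈ g n := by
    intro i n hin
    induction n with
    | zero => omega
    | succ n ih =>
      change _ ∈ insert (pick (g n)) (g n)
      rcases Nat.lt_succ_iff_lt_or_eq.1 hin with h | rfl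
      · exact Finset.mem_insert_of_mem (ih h)
      · exact Finset.mem_insert_self _ _
  refine ⟨fun n => pick (g n), fun j hj m hm y hy bad hbad => ?_⟩
  by_contra hlt
  refine hm (HasOrder.mono ?_ (not_lt.1 hlt))
  let i : ℕ → ℕ := fun q => if h : q < bad.card then bad.orderEmbOfFin rfl ⟨q, h⟩ else 0
  have hi : ∀ q < bad.card, i q ∈ bad := fun q hq => by
    simp [i, hq]
  have himono : ∀ q q', q < q' → q' < bad.card → i q < i q' := fun q q' hqq hq' => by
    simp [i, hq', hqq.trans hq', hqq]
  let Z : ℕ → Finset (X → W) := fun r => (Finset.range (r + 1)).image fun q => pick (g (i q))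
  have hZ : ∀ r < bad.card, good j (Z r) (w j (Z r)) := by
    intro r hr
    refine hw j (Z r) ⟨y, hy, fun z hz => ?_⟩
    obtain ⟨q, hq, rfl⟩ := Finset.mem_image.1 hz
    exact hbad _ (hi q ((Nat.lt_succ_iff.1 (Finset.mem_range.1 hq)).trans_lt hr))
  -- The parameter fixed for the bad points up to the `r`-th fails at these and holds at the later
  -- ones. This half graph, read backwards, is an order of length `bad.card`.
  have key : ∀ q < bad.card, ∀ r < bad.card,
      (Ψ j).Realize (Sum.elim (pick (g (i q))) (w j (Z r))) ↔ r < q := by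
    intro q hq r hr
    constructor
    · intro h
      by_contra hc
      exact (hZ r hr).2 _ (Finset.mem_image_of_mem _
        (Finset.mem_range.2 (Nat.lt_succ_of_le (not_lt.1 hc)))) h
    · intro h
      refine hpick _ j hj _ (Finset.mem_powerset.2 fun z hz => ?_) (hZ r hr)
      obtain ⟨q', hq', rfl⟩ := Finset.mem_image.1 hz
      exact hg (himono q' q ((Nat.lt_succ_iff.1 (Finset.mem_range.1 hq')).trans_lt h) hq)
  refine ⟨fun n => pick (g (i (bad.card - 1 - n))), fun n => w j (Z (bad.card - 1 - n)),
    fun n hn i' hi' => ?_⟩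
  rw [key _ (by omega) _ (by omega)]
  omega

/-- At least half of the first `2 * m` points satisfy the formula. -/
def MajorityHolds {W : Type*} [L.Structure W] (ψ : L.Formula (X ⊕ ℕ)) (m : ℕ) (e : ℕ → X → W)
    (y : ℕ → W) : Prop :=
  ∃ t ∈ (Finset.range (2 * m)).powersetCard m, ∀ i ∈ t, ψ.Realize (Sum.elim (e i) y)

/-- The formula defining `MajorityHolds`. -/
def majorityF (ψ : L.Formula (X ⊕ ℕ)) (m : ℕ) : L.Formula ((ℕ × X) ⊕ ℕ) :=
  (infF ((Finset.range (2 * m)).powersetCard m) fun t =>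
    (infF t fun i => ψ.relabel (Sum.elim (fun x => .inl (i, x)) .inr)).not).not

theorem realize_majorityF {W : Type*} [L.Structure W] (ψ : L.Formula (X ⊕ ℕ)) (m : ℕ)
    (c : ℕ × X → W) (y : ℕ → W) : (majorityF ψ m).Realize (Sum.elim c y) ↔
      MajorityHolds ψ m (fun i x => c (i, x)) y := by
  simp only [majorityF, Formula.realize_not, realize_infF, realize_relabel_elim, Sum.elim_inl,
    Sum.elim_inr, MajorityHolds]
  push Not
  rfl

/-- For formulas without long orders, an ultrafilter on points is approximated on finitely many
formulas by a sequence of points. -/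
theorem exists_majority {W : Type*} [L.Structure W] [Nonempty W] (F : Ultrafilter (X → W))
    {Φ : ℕ → L.Formula (X ⊕ ℕ)} {m : ℕ → ℕ} (hm : ∀ k, ¬ HasOrder W (Φ k) (m k))
    (hm' : ∀ k, ¬ HasOrder W (Φ k).not (m k)) (K : ℕ) : ∃ a : ℕ → X → W, ∀ k < K, ∀ y : ℕ → W,
      (MajorityHolds (Φ k) (m k) a y ↔ ∀ᶠ x in F, (Φ k).Realize (Sum.elim x y)) ∧
      ((∀ᶠ x in F, (Φ k).Realize (Sum.elim x y)) → ∀ bad : Finset ℕ,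
        (∀ i ∈ bad, ¬ (Φ k).Realize (Sum.elim (a i) y)) → bad.card < m k) := by
  classical
  -- Both the formulas and their negations are approximated, so that among `2 * m k` points fewer
  -- than `m k` vote against the ultrafilter.
  obtain ⟨a, ha⟩ := exists_approximation F (Finset.range K ×ˢ (Finset.univ : Finset Bool))
    fun p => if p.2 then Φ p.1 else (Φ p.1).not
  refine ⟨a, fun k hk y => ?_⟩
  have h1 : (∀ᶠ x in F, (Φ k).Realize (Sum.elim x y)) → ∀ bad : Finset ℕ,
      (∀ i ∈ bad, ¬ (Φ k).Realize (Sum.elim (a i) y)) → bad.card < m k := fun h bad hbad =>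
    ha (k, true) (by simpa using hk) (m k) (by simpa using hm k) y (by simpa using h) bad
      (by simpa using hbad)
  have h2 : (¬ ∀ᶠ x in F, (Φ k).Realize (Sum.elim x y)) → ∀ bad : Finset ℕ,
      (∀ i ∈ bad, (Φ k).Realize (Sum.elim (a i) y)) → bad.card < m k := fun h bad hbad =>
    ha (k, false) (by simpa using hk) (m k) (by simpa using hm' k) y
      (by simpa [← Ultrafilter.eventually_not] using h) bad (by simpa using hbad)
  refine ⟨⟨fun ⟨t, ht, h⟩ => ?_, fun h => ?_⟩, h1⟩
  · by_contra hn
    exact (h2 hn t h).ne (Finset.mem_powersetCard.1 ht).2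
  · have h3 := h1 h ((Finset.range (2 * m k)).filter fun i => ¬ (Φ k).Realize (Sum.elim (a i) y))
      fun i hi => (Finset.mem_filter.1 hi).2
    have h4 := Finset.card_filter_add_card_filter_not (s := Finset.range (2 * m k))
      fun i => (Φ k).Realize (Sum.elim (a i) y)
    rw [Finset.card_range] at h4
    obtain ⟨t, ht, hc⟩ := Finset.exists_subset_card_eq (n := m k) (s := (Finset.range (2 * m k)).filter
      fun i => (Φ k).Realize (Sum.elim (a i) y)) (by omega)
    exact ⟨t, Finset.mem_powersetCard.2 ⟨ht.trans (Finset.filter_subset _ _), hc⟩,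
      fun i hi => (Finset.mem_filter.1 (ht hi)).2⟩

end Stable

/-! ## Refinements from simplices -/

section Simplices

/-- The element is a disjunctive normal form; with it, finitary conditions on traces at ultrafilters
become elements of the algebra. -/
theorem exists_comb {ι B : Type*} [Finite ι] [BooleanAlgebra B] (P : Set (Set ι)) (f : ι → B) :
    ∃ c : B, ∀ 𝒱 : Order.PFilter B, IsUltrafilter 𝒱 → (c ∈ 𝒱 ↔ {i | f i ∈ 𝒱} ∈ P) := by
  classical
  cases nonempty_fintype ι
  refine ⟨((Finset.univ : Finset (Set ι)).filter (· ∈ P)).sup fun Z =>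
    Finset.univ.inf fun i => if i ∈ Z then f i else (f i)ᶜ, fun 𝒱 h𝒱 => ?_⟩
  rw [h𝒱.finset_sup_mem]
  have key : ∀ Z : Set ι, ((Finset.univ.inf fun i => if i ∈ Z then f i else (f i)ᶜ) ∈ 𝒱) ↔
      {i | f i ∈ 𝒱} = Z := by
    intro Z
    rw [pfilter_finset_inf_mem_iff, Set.ext_iff]
    simp only [Finset.mem_univ, true_imp_iff, Set.mem_ofPred_eq]
    refine forall_congr' fun i => ?_
    split_ifs with h
    · simp [h]
    · simp [h, h𝒱.compl_mem]
  simp only [key, Finset.mem_filter, Finset.mem_univ, true_and]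
  exact ⟨fun ⟨Z, h, e⟩ => e ▸ h, fun h => ⟨_, h, rfl⟩⟩

/-- The complements of the `C r` have join `⊤`, so ultrafilters containing every `C r`, such as `U`
in the application, can be ignored when an inequality is tested. -/
theorem le_of_iInf_eq_bot {B : Type*} [CompleteBooleanAlgebra B] {C : ℕ → B} (hC : ⨅ r, C r = ⊥)
    {a b : B} (h : ∀ U : Order.PFilter B, IsUltrafilter U → a ∈ U → (∃ r, C r ∉ U) → b ∈ U) :
    a ≤ b := by
  have h1 : ∀ r, a ⊓ (C r)ᶜ ≤ b := fun r => le_of_forall_ultrafilter fun U hU hm => by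
    rw [pfilter_inf_mem_iff] at hm
    exact h U hU hm.1 ⟨r, hU.compl_mem.1 hm.2⟩
  calc a = a ⊓ ⨆ r, (C r)ᶜ := by rw [← compl_iInf, hC, compl_bot, inf_top_eq]
    _ = ⨆ r, a ⊓ (C r)ᶜ := inf_iSup_eq _ _
    _ ≤ b := iSup_le h1

variable {L : FirstOrder.Language.{0, 0}} {B : Type u} [CompleteBooleanAlgebra B] {N : Type u}
  (S : FullBVStructure L B N) {U : Order.PFilter B} (hU : IsUltrafilter U)
  {T : L.Theory} (hT : T.IsComplete) {M : Type w} [L.Structure M]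
  [Nontrivial M] (hM : M ⊨ T) (hS : S.IsModel T) {κ : Cardinal.{u}} (hκ : ℵ₀ ≤ κ)
  (h : ∀ (m : ℕ) (φ : L.Formula (Fin 1 ⊕ Fin m)), (κ : WithTop Cardinal.{u}) < lambdaFormula U M φ)
  {Φ : ℕ → L.Formula (Fin 1 ⊕ ℕ)} (hΦ : Function.Surjective Φ) {J : Type u} (hJ : #J ≤ κ)

include hU hT hM hS hκ h hΦ hJ in
/-- If there are arbitrarily large finite systems of formulas all of whose proper subsystems are
consistent, then uniformly finite exceptional sets can be avoided. -/
theorem exists_refinement_of_simplices {A : Finset J → B} {C : ℕ → B} (hC0 : C 0 = ⊤)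
    (hanti : Antitone C) (hCU : ∀ r, C r ∈ U) (hC : ⨅ r, C r = ⊥) {l : ℕ → ℕ} (hl : ∀ r, r ≤ l r)
    {g : ∀ r, Fin (l r + 1) → ℕ} {K : ℕ} (hgK : ∀ r i, g r i < K)
    (hg : ∀ r (𝒱 : Order.PFilter B), IsUltrafilter 𝒱 → ∃ y : Fin (l r + 1) → ℕ → S.Spec 𝒱,
      ∀ t : Finset (Fin (l r + 1)), Cons (fun i => Φ (g r i)) y t ↔ t ≠ Finset.univ)
    {k : J → ℕ} {m : J → ℕ} {δ : J → B} (hδ : ∀ j, δ j ∈ U) {β : ∀ r, J → Fin (l r + 1) → B}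
    (hβ : ∀ 𝒱 : Order.PFilter B, IsUltrafilter 𝒱 → ∀ r j, k j < r → C r ∈ 𝒱 → δ j ∈ 𝒱 →
      {i | β r j i ∈ 𝒱}.ncard < m j)
    (hA : ∀ 𝒱 : Order.PFilter B, IsUltrafilter 𝒱 → ∀ r (s : Finset J),
      (∃ i, ∀ j ∈ s, β r j i ∉ 𝒱) → A s ∈ 𝒱) :
    ∃ a : J → B, (∀ j, a j ∈ U) ∧ ∀ s, s.inf a ≤ A s := by
  classical
  -- The pair `(j, t)` hits the bad index of `j` that has exactly `t` bad indices below it. Each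
  -- pair hits at most one vertex, and the pairs with `t < m j` reach all bad indices of `j` if
  -- there are fewer than `m j`.
  let Hit : Order.PFilter B → (r : ℕ) → J × ℕ → Fin (l r + 1) → Prop := fun 𝒱 r p i =>
    β r p.1 i ∈ 𝒱 ∧ p.2 = {i' | β r p.1 i' ∈ 𝒱 ∧ i' < i}.ncard
  have hHit : ∀ 𝒱 r p i i', Hit 𝒱 r p i → Hit 𝒱 r p i' → i = i' := by
    have : ∀ 𝒱 r p i i', Hit 𝒱 r p i → Hit 𝒱 r p i' → ¬ i < i' := by
      intro 𝒱 r p i i' h1 h2 hlt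
      refine (Set.ncard_lt_ncard (t := {q | β r p.1 q ∈ 𝒱 ∧ q < i'})
        (Set.ssubset_iff_exists.2 ⟨fun q hq => ⟨hq.1, hq.2.trans hlt⟩, i, ⟨h1.1, hlt⟩, fun hi =>
          lt_irrefl _ hi.2⟩) (Set.toFinite _)).ne (h1.2.symm.trans h2.2)
    exact fun 𝒱 r p i i' h1 h2 => le_antisymm (not_lt.1 (this _ _ _ _ _ h2 h1))
      (not_lt.1 (this _ _ _ _ _ h1 h2))
  have hζ : ∀ r p i, ∃ c : B, ∀ 𝒱 : Order.PFilter B, IsUltrafilter 𝒱 → (c ∈ 𝒱 ↔ Hit 𝒱 r p i) :=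
    fun r p i => exists_comb {Z | i ∈ Z ∧ p.2 = {i' | i' ∈ Z ∧ i' < i}.ncard} (β r p.1)
  choose ζ hζ using hζ
  let Cover : Order.PFilter B → ℕ → Finset (J × ℕ) → Prop := fun 𝒱 r s =>
    ∀ i, ∃ p ∈ s, Hit 𝒱 r p i
  have hcard : ∀ 𝒱 r s, Cover 𝒱 r s → r < s.card := by
    intro 𝒱 r s hc
    choose p hp hp' using hc
    have := Finset.card_le_card_of_injOn (s := Finset.univ) (t := s) p (fun i _ => hp i)
      fun i _ i' _ e => hHit 𝒱 r (p i) i i' (hp' i) (e ▸ hp' i')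
    rw [Finset.card_univ, Fintype.card_fin] at this
    have := hl r
    omega
  -- On the layer where `C r` holds and `C (r + 1)` fails, `D s` says that `s` leaves some vertex of
  -- the `r`-th simplex unhit. Covering more than `r` vertices takes more than `r` pairs, so a
  -- finite join of layers suffices.
  let D : Finset (J × ℕ) → B := fun s => ((Finset.range s.card).sup fun r =>
    (C r ⊓ (C (r + 1))ᶜ) ⊓ Finset.univ.inf fun i => s.sup fun p => ζ r p i)ᶜ
  have hD : ∀ {𝒱 : Order.PFilter B}, IsUltrafilter 𝒱 → ∀ s, D s ∈ 𝒱 ↔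
      ∀ r, C r ∈ 𝒱 → C (r + 1) ∉ 𝒱 → ¬ Cover 𝒱 r s := by
    intro 𝒱 h𝒱 s
    simp only [D, h𝒱.compl_mem, h𝒱.finset_sup_mem, pfilter_inf_mem_iff,
      pfilter_finset_inf_mem_iff, hζ _ _ _ 𝒱 h𝒱, Finset.mem_range, Finset.mem_univ, true_imp_iff]
    constructor
    · exact fun hn r h1 h2 h3 => hn ⟨r, hcard _ _ _ h3, ⟨h1, h2⟩, h3⟩
    · rintro hn ⟨r, -, ⟨h1, h2⟩, h3⟩
      exact hn r h1 h2 h3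
  have hDU : ∀ s, D s ∈ U := fun s => (hD hU s).2 fun r _ h2 => absurd (hCU _) h2
  have hmono : ∀ 𝒱 r s t, s ⊆ t → Cover 𝒱 r s → Cover 𝒱 r t := fun 𝒱 r s t hst hc i =>
    (hc i).imp fun p hp => ⟨hst hp.1, hp.2⟩
  have hdist : IsDistribution D := by
    refine ⟨fun s => hU.ne_bot (hDU s), by simp [D], fun s t hst => ?_⟩
    refine le_of_forall_ultrafilter fun 𝒱 h𝒱 ht => (hD h𝒱 s).2 fun r h1 h2 hc => ?_
    exact (hD h𝒱 t).1 ht r h1 h2 (hmono _ _ _ _ hst hc)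
  obtain ⟨k₀, hk₀⟩ := hΦ (⊤ : L.Formula (Fin 1 ⊕ ℕ))
  -- On a layer, a pair that hits a vertex is interpreted by the formula at that vertex, and every
  -- other pair by the trivial formula `Φ k₀`. Such instances are consistent exactly if a vertex is
  -- left out.
  obtain ⟨d, hdU, hd⟩ := exists_refinement S hU hT hM hS h Φ (K + k₀ + 1) (J := J × ℕ)
    (by
      rw [Cardinal.mk_prod, Cardinal.lift_uzero, Cardinal.mk_nat, Cardinal.lift_aleph0]
      exact Cardinal.mul_le_of_le hκ hJ hκ) hdist hDU (by
    intro s 𝒱 h𝒱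
    by_cases hr : ∃ r, C r ∈ 𝒱 ∧ C (r + 1) ∉ 𝒱
    · obtain ⟨r, hr, hr'⟩ := hr
      have huniq : ∀ q, C q ∈ 𝒱 → C (q + 1) ∉ 𝒱 → q = r := by
        intro q h1 h2
        rcases lt_trichotomy q r with h3 | h3 | h3
        · exact absurd (𝒱.mem_of_le (hanti h3) hr) h2
        · exact h3
        · exact absurd (𝒱.mem_of_le (hanti h3) h1) hr'
      obtain ⟨y, hy⟩ := hg r 𝒱 h𝒱
      refine ⟨fun p => if hp : ∃ i, Hit 𝒱 r p i then g r hp.choose else k₀, fun p _ => ?_,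
        fun p => if hp : ∃ i, Hit 𝒱 r p i then y hp.choose else fun _ => Classical.arbitrary _,
        fun t _ => ?_⟩
      · dsimp only
        split_ifs with hp
        · have := hgK r hp.choose
          omega
        · omega
      · have hD' : D t ∈ 𝒱 ↔ ¬ Cover 𝒱 r t := by
          rw [hD h𝒱]
          refine ⟨fun hn => hn r hr hr', fun hn q h1 h2 => ?_⟩
          rw [huniq q h1 h2]
          exact hn
        have hcov : Cover 𝒱 r t ↔ Finset.univ.filter (fun i => ∃ p ∈ t, Hit 𝒱 r p i) =
            Finset.univ := by
          simp [Cover, Finset.filter_eq_self]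
        rw [hD', hcov, ← ne_eq, ← hy]
        refine exists_congr fun x => ⟨fun hx p hp => ?_, fun hx i hi => ?_⟩
        · beta_reduce
          split_ifs with hex
          · exact hx _ (by simpa using ⟨p.1, p.2, hp, hex.choose_spec⟩)
          · rw [hk₀]
            exact Formula.realize_top.2 trivial
        · simp only [Finset.mem_filter, Finset.mem_univ, true_and] at hi
          obtain ⟨p, hp, hi⟩ := hi
          have hex : ∃ i, Hit 𝒱 r p i := ⟨i, hi⟩
          have := hx p hp
          beta_reduce at this
          rw [dif_pos hex, dif_pos hex, hHit 𝒱 r p _ _ hex.choose_spec hi] at this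
          exact this
    · push Not at hr
      refine ⟨fun _ => k₀, fun _ _ => by dsimp only; omega, fun _ _ => Classical.arbitrary _, fun t _ => ?_⟩
      refine iff_of_true ((hD h𝒱 t).2 fun r h1 h2 => absurd (hr r h1) h2)
        ⟨fun _ => Classical.arbitrary _, fun _ _ => ?_⟩
      dsimp only
      rw [hk₀]
      exact Formula.realize_top.2 trivial)
  -- The factor `C (k j + 1)` forces a layer beyond `k j`, where `hβ` bounds the bad indices of `j`;
  -- the factors `d (j, t)` ensure that the bad indices of all `j ∈ s` do not exhaust the simplex.
  refine ⟨fun j => δ j ⊓ (C (k j + 1) ⊓ (Finset.range (m j)).inf fun t => d (j, t)), fun j =>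
    pfilter_inf_mem_iff.2 ⟨hδ j, pfilter_inf_mem_iff.2 ⟨hCU _,
      pfilter_finset_inf_mem_iff.2 fun t _ => hdU _⟩⟩, fun s => ?_⟩
  refine le_of_iInf_eq_bot hC fun 𝒱 h𝒱 hs hex => ?_
  simp only [pfilter_finset_inf_mem_iff, pfilter_inf_mem_iff, Finset.mem_range] at hs
  obtain ⟨r, hr, hr'⟩ : ∃ r, C r ∈ 𝒱 ∧ C (r + 1) ∉ 𝒱 := by
    have hpos : Nat.find hex ≠ 0 := fun h0 => Nat.find_spec hex (by rw [h0, hC0]; exact 𝒱.top_mem)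
    obtain ⟨r, hr⟩ := Nat.exists_eq_succ_of_ne_zero hpos
    have h1 := Nat.find_spec hex
    rw [hr] at h1
    refine ⟨r, ?_, h1⟩
    by_contra hc
    have := Nat.find_min' hex hc
    omega
  have hkr : ∀ j ∈ s, k j < r := by
    intro j hj
    by_contra hc
    exact hr' (𝒱.mem_of_le (hanti (Nat.succ_le_succ (not_lt.1 hc))) (hs j hj).2.1)
  have hnc : ¬ Cover 𝒱 r (s.biUnion fun j => (Finset.range (m j)).image fun t => (j, t)) := by
    refine (hD h𝒱 _).1 (𝒱.mem_of_le (hd _) (pfilter_finset_inf_mem_iff.2 fun p hp => ?_)) r hr hr'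
    simp only [Finset.mem_biUnion, Finset.mem_image, Finset.mem_range] at hp
    obtain ⟨j, hj, t, ht, rfl⟩ := hp
    exact (hs j hj).2.2 t ht
  simp only [Cover, not_forall] at hnc
  obtain ⟨i, hi⟩ := hnc
  refine hA 𝒱 h𝒱 r s ⟨i, fun j hj hbad => hi
    ⟨(j, {i' | β r j i' ∈ 𝒱 ∧ i' < i}.ncard), ?_, hbad, rfl⟩⟩
  refine Finset.mem_biUnion.2 ⟨j, hj, Finset.mem_image.2 ⟨_, Finset.mem_range.2 ?_, rfl⟩⟩
  exact (Set.ncard_le_ncard (fun q hq => hq.1) (Set.toFinite _)).trans_lt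
    (hβ 𝒱 h𝒱 r j (hkr j hj) hr (hs j hj).1)

end Simplices

/-! ## Saturation from refinements -/

section Definability

variable {L : FirstOrder.Language.{0, 0}} {X : Type*} {W : Type*} [L.Structure W]

/-- Any `l` instances of the formulas `Φ k`, for `k < K`, that hold at a majority of the points of
the sequences `e k` are consistent. -/
def AllConsistent (Φ : ℕ → L.Formula (X ⊕ ℕ)) (m : ℕ → ℕ) (K l : ℕ) (e : ℕ → ℕ → X → W) : Prop :=
  ∀ (g : Fin l → Fin K) (y : Fin l → ℕ → W),
    (∀ i, MajorityHolds (Φ (g i)) (m (g i)) (e (g i)) (y i)) →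
      Cons (fun i => Φ (g i)) y Finset.univ

/-- The formula defining `AllConsistent`. -/
def allConsistentF (Φ : ℕ → L.Formula (X ⊕ ℕ)) (m : ℕ → ℕ) (K l : ℕ) : L.Formula (ℕ × ℕ × X) :=
  infF Finset.univ fun g : Fin l → Fin K => allF (β := Fin l × ℕ)
    ((infF Finset.univ fun i => (majorityF (Φ (g i)) (m (g i))).relabel
      (Sum.elim (fun p => .inl (g i, p.1, p.2)) fun n => .inr (i, n))).imp
        ((consF (fun i => Φ (g i)) Finset.univ).relabel Sum.inr))

theorem realize_allConsistentF [Nonempty W] (Φ : ℕ → L.Formula (X ⊕ ℕ)) (m : ℕ → ℕ) (K l : ℕ)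
    (c : ℕ × ℕ × X → W) : (allConsistentF Φ m K l).Realize c ↔
      AllConsistent Φ m K l fun k i x => c (k, i, x) := by
  simp only [allConsistentF, realize_infF, Finset.mem_univ, true_imp_iff, realize_allF,
    Formula.realize_imp, realize_relabel_elim, Sum.elim_inl, Sum.elim_inr, realize_majorityF,
    AllConsistent]
  simp only [Formula.realize_relabel, Sum.elim_comp_inr, realize_consF]
  exact forall_congr' fun g => ⟨fun h y => h fun p => y p.1 p.2, fun h y => h fun i n => y (i, n)⟩

/-- If one of the formulas `Φ k`, for `k < r`, holds at a majority of the points of the sequence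
`e k`, then it fails at fewer than `m k` of the first `l + 1` points of `a`. -/
def HoldsMostly (Φ : ℕ → L.Formula (X ⊕ ℕ)) (m : ℕ → ℕ) (r l : ℕ) (e : ℕ → ℕ → X → W)
    (a : ℕ → X → W) : Prop :=
  ∀ k < r, ∀ y : ℕ → W, MajorityHolds (Φ k) (m k) (e k) y →
    ∀ t ∈ (Finset.range (l + 1)).powersetCard (m k), ∃ i ∈ t, (Φ k).Realize (Sum.elim (a i) y)

/-- The formula defining `HoldsMostly`. -/
def holdsMostlyF (Φ : ℕ → L.Formula (X ⊕ ℕ)) (m : ℕ → ℕ) (r l : ℕ) :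
    L.Formula ((ℕ × ℕ × X) ⊕ (ℕ × X)) :=
  infF (Finset.range r) fun k => allF (β := ℕ) (((majorityF (Φ k) (m k)).relabel
    (Sum.elim (fun p => .inl (.inl (k, p.1, p.2))) .inr)).imp
      (infF ((Finset.range (l + 1)).powersetCard (m k)) fun t => (infF t fun i =>
        ((Φ k).relabel (Sum.elim (fun x => .inl (.inr (i, x))) .inr)).not).not))

theorem realize_holdsMostlyF [Nonempty W] (Φ : ℕ → L.Formula (X ⊕ ℕ)) (m : ℕ → ℕ) (r l : ℕ)
    (c : ℕ × ℕ × X → W) (a : ℕ × X → W) : (holdsMostlyF Φ m r l).Realize (Sum.elim c a) ↔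
      HoldsMostly Φ m r l (fun k i x => c (k, i, x)) fun i x => a (i, x) := by
  simp only [holdsMostlyF, realize_infF, Finset.mem_range, realize_allF, Formula.realize_imp,
    realize_relabel_elim, Sum.elim_inl, Sum.elim_inr, realize_majorityF, Formula.realize_not,
    HoldsMostly]
  push Not
  rfl

end Definability

section Context

variable {L : FirstOrder.Language.{0, 0}} {B : Type u} [CompleteBooleanAlgebra B] {N : Type u}
  (S : FullBVStructure L B N) {U : Order.PFilter B} (hU : IsUltrafilter U)

include hU in
theorem FullBVStructure.realize_spec_elim {α β : Type*} (φ : L.Formula (α ⊕ β)) (f : α → N)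
    (g : β → N) : S.val (φ.relabel (Sum.elim f g)) ∈ U ↔
      φ.Realize (Sum.elim (fun i => S.toSpec U (f i)) fun i => S.toSpec U (g i)) := by
  rw [← S.realize_spec hU]
  refine iff_of_eq (congrArg φ.Realize ?_)
  ext (i | i) <;> rfl

variable {T : L.Theory} (hT : T.IsComplete) {M : Type w} [L.Structure M]
  [Nontrivial M] (hM : M ⊨ T) (hS : S.IsModel T) {κ : Cardinal.{u}} (hκ : ℵ₀ ≤ κ)
  (h : ∀ (m : ℕ) (φ : L.Formula (Fin 1 ⊕ Fin m)), (κ : WithTop Cardinal.{u}) < lambdaFormula U M φ)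
  {Φ : ℕ → L.Formula (Fin 1 ⊕ ℕ)} (hΦ : Function.Surjective Φ) {J : Type u} (hJ : #J ≤ κ)
  (k : J → ℕ) (b : J → ℕ → N) (hb : ∀ s, consVal S (fun j => Φ (k j)) b s ∈ U)

omit [L.Structure M] [Nontrivial M] in
include hT hS in
/-- If sufficiently small families of majority instances are consistent but not all of them are,
then there is a finite system all of whose proper subsystems are consistent. -/
theorem exists_simplex {m : ℕ → ℕ} {K : ℕ} {e : ℕ → ℕ → Fin 1 → N} {c : B} (hc : c ≠ ⊥) {r : ℕ}
    (h1 : ∀ l ≤ r, c ≤ S.val ((allConsistentF Φ m K l).relabel fun p => e p.1 p.2.1 p.2.2))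
    (h2 : c ≤ (⨅ l, S.val ((allConsistentF Φ m K l).relabel fun p => e p.1 p.2.1 p.2.2))ᶜ) :
    ∃ l, r ≤ l ∧ ∃ g : Fin (l + 1) → ℕ, (∀ i, g i < K) ∧ ∀ 𝒱 : Order.PFilter B, IsUltrafilter 𝒱 →
      ∃ y : Fin (l + 1) → ℕ → S.Spec 𝒱,
        ∀ t : Finset (Fin (l + 1)), Cons (fun i => Φ (g i)) y t ↔ t ≠ Finset.univ := by
  classical
  let θ : ℕ → B := fun l => S.val ((allConsistentF Φ m K l).relabel fun p => e p.1 p.2.1 p.2.2)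
  have hθ : ∀ {𝒱 : Order.PFilter B}, IsUltrafilter 𝒱 → ∀ l, θ l ∈ 𝒱 ↔
      AllConsistent Φ m K l fun k i x => S.toSpec 𝒱 (e k i x) := fun h𝒱 l =>
    (S.realize_spec h𝒱 _ _).symm.trans (realize_allConsistentF _ _ _ _ _)
  have hex : ∃ l, c ⊓ (θ l)ᶜ ≠ ⊥ := by
    by_contra hn
    push Not at hn
    refine hc (le_bot_iff.1 ?_)
    calc c ≤ (⨅ l, θ l) ⊓ (⨅ l, θ l)ᶜ := le_inf (le_iInf fun l => by
          rw [← sdiff_eq_bot_iff, sdiff_eq]; exact hn l) h2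
      _ = ⊥ := inf_compl_self _
  obtain ⟨l₀, hl₀⟩ := hex
  obtain ⟨𝒲, h𝒲, hm⟩ := exists_ultrafilter hl₀
  rw [pfilter_inf_mem_iff] at hm
  have hex : ∃ l, θ l ∉ 𝒲 := ⟨l₀, h𝒲.compl_mem.1 hm.2⟩
  -- At the first length where consistency fails, there is an inconsistent system all of whose
  -- subsystems with one member removed are consistent. The bounds `h1` make it larger than `r`.
  have hr : r < Nat.find hex := by
    by_contra hc
    exact Nat.find_spec hex (𝒲.mem_of_le (h1 _ (not_lt.1 hc)) hm.1)
  obtain ⟨l, hl⟩ := Nat.exists_eq_succ_of_ne_zero (Nat.ne_zero_of_lt hr)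
  have hspec := Nat.find_spec hex
  have hprev : θ l ∈ 𝒲 := by
    by_contra hc
    have := Nat.find_min' hex hc
    omega
  rw [hl, hθ h𝒲] at hspec
  rw [hθ h𝒲] at hprev
  simp only [AllConsistent, not_forall] at hspec
  obtain ⟨g, y, hy, hyc⟩ := hspec
  refine ⟨l, by omega, fun i => g i, fun i => (g i).2, fun 𝒱 h𝒱 => ?_⟩
  obtain ⟨a, ha⟩ := exists_realize_of_isComplete hT (S.model_spec hS h𝒲) (S.model_spec hS h𝒱)
    (patternF (fun i => Φ (g i)) Finset.univ (· ≠ Finset.univ)) ⟨fun p => y p.1 p.2, by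
      rw [realize_patternF]
      refine fun t _ => ⟨fun ht => ?_, fun ht htu => hyc (htu ▸ ht)⟩
      obtain ⟨i₀, hi₀⟩ : ∃ i₀, i₀ ∉ t := by
        by_contra hn
        push Not at hn
        exact ht (Finset.eq_univ_of_forall hn)
      obtain ⟨x, hx⟩ := hprev (fun i => g (i₀.succAbove i)) (fun i => y (i₀.succAbove i))
        fun i => hy _
      refine ⟨x, fun i hi => ?_⟩
      obtain ⟨i', rfl⟩ := Fin.exists_succAbove_eq (x := i) (y := i₀) (fun h => hi₀ (h ▸ hi))
      exact hx i' (Finset.mem_univ _)⟩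
  exact ⟨fun i n => a (i, n), fun t => ((realize_patternF _ _ _ _).1 ha t
    (Finset.subset_univ t)).symm⟩

include hU hT hM hS hκ h hΦ hJ hb in
/-- The case of a stable theory. -/
theorem exists_refinement_of_not_hasOrder
    (hψ : ∀ ψ : L.Formula (Fin 1 ⊕ ℕ), ∃ R, ¬ HasOrder M ψ R) :
    ∃ a : J → B, (∀ j, a j ∈ U) ∧
      ∀ s : Finset J, s.inf a ≤ consVal S (fun j => Φ (k j)) b s := by
  classical
  have hSU := S.model_spec hS hU
  have hm : ∀ k, ∃ m, ¬ HasOrder (S.Spec U) (Φ k) m ∧ ¬ HasOrder (S.Spec U) (Φ k).not m := by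
    intro k
    obtain ⟨R, hR⟩ := hψ (Φ k)
    obtain ⟨R', hR'⟩ := hψ (Φ k).not
    exact ⟨max R R', fun hc => hR ((hc.mono (le_max_left _ _)).transfer hT hSU hM),
      fun hc => hR' ((hc.mono (le_max_right _ _)).transfer hT hSU hM)⟩
  choose m hm hm' using hm
  obtain ⟨F, hF⟩ := Ultrafilter.exists_ultrafilter_of_finite_inter_nonempty
    (Set.range fun j => {x : Fin 1 → S.Spec U |
      (Φ (k j)).Realize (Sum.elim x fun n => S.toSpec U (b j n))}) (by
    intro t ht
    obtain ⟨s, rfl⟩ : ∃ s : Finset J, t = s.image fun j => {x : Fin 1 → S.Spec U |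
        (Φ (k j)).Realize (Sum.elim x fun n => S.toSpec U (b j n))} := by
      rw [← Set.image_univ] at ht
      obtain ⟨s, -, rfl⟩ := Finset.subset_set_image_iff.1 ht
      exact ⟨s, rfl⟩
    obtain ⟨x, hx⟩ := (consVal_mem S hU _ _ s).1 (hb s)
    refine ⟨x, ?_⟩
    simpa using hx)
  have hFb : ∀ j, ∀ᶠ x in F, (Φ (k j)).Realize (Sum.elim x fun n => S.toSpec U (b j n)) :=
    fun j => hF ⟨j, rfl⟩
  -- The vote on `Φ k` uses the sequence for `K = k + 1`, which depends on `k` alone; the sequences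
  -- `e' r` reappear below as candidate solutions at layer `r`.
  choose e' he' using fun K => exists_majority F hm hm' K
  choose e he using fun K i x => S.toSpec_surjective (U := U) (e' (K + 1) i x)
  have hmaj : ∀ k (y : ℕ → S.Spec U), MajorityHolds (Φ k) (m k) (fun i x => S.toSpec U (e k i x)) y ↔
      ∀ᶠ x in F, (Φ k).Realize (Sum.elim x y) := by
    intro k y
    simp only [he]
    exact (he' (k + 1) k (Nat.lt_succ_self k) y).1
  let δ : J → B := fun j =>
    S.val ((majorityF (Φ (k j)) (m (k j))).relabel (Sum.elim (fun p => e (k j) p.1 p.2) (b j)))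
  have hδ : ∀ {𝒱 : Order.PFilter B}, IsUltrafilter 𝒱 → ∀ j, δ j ∈ 𝒱 ↔
      MajorityHolds (Φ (k j)) (m (k j)) (fun i x => S.toSpec 𝒱 (e (k j) i x))
        fun n => S.toSpec 𝒱 (b j n) := fun h𝒱 j =>
    (S.realize_spec_elim h𝒱 _ _ _).trans (realize_majorityF _ _ _ _)
  have hδU : ∀ j, δ j ∈ U := fun j => (hδ hU j).2 ((hmaj _ _).2 (hFb j))
  let θ : ℕ → ℕ → B := fun K l =>
    S.val ((allConsistentF Φ m K l).relabel fun p => e p.1 p.2.1 p.2.2)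
  have hθ : ∀ {𝒱 : Order.PFilter B}, IsUltrafilter 𝒱 → ∀ K l, θ K l ∈ 𝒱 ↔
      AllConsistent Φ m K l fun k i x => S.toSpec 𝒱 (e k i x) := fun h𝒱 K l =>
    (S.realize_spec h𝒱 _ _).symm.trans (realize_allConsistentF _ _ _ _ _)
  have hθU : ∀ K l, θ K l ∈ U := by
    refine fun K l => (hθ hU K l).2 fun g y hy => ?_
    simp only [hmaj] at hy
    obtain ⟨x, hx⟩ := (Filter.eventually_all.2 hy).exists
    exact ⟨x, fun i _ => hx i⟩
  -- Each `θ K l` is in `U`, because finitely many majority instances hold together almost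
  -- everywhere for `F`; the infinite meet over `l` need not be.
  by_cases hW : ∀ K, ⨅ l, θ K l ∈ U
  · refine ⟨fun j => δ j ⊓ ⨅ l, θ (k j + 1) l, fun j => pfilter_inf_mem_iff.2 ⟨hδU j, hW _⟩,
      fun s => le_of_forall_ultrafilter fun 𝒱 h𝒱 hs => ?_⟩
    simp only [pfilter_finset_inf_mem_iff, pfilter_inf_mem_iff] at hs
    rcases s.eq_empty_or_nonempty with rfl | hne
    · rw [consVal_empty]
      exact 𝒱.top_mem
    obtain ⟨j₀, hj₀, hmax⟩ := s.exists_max_image k hne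
    obtain ⟨x, hx⟩ := (hθ h𝒱 (k j₀ + 1) s.card).1 (𝒱.mem_of_le (iInf_le _ _) (hs j₀ hj₀).2)
      (fun i => ⟨k (s.equivFin.symm i), Nat.lt_succ_of_le (hmax _ (s.equivFin.symm i).2)⟩)
      (fun i n => S.toSpec 𝒱 (b (s.equivFin.symm i) n))
      fun i => (hδ h𝒱 _).1 (hs _ (s.equivFin.symm i).2).1
    refine (consVal_mem S h𝒱 _ _ s).2 ⟨x, fun j hj => ?_⟩
    have := hx (s.equivFin ⟨j, hj⟩) (Finset.mem_univ _)
    simpa using this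
  · push Not at hW
    obtain ⟨K, hK⟩ := hW
    -- Each `C' r` is in `U`, and hence nonzero, although their meet is `⊥`: more than `r` instances
    -- are needed for an inconsistency, but there is one. This yields a simplex for every `r`.
    let C' : ℕ → B := fun r => ((Finset.range (r + 1)).inf (θ K)) ⊓ (⨅ l, θ K l)ᶜ
    have hC'U : ∀ r, C' r ∈ U := fun r => pfilter_inf_mem_iff.2
      ⟨pfilter_finset_inf_mem_iff.2 fun l _ => hθU K l, hU.compl_mem.2 hK⟩
    have hC'θ : ∀ r, ∀ l ≤ r, C' r ≤ θ K l := fun r l hl =>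
      inf_le_left.trans (Finset.inf_le (Finset.mem_range.2 (Nat.lt_succ_of_le hl)))
    choose l hl g hgK hg using fun r =>
      exists_simplex S hT hS (Φ := Φ) (hU.ne_bot (hC'U r)) (hC'θ r) inf_le_right
    choose a ha using fun r i x => S.toSpec_surjective (U := U) (e' r i x)
    -- This value bounds the number of vertices `i` at which the point `a r i` violates a majority
    -- instance of a formula below `r`; the points themselves are the solutions offered by unhit
    -- vertices.
    let σ : ℕ → B := fun r => S.val ((holdsMostlyF Φ m r (l r)).relabel
      (Sum.elim (fun p => e p.1 p.2.1 p.2.2) fun p => a r p.1 p.2))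
    have hσ : ∀ {𝒱 : Order.PFilter B}, IsUltrafilter 𝒱 → ∀ r, σ r ∈ 𝒱 ↔
        HoldsMostly Φ m r (l r) (fun k i x => S.toSpec 𝒱 (e k i x)) fun i x =>
          S.toSpec 𝒱 (a r i x) := fun h𝒱 r =>
      (S.realize_spec_elim h𝒱 _ _ _).trans (realize_holdsMostlyF _ _ _ _ _ _)
    have hσU : ∀ r, σ r ∈ U := by
      refine fun r => (hσ hU r).2 fun k hk y hy t ht => ?_
      rw [hmaj] at hy
      by_contra hn
      push Not at hn
      simp only [ha] at hn
      exact ((he' r k hk y).2 hy t hn).ne (Finset.mem_powersetCard.1 ht).2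
    -- The shift gives `C 0 = ⊤`, and makes `C r` lie below `σ r` for every positive `r`.
    let C : ℕ → B := fun r => (Finset.range r).inf fun q => C' q ⊓ σ (q + 1)
    have hCle : ∀ q r, q < r → C r ≤ C' q ⊓ σ (q + 1) := fun q r hq =>
      Finset.inf_le (Finset.mem_range.2 hq)
    refine exists_refinement_of_simplices S hU hT hM hS hκ h hΦ hJ (C := C) (by simp [C])
      (fun q r hqr => Finset.inf_mono (Finset.range_mono hqr))
      (fun r => pfilter_finset_inf_mem_iff.2 fun q _ => pfilter_inf_mem_iff.2 ⟨hC'U q, hσU _⟩)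
      (le_bot_iff.1 ?_) hl hgK hg (k := k) (m := fun j => m (k j)) hδU
      (β := fun r j i => (S.val ((Φ (k j)).relabel (Sum.elim (a r i) (b j))))ᶜ) ?_ ?_
    · calc ⨅ r, C r ≤ (⨅ l, θ K l) ⊓ (⨅ l, θ K l)ᶜ := le_inf
            (le_iInf fun l => (iInf_le _ (l + 1)).trans ((hCle l _ (Nat.lt_succ_self l)).trans
              (inf_le_left.trans (hC'θ l l le_rfl))))
            ((iInf_le _ 1).trans ((hCle 0 _ Nat.one_pos).trans (inf_le_left.trans inf_le_right)))
        _ = ⊥ := inf_compl_self _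
    · intro 𝒱 h𝒱 r j hkr hC hδj
      obtain ⟨q, rfl⟩ := Nat.exists_eq_succ_of_ne_zero (Nat.ne_zero_of_lt hkr)
      have h1 := (hσ h𝒱 (q + 1)).1 (pfilter_inf_mem_iff.1
        (𝒱.mem_of_le (hCle q _ (Nat.lt_succ_self q)) hC)).2 (k j) hkr _ ((hδ h𝒱 j).1 hδj)
      by_contra hlt
      obtain ⟨t, ht, hcard⟩ := Finset.exists_subset_card_eq (n := m (k j))
        (s := Finset.univ.filter fun i : Fin (l (q + 1) + 1) =>
          (S.val ((Φ (k j)).relabel (Sum.elim (a (q + 1) i) (b j))))ᶜ ∈ 𝒱) (by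
          rw [not_lt, Set.ncard_eq_toFinset_card'] at hlt
          refine hlt.trans (Finset.card_le_card fun i hi => ?_)
          simpa using hi)
      obtain ⟨i, hi, hi'⟩ := h1 (t.map Fin.valEmbedding) (by
        rw [Finset.mem_powersetCard, Finset.card_map]
        refine ⟨fun i hi => ?_, hcard⟩
        obtain ⟨i', -, rfl⟩ := Finset.mem_map.1 hi
        exact Finset.mem_range.2 i'.2)
      obtain ⟨i, hit, rfl⟩ := Finset.mem_map.1 hi
      refine h𝒱.compl_mem.1 (Finset.mem_filter.1 (ht hit)).2 ?_
      rw [S.realize_spec_elim h𝒱]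
      exact hi'
    · rintro 𝒱 h𝒱 r s ⟨i, hi⟩
      refine (consVal_mem S h𝒱 _ _ s).2 ⟨fun x => S.toSpec 𝒱 (a r i x), fun j hj => ?_⟩
      have := hi j hj
      rw [h𝒱.compl_mem, not_not, S.realize_spec_elim h𝒱] at this
      exact this

variable [Countable L.Symbols] (hsat : S.IsSuccSaturated κ)

-- The type is its own index set, of size at most `κ` since the language is countable. Once its
-- consistency values have a multiplicative refinement `a`, saturation of `S` gives one element
-- satisfying each formula with value at least the corresponding `a j`, and it realizes the type at
-- `U`.
include hU hT hM hS hκ h hsat in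
theorem isSuccSaturated_spec : IsSuccSaturated L (S.Spec U) κ := by
  classical
  obtain ⟨Φ, hΦ⟩ := exists_surjective_nat (L.Formula (Fin 1 ⊕ ℕ))
  intro A hA p hp
  let c : p → L.Formula (S.Spec U ⊕ Fin 1) := fun φ => φ.1.relabel (Sum.map Subtype.val fun _ => 0)
  choose k hk using fun φ : p => hΦ ((codeF (c φ)).relabel Sum.swap)
  choose b hb using fun (φ : p) (n : ℕ) => S.toSpec_surjective (codeV (c φ) n)
  have hreal : ∀ (φ : p) (x : Fin 1 → S.Spec U),
      (Φ (k φ)).Realize (Sum.elim x fun n => S.toSpec U (b φ n)) ↔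
        φ.1.Realize (Sum.elim (fun a : A => (a : S.Spec U)) fun _ => x 0) := by
    intro φ x
    have := realize_codeF (c φ) id x
    simp only [hk, hb, Formula.realize_relabel, Sum.elim_swap]
    refine this.trans ?_
    simp only [c, Formula.realize_relabel]
    refine iff_of_eq (congrArg φ.1.Realize ?_)
    ext (i | i) <;> rfl
  have hJ : #p ≤ κ := by
    refine (Cardinal.mk_subtype_le _).trans ?_
    have h1 : #(L.Formula (A ⊕ Unit)) ≤ #(Σ n, L.BoundedFormula (A ⊕ Unit) n) :=
      Cardinal.mk_le_of_injective (f := fun φ => ⟨0, φ⟩) fun φ ψ e => by simpa using e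
    refine (h1.trans BoundedFormula.card_le).trans (max_le hκ ?_)
    have hL : L.card ≤ ℵ₀ := Cardinal.mk_le_aleph0
    refine Cardinal.add_le_of_le hκ ?_ ?_
    · rw [Cardinal.lift_uzero, Cardinal.mk_sum]
      refine Cardinal.add_le_of_le hκ (by simpa using hA) ?_
      exact (Cardinal.lift_lt_aleph0.2 (Cardinal.lt_aleph0_of_finite _)).le.trans hκ
    · exact (Cardinal.lift_le_aleph0.2 hL).trans hκ
  have hbU : ∀ s, consVal S (fun φ => Φ (k φ)) b s ∈ U := by
    intro s
    obtain ⟨x, hx⟩ := hp (s.map (Function.Embedding.subtype _)) (by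
      intro φ hφ
      obtain ⟨ψ, -, rfl⟩ := Finset.mem_map.1 hφ
      exact ψ.2)
    exact (consVal_mem S hU _ _ _).2 ⟨fun _ => x, fun φ hφ =>
      (hreal φ _).2 (hx _ (Finset.mem_map_of_mem _ hφ))⟩
  obtain ⟨a, haU, ha⟩ : ∃ a : p → B, (∀ j, a j ∈ U) ∧
      ∀ s : Finset p, s.inf a ≤ consVal S (fun φ => Φ (k φ)) b s := by
    by_cases hψ : ∃ ψ : L.Formula (Fin 1 ⊕ ℕ), ∀ R, HasOrder M ψ R
    · obtain ⟨ψ, hψ⟩ := hψ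
      exact exists_refinement_of_hasOrder S hU hT hM hS hκ hsat h hΦ hJ k b hbU hψ
    · push Not at hψ
      exact exists_refinement_of_not_hasOrder S hU hT hM hS hκ h hΦ hJ k b hbU hψ
  obtain ⟨g, hg⟩ := S.exists_realization hκ hsat (P := p × ℕ) (C := ULift.{u} (Fin 1))
    (by
      rw [Cardinal.mk_prod, Cardinal.lift_uzero, Cardinal.mk_nat, Cardinal.lift_aleph0]
      exact Cardinal.mul_le_of_le hκ hJ hκ)
    ((Cardinal.lt_aleph0_of_finite _).le.trans hκ) (fun i => b i.1 i.2)
    (fun φ => (Φ (k φ)).relabel (Sum.elim (fun x => .inr ⟨x⟩) fun n => .inl (φ, n))) a (by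
      intro s 𝒱 h𝒱 hs
      obtain ⟨x, hx⟩ := (consVal_mem S h𝒱 _ _ s).1
        (𝒱.mem_of_le (ha s) (pfilter_finset_inf_mem_iff.2 hs))
      refine ⟨fun i => x i.down, fun φ hφ => ?_⟩
      rw [realize_relabel_elim]
      exact hx φ hφ)
  refine ⟨S.toSpec U (g ⟨0⟩), fun φ hφ => ?_⟩
  have := (S.realize_spec hU _ _).2 (U.mem_of_le (hg ⟨φ, hφ⟩) (haU _))
  rw [realize_relabel_elim] at this
  have := (hreal ⟨φ, hφ⟩ fun i => S.toSpec U (g ⟨i⟩)).1 this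
  exact this

end Context

section Main

variable {L : FirstOrder.Language.{0, 0}} [Countable L.Symbols] {B : Type u}
  [CompleteBooleanAlgebra B] {U : Order.PFilter B} (hU : IsUltrafilter U) {T : L.Theory}
  (hT : T.IsComplete) {M : Type w} [L.Structure M] [Nonempty M] (hM : M ⊨ T)

-- Coding several formulas into one takes two distinct elements. If `M` has only one, so has the
-- specialization, and its finitely satisfiable types are realized trivially.
include hU hT hM in
theorem succSaturates_of_lt_lambdaFormula {κ : Cardinal.{u}} (hκ : ℵ₀ ≤ κ)
    (h : ∀ (m : ℕ) (φ : L.Formula (Fin 1 ⊕ Fin m)),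
      (κ : WithTop Cardinal.{u}) < lambdaFormula U M φ) : SuccSaturates U T κ := by
  have : Nontrivial B := ⟨⊤, ⊥, hU.ne_bot U.top_mem⟩
  obtain ⟨N, S, hST, hS⟩ := exists_saturated (B := B) hT.1 hκ
  refine ⟨N, S, hST, hS, ?_⟩
  rcases subsingleton_or_nontrivial M with hsub | hnt
  · have : Subsingleton (S.Spec U) := by
      refine ⟨fun p q => by_contra fun hpq => ?_⟩
      obtain ⟨a, ha⟩ := exists_realize_of_isComplete hT (S.model_spec hST hU) hM
        (eqv (0 : Fin 2) 1).not ⟨![p, q], by simpa using hpq⟩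
      exact (Formula.realize_not.1 ha) ((realize_eqv _ _ _).2 (Subsingleton.elim _ _))
    intro A _ p hp
    refine ⟨Classical.arbitrary _, fun φ hφ => ?_⟩
    obtain ⟨x, hx⟩ := hp {φ} (by simpa using hφ)
    rw [Subsingleton.elim (Classical.arbitrary _) x]
    exact hx φ (by simp)
  · exact isSuccSaturated_spec S hU hT hM hST hκ h hS

include hU in
omit [Countable L.Symbols] [Nonempty M] in
theorem aleph0_le_of_lambdaFormula_eq {n m : ℕ} {φ : L.Formula (Fin n ⊕ Fin m)} {κ : Cardinal.{u}}
    (h : lambdaFormula U M φ = κ) : ℵ₀ ≤ κ := by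
  by_contra hκ
  refine (lt_irrefl (κ : WithTop Cardinal.{u})) (h ▸ (lt_lambdaPattern_iff _ κ).2 ?_)
  intro J A hJ hA hm
  have : Finite J := Cardinal.lt_aleph0_iff_finite.1 (hJ.trans_lt (not_le.1 hκ))
  exact hasMultiplicativeRefinement_of_finite hU hA.1 hm

include hU hT hM in
theorem lambdaTheory_le {n m : ℕ} (φ : L.Formula (Fin n ⊕ Fin m)) :
    lambdaTheory U T ≤ lambdaFormula U M φ := by
  rcases h : lambdaFormula U M φ with _ | κ
  · exact le_top
  · have hκ := aleph0_le_of_lambdaFormula_eq hU h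
    refine sInf_le ⟨κ, ⟨hκ, fun hs => ?_⟩, rfl⟩
    exact (lt_lambdaFormula_of_succSaturates hU hT hM hκ hs φ).ne h.symm

-- The least cardinal at which saturation fails is attained by well-ordering; if every one-variable
-- formula had a larger invariant, saturation would hold there. If saturation never fails, any
-- formula will do.
include hU hT hM in
theorem exists_lambdaFormula_eq : ∃ (m : ℕ) (φ : L.Formula (Fin 1 ⊕ Fin m)),
    lambdaTheory U T = lambdaFormula U M φ := by
  suffices ∃ (m : ℕ) (φ : L.Formula (Fin 1 ⊕ Fin m)), lambdaFormula U M φ ≤ lambdaTheory U T by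
    obtain ⟨m, φ, h⟩ := this
    exact ⟨m, φ, le_antisymm (lambdaTheory_le hU hT hM φ) h⟩
  rcases Set.eq_empty_or_nonempty {κ : Cardinal.{u} | ℵ₀ ≤ κ ∧ ¬ SuccSaturates U T κ} with he | hne
  · refine ⟨0, ⊤, ?_⟩
    rw [lambdaTheory, he, Set.image_empty, WithTop.sInf_empty]
    exact le_top
  · obtain ⟨κ, ⟨hκ, hs⟩, e⟩ := csInf_mem (hne.image ((↑) : Cardinal.{u} → WithTop Cardinal.{u}))
    by_contra hn
    push Not at hn
    refine hs (succSaturates_of_lt_lambdaFormula hU hT hM hκ fun m φ => ?_)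
    have := hn m φ
    rwa [lambdaTheory, ← e] at this

end Main

end

end BVPatterns

open BVPatterns

theorem theorem7p7 {B : Type u} [CompleteBooleanAlgebra B] (U : Order.PFilter B)
    (hU : IsUltrafilter U) :
    (∀ (κ : Cardinal.{u}) (V : ZFSet.{u}), V.IsTransitive → IsModelZFCMinus V →
      ∀ (N : Type u) (S : FullBVStructure setLang B N) (i : V → N),
        IsElementaryInto S.toBVStructure i → S.IsSuccSaturated κ →
        ∀ (I Δ : V) (hΔ : IsPatternOn (Δ : ZFSet.{u}) (I : ZFSet.{u})),
          (κ : WithTop Cardinal.{u}) < lambdaPattern U (setPattern hΔ) ↔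
            (κ : WithTop Cardinal.{u}) < lambdaModel (fun a : V => S.toSpec U (i a)) Δ I) ∧
    (∀ (L : FirstOrder.Language.{0, 0}) [Countable L.Symbols] (T : L.Theory), T.IsComplete →
      ∀ (M : Type w) [L.Structure M] [Nonempty M], M ⊨ T →
        IsLeast {κ : WithTop Cardinal.{u} |
          ∃ (n m : ℕ) (φ : L.Formula (Fin n ⊕ Fin m)), κ = lambdaFormula U M φ}
          (lambdaTheory U T) ∧
        IsLeast {κ : WithTop Cardinal.{u} |
          ∃ (m : ℕ) (φ : L.Formula (Fin 1 ⊕ Fin m)), κ = lambdaFormula U M φ}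
          (lambdaTheory U T)) := by
  refine ⟨fun κ V hV hZ N S i hi hS I Δ hΔ =>
    lt_lambdaPattern_iff_lt_lambdaModel hU hV hZ S hi hS I Δ hΔ, fun L _ T hT M _ _ hM => ?_⟩
  obtain ⟨m, φ, h⟩ := exists_lambdaFormula_eq hU hT hM
  refine ⟨⟨⟨1, m, φ, h⟩, ?_⟩, ⟨m, φ, h⟩, ?_⟩
  · rintro _ ⟨n, m, φ, rfl⟩
    exact lambdaTheory_le hU hT hM φ
  · rintro _ ⟨m, φ, rfl⟩
    exact lambdaTheory_le hU hT hM φ
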